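/- All 2-categories are strict ($\mathcal{C}at$-enriched) and 2-functors are strict. "Small" is relative to a fixed universe, and $\mathcal{C}$ is a locally small 2-category (its hom-categories are small). **2-filtered.** A 2-category $\mathcal{A}$ is 2-filtered if: (F0) for all objects $a,b$ there are an object $c$ and 1-cells $a\to c$, $b\to c$; (F1) for all 1-cells $f,g:a\to b$ there are $h:b\to c$ and an invertible 2-cell $hf\cong hg$; (F2) for all 2-cells $\alpha,\beta:f\Rightarrow g:a\to b$ there is $h:b\to c$ with $h\alpha=h\beta$. **2-pro-objects.** A 2-pro-object of $\mathcal{C}$ is a 2-functor $\mathsf{X}:\mathcal{I}^{op}\to\mathcal{C}$ with $\mathcal{I}$ a small 2-filtered 2-category. Let $\mathsf{L}_{\mathsf X}:\mathcal{C}\to\mathcal{C}at$ be the 2-functor $D\mapsto \mathrm{colim}_{i}\,\mathcal{C}(\mathsf{X}_i,D)$ (pseudocolimit in $\mathcal{C}at$). The 2-category $2\text{-}\mathcal{P}ro(\mathcal{C})$ has the 2-pro-objects as objects, the 2-natural transformations $\mathsf{L}_{\mathsf Y}\Rightarrow \mathsf{L}_{\mathsf X}$ as 1-cells $\mathsf{X}\to\mathsf{Y}$,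 and the modifications as 2-cells. An object $A$ of $\mathcal{C}$ is regarded as the 2-pro-object indexed by the terminal 2-category with value $A$; this gives a 2-functor $\mathcal{C}\to 2\text{-}\mathcal{P}ro(\mathcal{C})$, which we suppress from the notation. For $i\in\mathcal{I}$ let $\pi_i:\mathsf{X}\to\mathsf{X}_i$ be the 1-cell corresponding to the object $(i,\mathrm{id}_{\mathsf{X}_i})$ of $\mathrm{colim}_{i'}\,\mathcal{C}(\mathsf{X}_{i'},\mathsf{X}_i)$. **Representing data.** Let $f,g:\mathsf{X}\to\mathsf{Y}$ be 1-cells and $\alpha:f\Rightarrow g$ a 2-cell in $2\text{-}\mathcal{P}ro(\mathcal{C})$. A pair $(\mathsf r,\varphi)$ with $\mathsf r:\mathsf{X}_i\to\mathsf{Y}_j$ in $\mathcal{C}$ represents $f$ if $\varphi:\pi_j f\Rightarrow \mathsf r\pi_i$ is an invertible 2-cell. If $(\mathsf r,\varphi)$ represents $f$ and $(\mathsf s,\psi)$ represents $g$ (with the same $i,j$), then $(\theta,\mathsf r,\varphi,\mathsf s,\psi)$ with $\theta:\mathsf r\Rightarrow\mathsf s$ represents $\alpha$ if $(\theta\pi_i)\circ\varphi=\psi\circ(\pi_j\alpha)$.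 **Pseudolimits.** Let $F:\mathcal{A}\to\mathcal{B}$ be a 2-functor. A pseudocone over $F$ with vertex $W$ is a pseudonatural transformation from the constant 2-functor at $W$ to $F$; with the modifications these form a category $\mathsf{PC}(W,F)$. A pseudocone $\pi$ with vertex $L$ is universal, and then $L$ (with $\pi$) is the pseudolimit $\mathrm{Lim}\,F$, if for every $W$ precomposition $\mathcal{B}(W,L)\to\mathsf{PC}(W,F)$, $f\mapsto\pi f$, is an isomorphism of categories. **Theorem.** Let $\mathcal{J}$ be a small 2-filtered 2-category and let $\mathsf{X}:\mathcal{J}^{op}\to 2\text{-}\mathcal{P}ro(\mathcal{C})$ be a 2-functor, with $\mathsf{X}^j=\{\mathsf{X}^j_i\}_{i\in\mathcal{I}_j}$. Let $\mathcal{K}_{\mathsf X}$ be the 2-category given as follows. * Objects: pairs $(i,j)$ with $j\in\mathcal{J}$ and $i\in\mathcal{I}_j$. * 1-cells $(i,j)\to(i',j')$: triples $(a,\mathsf r,\varphi)$ with $a:j\to j'$ in $\mathcal{J}$, $\mathsf r:\mathsf{X}^{j'}_{i'}\to\mathsf{X}^{j}_{i}$ in $\mathcal{C}$, and $(\mathsf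 r,\varphi)$ representing $\mathsf{X}^a:\mathsf{X}^{j'}\to\mathsf{X}^j$. * 2-cells $(a,\mathsf r,\varphi)\Rightarrow(b,\mathsf s,\psi)$: pairs $(\alpha,\theta)$ with $\alpha:a\Rightarrow b$ in $\mathcal{J}$, $\theta:\mathsf r\Rightarrow\mathsf s$ in $\mathcal{C}$, and $(\theta,\mathsf r,\varphi,\mathsf s,\psi)$ representing $\mathsf{X}^\alpha$. * Compositions: $(a',\mathsf r',\varphi')(a,\mathsf r,\varphi)=(a'a,\ \mathsf r\mathsf r',\ \mathsf r\varphi'\circ\varphi\mathsf{X}^{a'})$, $(\alpha',\theta')(\alpha,\theta)=(\alpha'\alpha,\theta\theta')$, $(\beta,\eta)\circ(\alpha,\theta)=(\beta\circ\alpha,\eta\circ\theta)$. Then $\mathcal{K}_{\mathsf X}$ is small and 2-filtered. Consequently the 2-functor $\widetilde{\mathsf X}:\mathcal{K}_{\mathsf X}^{op}\to\mathcal{C}$ given by $\widetilde{\mathsf X}_{(i,j)}=\mathsf{X}^j_i$, $\widetilde{\mathsf X}_{(a,\mathsf r,\varphi)}=\mathsf r$, $\widetilde{\mathsf X}_{(\alpha,\theta)}=\theta$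 is a 2-pro-object of $\mathcal{C}$. Moreover $$\widetilde{\mathsf X}=\mathrm{Lim}_{j\in\mathcal{J}^{op}}\mathsf{X}^j\quad\text{in } 2\text{-}\mathcal{P}ro(\mathcal{C}),$$ that is, there is a universal pseudocone over $\mathsf{X}$ with vertex $\widetilde{\mathsf X}$. -/

import Mathlib

universe w₁ w₂ v₃ v₁ v₂ u₁ u₂ v u

namespace TwoPro

open CategoryTheory Bicategory Opposite

section Colimit

variable {I : Type u₁} [Bicategory.{w₁, v₁} I] {C : Type u₂} [Bicategory.{w₂, v₂} C]

/-- The transition 1-cell `X_s : X_j ⟶ X_i` of a diagram indexed by `Iᵒᵖ`. -/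
abbrev tr (X : Pseudofunctor Iᵒᵖ C) {i j : I} (s : i ⟶ j) : X.obj (op j) ⟶ X.obj (op i) :=
  X.map s.op

abbrev tr₂ (X : Pseudofunctor Iᵒᵖ C) {i j : I} {s t : i ⟶ j} (α : s ⟶ t) : tr X s ⟶ tr X t :=
  X.map₂ (Bicategory.Opposite.op2 α)

abbrev trId (X : Pseudofunctor Iᵒᵖ C) (i : I) : tr X (𝟙 i) ≅ 𝟙 (X.obj (op i)) :=
  X.mapId (op i)

abbrev trComp (X : Pseudofunctor Iᵒᵖ C) {i j k : I} (s : i ⟶ j) (t : j ⟶ k) :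
    tr X (s ≫ t) ≅ tr X t ≫ tr X s :=
  X.mapComp t.op s.op

/-- Objects of the pseudocolimit of the categories `C(X_i, D)`: pairs of an index `i` and an object
of `C(X_i, D)`. -/
structure ColimObj (X : Pseudofunctor Iᵒᵖ C) (D : C) where
  idx : I
  arr : X.obj (op idx) ⟶ D

/-- Formal morphisms of the pseudocolimit of the categories `C(X_i, D)`. The generators are the
morphisms of the categories `C(X_i, D)` and the invertible structure 2-cells `up` (with formal
inverse `down`) of a pseudocone. -/
inductive Word (X : Pseudofunctor Iᵒᵖ C) (D : C) :
    ColimObj X D → ColimObj X D → Type (max u₁ v₁ v₂ w₂)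
  | id (x : ColimObj X D) : Word X D x x
  | comp {x y z : ColimObj X D} (p : Word X D x y) (q : Word X D y z) : Word X D x z
  | cell (i : I) {r s : X.obj (op i) ⟶ D} (θ : r ⟶ s) : Word X D ⟨i, r⟩ ⟨i, s⟩
  | up {i j : I} (s : i ⟶ j) (r : X.obj (op i) ⟶ D) : Word X D ⟨i, r⟩ ⟨j, tr X s ≫ r⟩
  | down {i j : I} (s : i ⟶ j) (r : X.obj (op i) ⟶ D) : Word X D ⟨j, tr X s ≫ r⟩ ⟨i, r⟩

open Word in
/-- The congruence generated by the category laws, the functoriality of the inclusions of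
`C(X_i, D)`, and the pseudocone equations for `up`. -/
inductive Rel (X : Pseudofunctor Iᵒᵖ C) (D : C) :
    ∀ {x y : ColimObj X D}, Word X D x y → Word X D x y → Prop
  | refl {x y : ColimObj X D} (p : Word X D x y) : Rel X D p p
  | symm {x y : ColimObj X D} {p q : Word X D x y} : Rel X D p q → Rel X D q p
  | trans {x y : ColimObj X D} {p q r : Word X D x y} : Rel X D p q → Rel X D q r → Rel X D p r
  | comp_congr {x y z : ColimObj X D} {p p' : Word X D x y} {q q' : Word X D y z} :
      Rel X D p p' → Rel X D q q' → Rel X D (comp p q) (comp p' q')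
  | id_comp {x y : ColimObj X D} (p : Word X D x y) : Rel X D (comp (id x) p) p
  | comp_id {x y : ColimObj X D} (p : Word X D x y) : Rel X D (comp p (id y)) p
  | assoc {x y z t : ColimObj X D} (p : Word X D x y) (q : Word X D y z) (r : Word X D z t) :
      Rel X D (comp (comp p q) r) (comp p (comp q r))
  | cell_id (i : I) (r : X.obj (op i) ⟶ D) : Rel X D (cell i (𝟙 r)) (id ⟨i, r⟩)
  | cell_comp (i : I) {r s t : X.obj (op i) ⟶ D} (θ : r ⟶ s) (η : s ⟶ t) :
      Rel X D (cell i (θ ≫ η)) (comp (cell i θ) (cell i η))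
  | up_down {i j : I} (s : i ⟶ j) (r : X.obj (op i) ⟶ D) :
      Rel X D (comp (up s r) (down s r)) (id ⟨i, r⟩)
  | down_up {i j : I} (s : i ⟶ j) (r : X.obj (op i) ⟶ D) :
      Rel X D (comp (down s r) (up s r)) (id ⟨j, tr X s ≫ r⟩)
  | up_naturality {i j : I} (s : i ⟶ j) {r t : X.obj (op i) ⟶ D} (θ : r ⟶ t) :
      Rel X D (comp (cell i θ) (up s t)) (comp (up s r) (cell j (tr X s ◁ θ)))
  | up_id (i : I) (r : X.obj (op i) ⟶ D) :
      Rel X D (comp (up (𝟙 i) r) (cell i ((trId X i).hom ▷ r ≫ (λ_ r).hom))) (id ⟨i, r⟩)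
  | up_comp {i j k : I} (s : i ⟶ j) (t : j ⟶ k) (r : X.obj (op i) ⟶ D) :
      Rel X D (comp (up (s ≫ t) r) (cell k ((trComp X s t).hom ▷ r ≫ (α_ _ _ _).hom)))
        (comp (up s r) (up t (tr X s ≫ r)))
  | up_cell {i j : I} {s t : i ⟶ j} (α : s ⟶ t) (r : X.obj (op i) ⟶ D) :
      Rel X D (comp (up s r) (cell j (tr₂ X α ▷ r))) (up t r)

def wordSetoid (X : Pseudofunctor Iᵒᵖ C) (D : C) (x y : ColimObj X D) : Setoid (Word X D x y) where
  r := Rel X D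
  iseqv := ⟨Rel.refl, Rel.symm, Rel.trans⟩

/-- Morphisms of the pseudocolimit of the categories `C(X_i, D)`. -/
structure ColimHom {X : Pseudofunctor Iᵒᵖ C} {D : C} (x y : ColimObj X D) where
  cls : Quotient (wordSetoid X D x y)

namespace ColimHom

variable {X : Pseudofunctor Iᵒᵖ C} {D : C}

def mk' {x y : ColimObj X D} (p : Word X D x y) : ColimHom x y := ⟨Quotient.mk _ p⟩

lemma sound {x y : ColimObj X D} {p q : Word X D x y} (h : Rel X D p q) : mk' p = mk' q :=
  congrArg ColimHom.mk (Quotient.sound h)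

lemma exists_rep {x y : ColimObj X D} (f : ColimHom x y) : ∃ p, mk' p = f := by
  obtain ⟨f⟩ := f
  obtain ⟨p, rfl⟩ := Quotient.exists_rep f
  exact ⟨p, rfl⟩

end ColimHom

/-- The pseudocolimit over `i` of the categories `C(X_i, D)`, by generators and relations. Its
universal property is `ColimDesc.desc`, `ColimDesc.ofFunctor_desc`, `ColimDesc.desc_ofFunctor`. -/
instance colimCategory (X : Pseudofunctor Iᵒᵖ C) (D : C) : Category (ColimObj X D) where
  Hom x y := ColimHom x y
  id x := ColimHom.mk' (Word.id x)
  comp f g := ⟨Quotient.map₂ Word.comp (fun _ _ h _ _ k => Rel.comp_congr h k) f.cls g.cls⟩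
  id_comp f := by
    obtain ⟨p, rfl⟩ := f.exists_rep
    exact ColimHom.sound (Rel.id_comp p)
  comp_id f := by
    obtain ⟨p, rfl⟩ := f.exists_rep
    exact ColimHom.sound (Rel.comp_id p)
  assoc f g h := by
    obtain ⟨p, rfl⟩ := f.exists_rep
    obtain ⟨q, rfl⟩ := g.exists_rep
    obtain ⟨r, rfl⟩ := h.exists_rep
    exact ColimHom.sound (Rel.assoc p q r)

section

variable {X : Pseudofunctor Iᵒᵖ C} {D : C}

/-- The 2-cell `θ : r ⟶ s` of `C`, regarded as a morphism of the pseudocolimit. -/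
def cell (i : I) {r s : X.obj (op i) ⟶ D} (θ : r ⟶ s) : (⟨i, r⟩ : ColimObj X D) ⟶ ⟨i, s⟩ :=
  ColimHom.mk' (Word.cell i θ)

/-- The structural isomorphism of the universal pseudocone. -/
def up {i j : I} (s : i ⟶ j) (r : X.obj (op i) ⟶ D) :
    (⟨i, r⟩ : ColimObj X D) ≅ ⟨j, tr X s ≫ r⟩ where
  hom := ColimHom.mk' (Word.up s r)
  inv := ColimHom.mk' (Word.down s r)
  hom_inv_id := ColimHom.sound (Rel.up_down s r)
  inv_hom_id := ColimHom.sound (Rel.down_up s r)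

@[simp]
lemma cell_id (i : I) (r : X.obj (op i) ⟶ D) : cell i (𝟙 r) = 𝟙 (⟨i, r⟩ : ColimObj X D) :=
  ColimHom.sound (Rel.cell_id i r)

lemma cell_comp (i : I) {r s t : X.obj (op i) ⟶ D} (θ : r ⟶ s) (η : s ⟶ t) :
    cell i θ ≫ cell i η = cell i (θ ≫ η) :=
  (ColimHom.sound (Rel.cell_comp i θ η)).symm

lemma cell_up {i j : I} (s : i ⟶ j) {r t : X.obj (op i) ⟶ D} (θ : r ⟶ t) :
    cell i θ ≫ (up s t).hom = (up s r).hom ≫ cell j (tr X s ◁ θ) :=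
  ColimHom.sound (Rel.up_naturality s θ)

lemma cell_up_assoc {i j : I} (s : i ⟶ j) {r t : X.obj (op i) ⟶ D} (θ : r ⟶ t)
    {x : ColimObj X D} (h : ⟨j, tr X s ≫ t⟩ ⟶ x) :
    cell i θ ≫ (up s t).hom ≫ h = (up s r).hom ≫ cell j (tr X s ◁ θ) ≫ h := by
  rw [← Category.assoc, cell_up, Category.assoc]

lemma up_id (i : I) (r : X.obj (op i) ⟶ D) :
    (up (𝟙 i) r).hom ≫ cell i ((trId X i).hom ▷ r ≫ (λ_ r).hom) = 𝟙 _ :=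
  ColimHom.sound (Rel.up_id i r)

lemma up_comp {i j k : I} (s : i ⟶ j) (t : j ⟶ k) (r : X.obj (op i) ⟶ D) :
    (up (s ≫ t) r).hom ≫ cell k ((trComp X s t).hom ▷ r ≫ (α_ _ _ _).hom) =
      (up s r).hom ≫ (up t (tr X s ≫ r)).hom :=
  ColimHom.sound (Rel.up_comp s t r)

lemma up_comp_assoc {i j k : I} (s : i ⟶ j) (t : j ⟶ k) (r : X.obj (op i) ⟶ D)
    {x : ColimObj X D} (h : ⟨k, tr X t ≫ tr X s ≫ r⟩ ⟶ x) :
    (up (s ≫ t) r).hom ≫ cell k ((trComp X s t).hom ▷ r ≫ (α_ _ _ _).hom) ≫ h =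
      (up s r).hom ≫ (up t (tr X s ≫ r)).hom ≫ h := by
  rw [← Category.assoc, up_comp, Category.assoc]

lemma up_cell {i j : I} {s t : i ⟶ j} (α : s ⟶ t) (r : X.obj (op i) ⟶ D) :
    (up s r).hom ≫ cell j (tr₂ X α ▷ r) = (up t r).hom :=
  ColimHom.sound (Rel.up_cell α r)

lemma up_cell_assoc {i j : I} {s t : i ⟶ j} (α : s ⟶ t) (r : X.obj (op i) ⟶ D)
    {x : ColimObj X D} (h : ⟨j, tr X t ≫ r⟩ ⟶ x) :
    (up s r).hom ≫ cell j (tr₂ X α ▷ r) ≫ h = (up t r).hom ≫ h := by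
  rw [← Category.assoc, up_cell]

/-- `cell` applied to an invertible 2-cell. -/
@[simps]
def cellIso (i : I) {r s : X.obj (op i) ⟶ D} (θ : r ≅ s) : (⟨i, r⟩ : ColimObj X D) ≅ ⟨i, s⟩ where
  hom := cell i θ.hom
  inv := cell i θ.inv
  hom_inv_id := by simp [cell_comp]
  inv_hom_id := by simp [cell_comp]

lemma hom_induction (P : ∀ ⦃x y : ColimObj X D⦄, (x ⟶ y) → Prop)
    (h_id : ∀ x, P (𝟙 x)) (h_comp : ∀ {x y z} (f : x ⟶ y) (g : y ⟶ z), P f → P g → P (f ≫ g))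
    (h_cell : ∀ (i : I) {r s : X.obj (op i) ⟶ D} (θ : r ⟶ s), P (cell i θ))
    (h_up : ∀ {i j : I} (s : i ⟶ j) (r : X.obj (op i) ⟶ D), P (up s r).hom)
    (h_down : ∀ {i j : I} (s : i ⟶ j) (r : X.obj (op i) ⟶ D), P (up s r).inv)
    {x y : ColimObj X D} (f : x ⟶ y) : P f := by
  obtain ⟨p, rfl⟩ := ColimHom.exists_rep f
  induction p with
  | id x => exact h_id x
  | comp p q hp hq => exact h_comp (ColimHom.mk' p) (ColimHom.mk' q) hp hq
  | cell i θ => exact h_cell i θ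
  | up s r => exact h_up s r
  | down s r => exact h_down s r

variable {E : Type u} [Category.{v} E]

lemma naturality_of_generators {G H : ColimObj X D ⥤ E} (app : ∀ x, G.obj x ⟶ H.obj x)
    (h_cell : ∀ (i : I) {r s : X.obj (op i) ⟶ D} (θ : r ⟶ s),
      G.map (cell i θ) ≫ app ⟨i, s⟩ = app ⟨i, r⟩ ≫ H.map (cell i θ))
    (h_up : ∀ {i j : I} (s : i ⟶ j) (r : X.obj (op i) ⟶ D),
      G.map (up s r).hom ≫ app ⟨j, tr X s ≫ r⟩ = app ⟨i, r⟩ ≫ H.map (up s r).hom)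
    {x y : ColimObj X D} (f : x ⟶ y) : G.map f ≫ app y = app x ≫ H.map f := by
  induction f using hom_induction with
  | h_id x => simp
  | h_comp f g hf hg => simp [hg, reassoc_of% hf]
  | h_cell i θ => exact h_cell i θ
  | h_up s r => exact h_up s r
  | h_down s r =>
    rw [← cancel_epi (G.map (up s r).hom), ← Functor.map_comp_assoc, Iso.hom_inv_id,
      reassoc_of% (h_up s r), ← Functor.map_comp, Iso.hom_inv_id]
    simp

variable (X D E) in
/-- A pseudocone with vertex `E` under the diagram of categories `C(X_i, D)`. -/
structure ColimDesc where
  obj : ∀ i : I, (X.obj (op i) ⟶ D) → E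
  map : ∀ (i : I) {r s : X.obj (op i) ⟶ D}, (r ⟶ s) → (obj i r ⟶ obj i s)
  iso : ∀ {i j : I} (s : i ⟶ j) (r : X.obj (op i) ⟶ D), obj i r ≅ obj j (tr X s ≫ r)
  map_id : ∀ (i : I) (r : X.obj (op i) ⟶ D), map i (𝟙 r) = 𝟙 _
  map_comp : ∀ (i : I) {r s t : X.obj (op i) ⟶ D} (θ : r ⟶ s) (η : s ⟶ t),
    map i (θ ≫ η) = map i θ ≫ map i η
  naturality : ∀ {i j : I} (s : i ⟶ j) {r t : X.obj (op i) ⟶ D} (θ : r ⟶ t),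
    map i θ ≫ (iso s t).hom = (iso s r).hom ≫ map j (tr X s ◁ θ)
  iso_id : ∀ (i : I) (r : X.obj (op i) ⟶ D),
    (iso (𝟙 i) r).hom ≫ map i ((trId X i).hom ▷ r ≫ (λ_ r).hom) = 𝟙 _
  iso_comp : ∀ {i j k : I} (s : i ⟶ j) (t : j ⟶ k) (r : X.obj (op i) ⟶ D),
    (iso (s ≫ t) r).hom ≫ map k ((trComp X s t).hom ▷ r ≫ (α_ _ _ _).hom) =
      (iso s r).hom ≫ (iso t (tr X s ≫ r)).hom
  iso_cell : ∀ {i j : I} {s t : i ⟶ j} (α : s ⟶ t) (r : X.obj (op i) ⟶ D),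
    (iso s r).hom ≫ map j (tr₂ X α ▷ r) = (iso t r).hom

namespace ColimDesc

variable (S : ColimDesc X D E)

def evalWord : ∀ {x y : ColimObj X D}, Word X D x y → (S.obj x.idx x.arr ⟶ S.obj y.idx y.arr)
  | _, _, .id _ => 𝟙 _
  | _, _, .comp p q => evalWord p ≫ evalWord q
  | _, _, .cell i θ => S.map i θ
  | _, _, .up s r => (S.iso s r).hom
  | _, _, .down s r => (S.iso s r).inv

lemma evalWord_rel {x y : ColimObj X D} {p q : Word X D x y} (h : Rel X D p q) :
    S.evalWord p = S.evalWord q := by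
  induction h with
  | refl p => rfl
  | symm _ h => exact h.symm
  | trans _ _ h k => exact h.trans k
  | comp_congr _ _ h k => simp only [evalWord, h, k]
  | id_comp p => simp [evalWord]
  | comp_id p => simp [evalWord]
  | assoc p q r => simp [evalWord]
  | cell_id i r => exact S.map_id i r
  | cell_comp i θ η => exact S.map_comp i θ η
  | up_down s r => simp [evalWord]
  | down_up s r => simp [evalWord]
  | up_naturality s θ => exact S.naturality s θ
  | up_id i r => exact S.iso_id i r
  | up_comp s t r => exact S.iso_comp s t r
  | up_cell α r => exact S.iso_cell α r

/-- The functor out of the pseudocolimit induced by a pseudocone. -/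
def desc : ColimObj X D ⥤ E where
  obj x := S.obj x.idx x.arr
  map f := Quotient.lift S.evalWord (fun _ _ h => S.evalWord_rel h) f.cls
  map_id x := rfl
  map_comp f g := by
    obtain ⟨p, rfl⟩ := f.exists_rep
    obtain ⟨q, rfl⟩ := g.exists_rep
    rfl

@[simp] lemma desc_obj (x : ColimObj X D) : S.desc.obj x = S.obj x.idx x.arr := rfl
@[simp] lemma desc_map_cell (i : I) {r s : X.obj (op i) ⟶ D} (θ : r ⟶ s) :
    S.desc.map (cell i θ) = S.map i θ := rfl
@[simp] lemma desc_map_up_hom {i j : I} (s : i ⟶ j) (r : X.obj (op i) ⟶ D) :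
    S.desc.map (up s r).hom = (S.iso s r).hom := rfl
@[simp] lemma desc_map_up_inv {i j : I} (s : i ⟶ j) (r : X.obj (op i) ⟶ D) :
    S.desc.map (up s r).inv = (S.iso s r).inv := rfl

/-- Restriction of a functor along the universal pseudocone. -/
def ofFunctor (G : ColimObj X D ⥤ E) : ColimDesc X D E where
  obj i r := G.obj ⟨i, r⟩
  map i _ _ θ := G.map (cell i θ)
  iso s r := G.mapIso (up s r)
  map_id i r := by simp
  map_comp i _ _ _ θ η := by rw [← G.map_comp, cell_comp]
  naturality s r t θ := by
    simp only [Functor.mapIso_hom, ← Functor.map_comp, cell_up]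
  iso_id i r := by
    simp only [Functor.mapIso_hom, ← G.map_comp, up_id]
    simp
  iso_comp s t r := by
    simp only [Functor.mapIso_hom, ← G.map_comp, up_comp]
  iso_cell α r := by
    simp only [Functor.mapIso_hom, ← G.map_comp, up_cell]

/-- The induced functor restricts to the given pseudocone. -/
lemma ofFunctor_desc : ofFunctor S.desc = S := rfl

/-- A functor out of the pseudocolimit is determined by its restriction. -/
lemma desc_ofFunctor (G : ColimObj X D ⥤ E) : (ofFunctor G).desc = G :=
  CategoryTheory.Functor.ext (fun _ => rfl) (fun x y f => by
    have := naturality_of_generators (G := (ofFunctor G).desc) (H := G) (fun _ => 𝟙 _)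
      (fun i _ _ θ => (Category.comp_id _).trans (Category.id_comp _).symm)
      (fun s r => (Category.comp_id _).trans (Category.id_comp _).symm) f
    change _ = 𝟙 _ ≫ G.map f ≫ 𝟙 _
    exact (Category.comp_id _).symm.trans (this.trans
      (congrArg (fun t => 𝟙 _ ≫ t) (Category.comp_id _).symm)))

end ColimDesc

/-- Postcomposition with `f : D ⟶ D'`, as a pseudocone. -/
@[simps]
def mapDesc (X : Pseudofunctor Iᵒᵖ C) {D D' : C} (f : D ⟶ D') :
    ColimDesc X D (ColimObj X D') where
  obj i r := ⟨i, r ≫ f⟩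
  map i _ _ θ := cell i (θ ▷ f)
  iso {i j} s r := up s (r ≫ f) ≪≫ cellIso j (α_ (tr X s) r f).symm
  map_id i r := by simp
  map_comp i _ _ _ θ η := by simp [cell_comp]
  naturality {i j} s r t θ := by
    simp [cell_up_assoc, cell_comp]
  iso_id i r := by
    rw [← up_id i (r ≫ f)]
    simp [cell_comp]
  iso_comp s t r := by
    simp [cell_up_assoc, ← up_comp_assoc s t (r ≫ f), cell_comp]
  iso_cell α r := by
    simp [← up_cell_assoc α (r ≫ f), cell_comp]

/-- Functoriality of the pseudocolimit of the `C(X_i, D)` in `D`. -/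
def postMap (X : Pseudofunctor Iᵒᵖ C) {D D' : C} (f : D ⟶ D') : ColimObj X D ⥤ ColimObj X D' :=
  (mapDesc X f).desc

@[simp] lemma postMap_obj {D D' : C} (f : D ⟶ D') (x : ColimObj X D) :
    (postMap X f).obj x = ⟨x.idx, x.arr ≫ f⟩ := rfl

@[simp] lemma postMap_map_cell {D D' : C} (f : D ⟶ D') (i : I) {r s : X.obj (op i) ⟶ D}
    (θ : r ⟶ s) : (postMap X f).map (cell i θ) = cell i (θ ▷ f) := rfl

@[simp] lemma postMap_map_up_hom {D D' : C} (f : D ⟶ D') {i j : I} (s : i ⟶ j)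
    (r : X.obj (op i) ⟶ D) : (postMap X f).map (up s r).hom =
      (up s (r ≫ f)).hom ≫ cell j (α_ (tr X s) r f).inv := rfl

/-- Functoriality in the 2-cells of `C`. -/
@[simps]
def postMap₂ (X : Pseudofunctor Iᵒᵖ C) {D D' : C} {f g : D ⟶ D'} (σ : f ⟶ g) :
    postMap X f ⟶ postMap X g where
  app x := cell x.idx (x.arr ◁ σ)
  naturality _ _ := naturality_of_generators (G := postMap X f) (H := postMap X g)
    (fun x => cell x.idx (x.arr ◁ σ))
    (fun i r s θ => by simp [cell_comp, whisker_exchange])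
    (fun {i j} s r => by simp [cell_up_assoc, cell_comp])

@[simps!]
def postMapId (X : Pseudofunctor Iᵒᵖ C) (D : C) : postMap X (𝟙 D) ≅ 𝟭 _ :=
  NatIso.ofComponents (fun x => cellIso x.idx (ρ_ x.arr))
    (naturality_of_generators (G := postMap X (𝟙 D)) (H := 𝟭 _)
      (fun x => cell x.idx (ρ_ x.arr).hom)
      (fun i r s θ => by simp [cell_comp])
      (fun {i j} s r => by simp [cell_up, cell_comp]))

@[simps!]
def postMapComp (X : Pseudofunctor Iᵒᵖ C) {D D' D'' : C} (f : D ⟶ D') (g : D' ⟶ D'') :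
    postMap X (f ≫ g) ≅ postMap X f ⋙ postMap X g :=
  NatIso.ofComponents (fun x => cellIso x.idx (α_ x.arr f g).symm)
    (naturality_of_generators (G := postMap X (f ≫ g)) (H := postMap X f ⋙ postMap X g)
      (fun x => cell x.idx (α_ x.arr f g).inv)
      (fun i r s θ => by simp [cell_comp])
      (fun {i j} s r => by simp [cell_up_assoc, cell_comp]))

/-- The pseudocolimit of the representables `C(X_i, -)`, computed pointwise. -/
def colimPseudo (X : Pseudofunctor Iᵒᵖ C) :
    Pseudofunctor C Cat.{max u₁ v₁ v₂ w₂, max u₁ v₂} where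
  obj D := Cat.of (ColimObj X D)
  map f := (postMap X f).toCatHom
  map₂ σ := (postMap₂ X σ).toCatHom₂
  mapId D := Cat.Hom.isoMk (postMapId X D)
  mapComp f g := Cat.Hom.isoMk (postMapComp X f g)
  map₂_id f := Cat.Hom₂.ext (NatTrans.ext (funext fun (x : ColimObj X _) => by
    change cell x.idx _ = 𝟙 (⟨_, _⟩ : ColimObj X _)
    simp))
  map₂_comp σ τ := Cat.Hom₂.ext (NatTrans.ext (funext fun (x : ColimObj X _) => by
    change cell x.idx _ = cell x.idx _ ≫ cell x.idx _
    simp [cell_comp]))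
  map₂_whisker_left f g h σ := Cat.Hom₂.ext (NatTrans.ext (funext fun (x : ColimObj X _) => by
    change cell x.idx (x.arr ◁ (f ◁ σ)) = cell x.idx (α_ x.arr f g).inv ≫
      cell x.idx ((x.arr ≫ f) ◁ σ) ≫ cell x.idx (α_ x.arr f h).hom
    simp [cell_comp]))
  map₂_whisker_right {_ _ _ f g} σ h :=
    Cat.Hom₂.ext (NatTrans.ext (funext fun (x : ColimObj X _) => by
      change cell x.idx (x.arr ◁ (σ ▷ h)) = cell x.idx (α_ x.arr f h).inv ≫
        cell x.idx ((x.arr ◁ σ) ▷ h) ≫ cell x.idx (α_ x.arr g h).hom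
      simp [cell_comp]))
  map₂_associator f g h := Cat.Hom₂.ext (NatTrans.ext (funext fun (x : ColimObj X _) => by
    change cell x.idx (x.arr ◁ (α_ f g h).hom) = cell x.idx (α_ x.arr (f ≫ g) h).inv ≫
      cell x.idx ((α_ x.arr f g).inv ▷ h) ≫ 𝟙 (⟨_, _⟩ : ColimObj X _) ≫
      cell x.idx (α_ (x.arr ≫ f) g h).hom ≫ cell x.idx (α_ x.arr f (g ≫ h)).hom
    simp [cell_comp]))
  map₂_left_unitor f := Cat.Hom₂.ext (NatTrans.ext (funext fun (x : ColimObj X _) => by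
    change cell x.idx (x.arr ◁ (λ_ f).hom) = cell x.idx (α_ x.arr (𝟙 _) f).inv ≫
      cell x.idx ((ρ_ x.arr).hom ▷ f) ≫ 𝟙 (⟨_, _⟩ : ColimObj X _)
    simp [cell_comp]))
  map₂_right_unitor f := Cat.Hom₂.ext (NatTrans.ext (funext fun (x : ColimObj X _) => by
    change cell x.idx (x.arr ◁ (ρ_ f).hom) = cell x.idx (α_ x.arr f (𝟙 _)).inv ≫
      cell x.idx (ρ_ (x.arr ≫ f)).hom ≫ 𝟙 (⟨_, _⟩ : ColimObj X _)
    simp [cell_comp]))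

lemma cell_eqToHom (i : I) {r s : X.obj (op i) ⟶ D} (h : r = s) :
    cell i (eqToHom h) = eqToHom (congrArg (ColimObj.mk i) h) := by
  subst h
  simp

end

end Colimit

/-- An invertible 2-cell of `Cat` whose components are identities is an identity. -/
lemma Cat.eq_eqToIso {A B : Cat.{v, u}} {F G : A ⟶ B} (e : F ≅ G)
    (hobj : ∀ x, F.toFunctor.obj x = G.toFunctor.obj x)
    (happ : ∀ x, e.hom.toNatTrans.app x = eqToHom (hobj x)) : ∃ h : F = G, e = eqToIso h := by
  have h : F = G := Cat.Hom.ext (Functor.ext_of_iso (Cat.Hom.toNatIso e) hobj happ)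
  refine ⟨h, ?_⟩
  subst h
  ext x
  simpa using happ x

section

variable {I : Type u₁} [Bicategory.{w₁, v₁} I] {C : Type u₂} [Bicategory.{w₂, v₂} C]
  [Strict C]

lemma colimPseudo_mapId (X : Pseudofunctor Iᵒᵖ C) (D : C) :
    ∃ h : (colimPseudo X).map (𝟙 D) = 𝟙 _, (colimPseudo X).mapId D = eqToIso h :=
  Cat.eq_eqToIso _ (fun x => congrArg (ColimObj.mk x.idx) (Strict.comp_id x.arr)) (fun x => by
    change cell x.idx (ρ_ x.arr).hom = _
    rw [Strict.rightUnitor_eqToIso, eqToIso.hom, cell_eqToHom]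
    rfl)

lemma colimPseudo_mapComp (X : Pseudofunctor Iᵒᵖ C) {D D' D'' : C} (f : D ⟶ D') (g : D' ⟶ D'') :
    ∃ h : (colimPseudo X).map (f ≫ g) = (colimPseudo X).map f ≫ (colimPseudo X).map g,
      (colimPseudo X).mapComp f g = eqToIso h :=
  Cat.eq_eqToIso _ (fun x => congrArg (ColimObj.mk x.idx) (Strict.assoc x.arr f g).symm)
    (fun x => by
      change cell x.idx (α_ x.arr f g).inv = _
      rw [Strict.associator_eqToIso, eqToIso.inv, cell_eqToHom]
      rfl)

/-- If `C` is a 2-category, the pointwise pseudocolimit `D ↦ colim_i C(X_i, D)` of representables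
is a 2-functor. -/
def colimFunctor (X : Pseudofunctor Iᵒᵖ C) :
    StrictPseudofunctor C Cat.{max u₁ v₁ v₂ w₂, max u₁ v₂} where
  __ := colimPseudo X
  map_id D := (colimPseudo_mapId X D).1
  mapId_eq_eqToIso D := (colimPseudo_mapId X D).2
  map_comp f g := (colimPseudo_mapComp X f g).1
  mapComp_eq_eqToIso f g := (colimPseudo_mapComp X f g).2

end

section

open scoped Pseudofunctor.StrongTrans

variable {A : Type u₁} [Bicategory.{w₁, v₁} A] {B : Type u₂} [Bicategory.{w₂, v₂} B]

/-- A pseudonatural transformation is 2-natural if its structure 2-cells are identities. -/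
def IsTwoNatural {F G : Pseudofunctor A B} (η : F ⟶ G) : Prop :=
  ∀ ⦃a b : A⦄ (f : a ⟶ b), ∃ h : F.map f ≫ η.app b = η.app a ≫ G.map f,
    η.naturality f = eqToIso h

lemma IsTwoNatural.id [Strict B] (F : Pseudofunctor A B) : IsTwoNatural (𝟙 F) := fun a b f => by
  refine ⟨(Strict.comp_id _).trans (Strict.id_comp _).symm, ?_⟩
  ext
  rw [Pseudofunctor.StrongTrans.categoryStruct_id_naturality_hom]
  simp [Strict.rightUnitor_eqToIso, Strict.leftUnitor_eqToIso]
  rfl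

lemma eqToHom_trans_five {E : Type u} [Category.{v} E] {a b c d e f : E} (h₁ : a = b) (h₂ : b = c)
    (h₃ : c = d) (h₄ : d = e) (h₅ : e = f) (h : a = f) :
    eqToHom h₁ ≫ eqToHom h₂ ≫ eqToHom h₃ ≫ eqToHom h₄ ≫ eqToHom h₅ = eqToHom h := by
  simp

lemma IsTwoNatural.comp [Strict B] {F G H : Pseudofunctor A B} {η : F ⟶ G} {θ : G ⟶ H}
    (hη : IsTwoNatural η) (hθ : IsTwoNatural θ) : IsTwoNatural (η ≫ θ) := fun a b f => by
  obtain ⟨h₁, e₁⟩ := hη f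
  obtain ⟨h₂, e₂⟩ := hθ f
  refine ⟨?_, ?_⟩
  · rw [Pseudofunctor.StrongTrans.comp_app, Pseudofunctor.StrongTrans.comp_app,
      ← Strict.assoc, h₁, Strict.assoc, h₂, Strict.assoc]
  · ext
    rw [Pseudofunctor.StrongTrans.categoryStruct_comp_naturality_hom, e₁, e₂]
    simp only [Strict.associator_eqToIso, eqToIso.hom, eqToIso.inv, whiskerLeft_eqToHom,
      eqToHom_whiskerRight]
    exact (eqToHom_trans_five _ _ _ _ _ _)

end

/-- 2-filtered 2-categories. -/
structure IsTwoFiltered (A : Type u) [Bicategory.{w₁, v} A] : Prop where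
  f0 : ∀ a b : A, ∃ c : A, Nonempty (a ⟶ c) ∧ Nonempty (b ⟶ c)
  f1 : ∀ {a b : A} (f g : a ⟶ b), ∃ (c : A) (h : b ⟶ c), Nonempty (f ≫ h ≅ g ≫ h)
  f2 : ∀ {a b : A} {f g : a ⟶ b} (α β : f ⟶ g), ∃ (c : A) (h : b ⟶ c), α ▷ h = β ▷ h

/-- Smallness relative to the universe `v` of the type of objects: all hom-categories are small. -/
structure IsSmallTwoCategory (A : Type v) [Bicategory.{w₁, v₁} A] : Prop where
  small_hom : ∀ a b : A, Small.{v} (a ⟶ b)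
  small_hom₂ : ∀ {a b : A} (f g : a ⟶ b), Small.{v} (f ⟶ g)

/-- A 2-pro-object of `C`: a 2-functor `idxᵒᵖ ⥤ C` with `idx` a small 2-filtered 2-category. The
1-cells and 2-cells of `idx` may be given in a larger universe, as long as they form small sets. -/
structure Pro (C : Type u) [Bicategory.{v, v} C] where
  idx : Type v
  [bicategory : Bicategory.{max u v, max u v} idx]
  [strict : Strict idx]
  small : IsSmallTwoCategory idx
  filtered : IsTwoFiltered idx
  diagram : StrictPseudofunctor idxᵒᵖ C

attribute [instance] Pro.bicategory Pro.strict

namespace Pro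

open scoped Pseudofunctor.StrongTrans

variable {C : Type u} [Bicategory.{v, v} C]

section

variable [Strict C]

/-- The object `X_i` of `C`. -/
abbrev at' (X : Pro C) (i : X.idx) : C := X.diagram.obj (op i)

/-- The 2-functor `D ↦ colim_i C(X_i, D)`. -/
def L (X : Pro C) : StrictPseudofunctor C Cat.{max u v, v} := colimFunctor X.diagram.toPseudofunctor

abbrev LP (X : Pro C) : Pseudofunctor C Cat.{max u v, v} := X.L.toPseudofunctor

/-- Morphisms `X ⟶ Y` of 2-pro-objects: 2-natural transformations from `colim_j C(Y_j, -)` to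
`colim_i C(X_i, -)`. -/
@[ext]
structure Hom (X Y : Pro C) where
  trans : Y.LP ⟶ X.LP
  isTwoNatural : IsTwoNatural trans

instance : CategoryStruct (Pro C) where
  Hom := Hom
  id X := ⟨𝟙 X.LP, IsTwoNatural.id _⟩
  comp f g := ⟨g.trans ≫ f.trans, g.isTwoNatural.comp f.isTwoNatural⟩

@[ext]
lemma hom_ext {X Y : Pro C} {f g : X ⟶ Y} (h : f.trans = g.trans) : f = g :=
  Hom.ext h

@[simp] lemma id_trans (X : Pro C) : Hom.trans (𝟙 X) = 𝟙 X.LP := rfl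
@[simp] lemma comp_trans {X Y Z : Pro C} (f : X ⟶ Y) (g : Y ⟶ Z) :
    (f ≫ g).trans = g.trans ≫ f.trans := rfl

/-- 2-cells between morphisms of 2-pro-objects: modifications. -/
@[ext]
structure Hom₂ {X Y : Pro C} (f g : X ⟶ Y) where
  mod : f.trans ⟶ g.trans

@[simps]
instance homCategory (X Y : Pro C) : Category (X ⟶ Y) where
  Hom := Hom₂
  id f := ⟨𝟙 f.trans⟩
  comp η θ := ⟨η.mod ≫ θ.mod⟩

@[ext]
lemma hom₂_ext {X Y : Pro C} {f g : X ⟶ Y} {η θ : f ⟶ g} (h : η.mod = θ.mod) : η = θ :=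
  Hom₂.ext h

@[simps]
def isoMk {X Y : Pro C} {f g : X ⟶ Y} (e : f.trans ≅ g.trans) : f ≅ g where
  hom := ⟨e.hom⟩
  inv := ⟨e.inv⟩

/-- The 2-category of 2-pro-objects of `C` (see also the instance `Strict (Pro C)`). -/
instance : Bicategory (Pro C) where
  homCategory := homCategory
  whiskerLeft f _ _ η := Hom₂.mk (Hom₂.mod η ▷ f.trans)
  whiskerRight η h := Hom₂.mk (h.trans ◁ Hom₂.mod η)
  associator f g h := isoMk (α_ h.trans g.trans f.trans).symm
  leftUnitor f := isoMk (ρ_ f.trans)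
  rightUnitor f := isoMk (λ_ f.trans)
  whiskerLeft_id _ _ := Hom₂.ext (id_whiskerRight _ _)
  whiskerLeft_comp _ _ _ _ _ _ := Hom₂.ext (comp_whiskerRight _ _ _)
  id_whiskerLeft _ := Hom₂.ext (whiskerRight_id _)
  comp_whiskerLeft _ _ _ _ _ := Hom₂.ext (whiskerRight_comp _ _ _)
  id_whiskerRight _ _ := Hom₂.ext (whiskerLeft_id _ _)
  comp_whiskerRight _ _ _ := Hom₂.ext (whiskerLeft_comp _ _ _)
  whiskerRight_id _ := Hom₂.ext (id_whiskerLeft _)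
  whiskerRight_comp _ _ _ := Hom₂.ext (comp_whiskerLeft _ _ _)
  whisker_assoc _ _ _ _ _ := Hom₂.ext (whisker_assoc_symm _ _ _)
  whisker_exchange _ _ := Hom₂.ext (whisker_exchange _ _).symm
  pentagon _ _ _ _ := Hom₂.ext (pentagon_inv _ _ _ _)
  triangle _ _ := Hom₂.ext (triangle_assoc_comp_right _ _)

end

end Pro

/-- The terminal 2-category. -/
structure Pt : Type u where

/-- The 1-cells of the terminal 2-category. -/
structure PtHom : Type v where

instance ptHomCategory : Category.{v} PtHom.{v} where
  Hom _ _ := PUnit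
  id _ := ⟨⟩
  comp _ _ := ⟨⟩

instance : Bicategory.{v, v} Pt.{u} where
  Hom _ _ := PtHom
  id _ := ⟨⟩
  comp _ _ := ⟨⟩
  homCategory _ _ := ptHomCategory
  whiskerLeft _ _ _ _ := ⟨⟩
  whiskerRight _ _ := ⟨⟩
  associator _ _ _ := ⟨⟨⟩, ⟨⟩, rfl, rfl⟩
  leftUnitor _ := ⟨⟨⟩, ⟨⟩, rfl, rfl⟩
  rightUnitor _ := ⟨⟨⟩, ⟨⟩, rfl, rfl⟩

instance : Strict Pt.{u} where
  id_comp _ := rfl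
  comp_id _ := rfl
  assoc _ _ _ := rfl
  leftUnitor_eqToIso _ := rfl
  rightUnitor_eqToIso _ := rfl
  associator_eqToIso _ _ _ := rfl

section
variable {C : Type u} [Bicategory.{w₁, v} C] [Strict C]

/-- The diagram on the terminal 2-category with value `A`. -/
def constDiagram (A : C) : StrictPseudofunctor (Pt.{u₁})ᵒᵖ C where
  obj _ := A
  map _ := 𝟙 A
  map₂ _ := 𝟙 _
  mapId _ := Iso.refl _
  mapComp _ _ := (λ_ (𝟙 A)).symm
  map₂_whisker_left _ _ _ _ := by simp
  map₂_whisker_right _ _ := by simp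
  map₂_associator _ _ _ := by simp
  map₂_left_unitor _ := by simp
  map₂_right_unitor _ := by simp
  map_id _ := rfl
  mapId_eq_eqToIso _ := rfl
  map_comp _ _ := (Strict.id_comp _).symm
  mapComp_eq_eqToIso _ _ := by
    rw [Strict.leftUnitor_eqToIso]
    rfl
end

namespace Pro
open scoped Pseudofunctor.StrongTrans
variable {C : Type u} [Bicategory.{v, v} C] [Strict C]

/-- An object of `C`, as a 2-pro-object. -/
def const (A : C) : Pro C where
  idx := Pt.{v}
  small :=
    { small_hom := fun _ _ => ⟨PtHom.{v}, ⟨⟨fun _ => ⟨⟩, fun _ => ⟨⟩, fun _ => rfl, fun _ => rfl⟩⟩⟩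
      small_hom₂ := fun _ _ =>
        ⟨PUnit.{v + 1}, ⟨⟨fun _ => ⟨⟩, fun _ => ⟨⟩, fun _ => rfl, fun _ => rfl⟩⟩⟩ }
  filtered :=
    { f0 := fun _ _ => ⟨⟨⟩, ⟨⟨⟩⟩, ⟨⟨⟩⟩⟩
      f1 := fun _ _ => ⟨⟨⟩, ⟨⟩, ⟨Iso.refl _⟩⟩
      f2 := fun _ _ => ⟨⟨⟩, ⟨⟩, rfl⟩ }
  diagram := constDiagram A

/-- The object `(i, r)` of `colim_i C(X_i, A)` induces by postcomposition a functor from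
`C(A, D)` to `colim_i C(X_i, D)`. -/
def eltDesc (X : Pro C) {A : C} (i : X.idx) (r : X.at' i ⟶ A) (D : C) :
    ColimDesc (constDiagram.{v, v, v, u, max u v} A).toPseudofunctor D
      (ColimObj X.diagram.toPseudofunctor D) where
  obj _ (s : A ⟶ D) := ⟨i, r ≫ s⟩
  map _ {s t : A ⟶ D} (θ : s ⟶ t) := cell i (r ◁ θ)
  iso _ (s : A ⟶ D) := cellIso i (whiskerLeftIso r (λ_ s).symm)
  map_id _ (s : A ⟶ D) := by
    change cell i (r ◁ (𝟙 s)) = _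
    simp
  map_comp _ {s t l : A ⟶ D} (θ : s ⟶ t) (η : t ⟶ l) := by
    change cell i (r ◁ (θ ≫ η)) = cell i (r ◁ θ) ≫ cell i (r ◁ η)
    simp [cell_comp]
  naturality {_ _} _ {s t : A ⟶ D} (θ : s ⟶ t) := by
    change cell i (r ◁ θ) ≫ cell i (r ◁ (λ_ t).inv) =
      cell i (r ◁ (λ_ s).inv) ≫ cell i (r ◁ (𝟙 A ◁ θ))
    simp [cell_comp, ← whiskerLeft_comp]
  iso_id _ (s : A ⟶ D) := by
    change cell i (r ◁ (λ_ s).inv) ≫ cell i (r ◁ (𝟙 (𝟙 A) ▷ s ≫ (λ_ s).hom)) =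
      𝟙 (⟨i, r ≫ s⟩ : ColimObj X.diagram.toPseudofunctor D)
    simp [cell_comp]
  iso_comp _ _ (s : A ⟶ D) := by
    change cell i (r ◁ (λ_ s).inv) ≫ cell i (r ◁ ((λ_ (𝟙 A)).inv ▷ s ≫ (α_ (𝟙 A) (𝟙 A) s).hom)) =
      cell i (r ◁ (λ_ s).inv) ≫ cell i (r ◁ (λ_ (𝟙 A ≫ s)).inv)
    simp [cell_comp, ← whiskerLeft_comp]
  iso_cell _ (s : A ⟶ D) := by
    change cell i (r ◁ (λ_ s).inv) ≫ cell i (r ◁ (𝟙 (𝟙 A) ▷ s)) = cell i (r ◁ (λ_ s).inv)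
    simp

/-- `colim C(A, D)` over the terminal 2-category. -/
abbrev CCat (A D : C) := ColimObj (constDiagram.{v, v, v, u, max u v} A).toPseudofunctor D
/-- `colim_i C(X_i, D)`. -/
abbrev PCat (X : Pro C) (D : C) := ColimObj X.diagram.toPseudofunctor D

/-- The object `s : A ⟶ D` of the pseudocolimit for the one-object diagram `A`. -/
def CCat.mk {A D : C} (s : A ⟶ D) : CCat A D :=
  ColimObj.mk (X := (constDiagram.{v, v, v, u, max u v} A).toPseudofunctor) (⟨⟩ : Pt.{v}) s

/-- The 2-cell `θ` as a morphism of the pseudocolimit for the one-object diagram. -/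
def ccell {A D : C} {s t : A ⟶ D} (θ : s ⟶ t) : CCat.mk s ⟶ CCat.mk t :=
  cell (X := (constDiagram.{v, v, v, u, max u v} A).toPseudofunctor) (⟨⟩ : Pt.{v}) θ

@[simp] lemma ccell_id {A D : C} (s : A ⟶ D) : ccell (𝟙 s) = 𝟙 (CCat.mk s) :=
  cell_id (X := (constDiagram.{v, v, v, u, max u v} A).toPseudofunctor) (⟨⟩ : Pt.{v}) s

lemma ccell_comp {A D : C} {s t l : A ⟶ D} (θ : s ⟶ t) (η : t ⟶ l) :
    ccell θ ≫ ccell η = ccell (θ ≫ η) :=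
  cell_comp (X := (constDiagram.{v, v, v, u, max u v} A).toPseudofunctor) (⟨⟩ : Pt.{v}) θ η

def ccellIso {A D : C} {s t : A ⟶ D} (θ : s ≅ t) : CCat.mk s ≅ CCat.mk t where
  hom := ccell θ.hom
  inv := ccell θ.inv
  hom_inv_id := by simp [ccell_comp]
  inv_hom_id := by simp [ccell_comp]

def cup {A D : C} (s : A ⟶ D) : CCat.mk s ⟶ CCat.mk (𝟙 A ≫ s) :=
  (up (X := (constDiagram.{v, v, v, u, max u v} A).toPseudofunctor) (𝟙 (⟨⟩ : Pt.{v})) s).hom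

lemma cup_eq {A D : C} (s : A ⟶ D) : cup s = ccell (λ_ s).inv := by
  have h : cup s ≫ ccell (𝟙 (𝟙 A) ▷ s ≫ (λ_ s).hom) = 𝟙 (CCat.mk s) :=
    TwoPro.up_id (X := (constDiagram.{v, v, v, u, max u v} A).toPseudofunctor) (⟨⟩ : Pt.{v}) s
  have h' : ccell (𝟙 (𝟙 A) ▷ s ≫ (λ_ s).hom) ≫ ccell (λ_ s).inv = 𝟙 (CCat.mk (𝟙 A ≫ s)) := by
    simp [ccell_comp]
  calc cup s = cup s ≫ ccell (𝟙 (𝟙 A) ▷ s ≫ (λ_ s).hom) ≫ ccell (λ_ s).inv := by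
        rw [h', Category.comp_id]
    _ = 𝟙 _ ≫ ccell (λ_ s).inv := by rw [← h, Category.assoc]
    _ = _ := Category.id_comp _

def arr {A D : C} (x : CCat A D) : A ⟶ D := ColimObj.arr x

lemma cnat {A D : C} {E : Type u₁} [Category.{v₁} E] {G H : CCat A D ⥤ E}
    (app : ∀ s : A ⟶ D, G.obj (CCat.mk s) ⟶ H.obj (CCat.mk s))
    (h : ∀ {s t : A ⟶ D} (θ : s ⟶ t), G.map (ccell θ) ≫ app t = app s ≫ H.map (ccell θ))
    {x y : CCat A D} (f : x ⟶ y) : G.map f ≫ app (arr y) = app (arr x) ≫ H.map f :=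
  naturality_of_generators (G := G) (H := H) (fun x => app (arr x))
    (fun _ _ _ θ => h θ)
    (fun _ s => (congrArg (fun t => G.map t ≫ app (𝟙 A ≫ s)) (cup_eq s)).trans
      ((h (λ_ (show A ⟶ D from s)).inv).trans
        (congrArg (fun t => app s ≫ H.map t) (cup_eq s).symm))) f

def eltFunctor (X : Pro C) {A : C} (i : X.idx) (r : X.at' i ⟶ A) (D : C) :
    CCat A D ⥤ PCat X D :=
  (eltDesc X i r D).desc

def eltNat (X : Pro C) {A : C} (i : X.idx) (r : X.at' i ⟶ A) {D D' : C} (f : D ⟶ D') :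
    postMap _ f ⋙ eltFunctor X i r D' ≅ eltFunctor X i r D ⋙ postMap _ f :=
  NatIso.ofComponents (fun x => cellIso i (α_ r (arr x) f).symm)
    (naturality_of_generators (G := postMap _ f ⋙ eltFunctor X i r D')
      (H := eltFunctor X i r D ⋙ postMap _ f)
      (fun x => cell i (α_ r (arr x) f).inv)
      (fun _ {s t : A ⟶ D} (θ : s ⟶ t) => by
        change cell i (r ◁ (θ ▷ f)) ≫ cell i (α_ r t f).inv =
          cell i (α_ r s f).inv ≫ cell i ((r ◁ θ) ▷ f)
        simp [cell_comp])
      (fun _ (s : A ⟶ D) => by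
        change (cell i (r ◁ (λ_ (s ≫ f)).inv) ≫ cell i (r ◁ (α_ (𝟙 A) s f).inv)) ≫ cell i (α_ r (𝟙 A ≫ s) f).inv =
          cell i (α_ r s f).inv ≫ cell i ((r ◁ (λ_ s).inv) ▷ f)
        simp [cell_comp, ← whiskerLeft_comp]))

/-- The 2-natural transformation corresponding to the object `(i, r)` of `colim_i C(X_i, A)`. -/
def eltTrans (X : Pro C) {A : C} (i : X.idx) (r : X.at' i ⟶ A) : (const A).LP ⟶ X.LP where
  app D := (eltFunctor X i r D).toCatHom
  naturality f := Cat.Hom.isoMk (eltNat X i r f)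
  naturality_naturality {D D' f g} η := Cat.Hom₂.ext (NatTrans.ext (funext fun (x : CCat A D) => by
    change cell i (r ◁ (arr x ◁ η)) ≫ cell i (α_ r (arr x) g).inv =
      cell i (α_ r (arr x) f).inv ≫ cell i ((r ≫ arr x) ◁ η)
    simp [cell_comp]))
  naturality_id D := Cat.Hom₂.ext (NatTrans.ext (funext fun (x : CCat A D) => by
    change cell i (α_ r (arr x) (𝟙 D)).inv ≫ cell i (ρ_ (r ≫ arr x)).hom =
      cell i (r ◁ (ρ_ (arr x)).hom) ≫ 𝟙 _ ≫ 𝟙 (⟨i, r ≫ arr x⟩ : PCat X D)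
    simp [cell_comp]))
  naturality_comp {D D' D''} f g := Cat.Hom₂.ext (NatTrans.ext (funext fun (x : CCat A D) => by
    change cell i (α_ r (arr x) (f ≫ g)).inv ≫ cell i (α_ (r ≫ arr x) f g).inv =
      cell i (r ◁ (α_ (arr x) f g).inv) ≫ 𝟙 _ ≫
        cell i (α_ r (arr x ≫ f) g).inv ≫ 𝟙 _ ≫ cell i ((α_ r (arr x) f).inv ▷ g) ≫
        𝟙 (⟨i, ((r ≫ arr x) ≫ f) ≫ g⟩ : PCat X D'')
    simp [cell_comp]))

/-- The morphism `X ⟶ A` of 2-pro-objects corresponding to the object `(i, r)` of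
`colim_j C(X_j, A)`. -/
def elt (X : Pro C) {A : C} (i : X.idx) (r : X.at' i ⟶ A) : X ⟶ const A :=
  ⟨eltTrans X i r, fun D D' f => Cat.eq_eqToIso _
    (fun (x : CCat A D) => congrArg (ColimObj.mk i) (Strict.assoc r (arr x) f).symm)
    (fun (x : CCat A D) => by
      change cell i (α_ r (arr x) f).inv = _
      rw [Strict.associator_eqToIso, eqToIso.inv, cell_eqToHom]
      rfl)⟩

/-- The projection `π_i : X ⟶ X_i`, corresponding to `(i, id)`. -/
def π (X : Pro C) (i : X.idx) : X ⟶ const (X.at' i) := elt X i (𝟙 _)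

def elt₂Nat (X : Pro C) {A : C} (i : X.idx) {r s : X.at' i ⟶ A} (θ : r ⟶ s) (D : C) :
    eltFunctor X i r D ⟶ eltFunctor X i s D where
  app x := cell i (θ ▷ arr x)
  naturality _ _ := naturality_of_generators (G := eltFunctor X i r D) (H := eltFunctor X i s D)
      (fun x => cell i (θ ▷ arr x))
      (fun _ {l t : A ⟶ D} (η : l ⟶ t) => by
        change cell i (r ◁ η) ≫ cell i (θ ▷ t) = cell i (θ ▷ l) ≫ cell i (s ◁ η)
        simp [cell_comp, whisker_exchange])
      (fun _ (l : A ⟶ D) => by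
        change cell i (r ◁ (λ_ l).inv) ≫ cell i (θ ▷ (𝟙 A ≫ l)) =
          cell i (θ ▷ l) ≫ cell i (s ◁ (λ_ l).inv)
        simp [cell_comp])

/-- The 2-cell of 2-pro-objects induced by a 2-cell of `C`. -/
def elt₂ (X : Pro C) {A : C} (i : X.idx) {r s : X.at' i ⟶ A} (θ : r ⟶ s) : elt X i r ⟶ elt X i s :=
  Hom₂.mk (Pseudofunctor.StrongTrans.Hom.of
   { app D := (elt₂Nat X i θ D).toCatHom₂
     naturality {D D'} f := Cat.Hom₂.ext (NatTrans.ext (funext fun (x : CCat A D) => by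
       change cell i (θ ▷ (arr x ≫ f)) ≫ cell i (α_ s (arr x) f).inv =
         cell i (α_ r (arr x) f).inv ≫ cell i ((θ ▷ arr x) ▷ f)
       simp [cell_comp])) })

end Pro

namespace Pro
open scoped Pseudofunctor.StrongTrans
variable {C : Type u} [Bicategory.{v, v} C] [Strict C]

lemma hom₂_ext_app {X Y : Pro C} {f g : X ⟶ Y} {η θ : f ⟶ g}
    (h : ∀ (D : C) (x : PCat Y D),
      (η.mod.as.app D).toNatTrans.app x = (θ.mod.as.app D).toNatTrans.app x) : η = θ :=
  hom₂_ext (Pseudofunctor.StrongTrans.homCategory.ext fun D =>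
    Cat.Hom₂.ext (NatTrans.ext (funext (h D))))

def eltIdNat (A D : C) : eltFunctor (const A) ⟨⟩ (𝟙 A) D ≅ 𝟭 (CCat A D) :=
  NatIso.ofComponents (fun x => ccellIso (λ_ (arr x)))
    (cnat (G := eltFunctor (const A) ⟨⟩ (𝟙 A) D) (H := 𝟭 (CCat A D))
      (fun s => ccell (λ_ s).hom)
      (fun {s t} θ => by
        change ccell (𝟙 A ◁ θ) ≫ ccell (λ_ t).hom = ccell (λ_ s).hom ≫ ccell θ
        simp [ccell_comp]))

def eltId (A : C) : elt (const A) ⟨⟩ (𝟙 A) ≅ 𝟙 (const A) :=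
  isoMk (Pseudofunctor.StrongTrans.isoMk (fun D => Cat.Hom.isoMk (eltIdNat A D))
    (fun {D D'} f => Cat.Hom₂.ext (NatTrans.ext (funext fun (x : CCat A D) => by
      change ccell (λ_ (arr x ≫ f)).hom ≫ (𝟙 (CCat.mk (arr x ≫ f)) ≫ 𝟙 _) =
        ccell (α_ (𝟙 A) (arr x) f).inv ≫ ccell ((λ_ (arr x)).hom ▷ f)
      simp [ccell_comp]))))

def eltCompNat (X : Pro C) (i : X.idx) {A B : C} (r : X.at' i ⟶ A) (s : A ⟶ B) (D : C) :
    eltFunctor X i (r ≫ s) D ≅ eltFunctor (const A) ⟨⟩ s D ⋙ eltFunctor X i r D :=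
  NatIso.ofComponents (fun x => cellIso i (α_ r s (arr x)))
    (cnat (G := eltFunctor X i (r ≫ s) D) (H := eltFunctor (const A) ⟨⟩ s D ⋙ eltFunctor X i r D)
      (fun t => cell i (α_ r s t).hom)
      (fun {t t'} θ => by
        change cell i ((r ≫ s) ◁ θ) ≫ cell i (α_ r s t').hom =
          cell i (α_ r s t).hom ≫ cell i (r ◁ (s ◁ θ))
        simp [cell_comp]))

def eltComp (X : Pro C) (i : X.idx) {A B : C} (r : X.at' i ⟶ A) (s : A ⟶ B) :
    elt X i (r ≫ s) ≅ elt X i r ≫ elt (const A) ⟨⟩ s :=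
  isoMk (Pseudofunctor.StrongTrans.isoMk (fun D => Cat.Hom.isoMk (eltCompNat X i r s D))
    (fun {D D'} f => Cat.Hom₂.ext (NatTrans.ext (funext fun (x : CCat B D) => by
      change cell i (α_ r s (arr x ≫ f)).hom ≫
          (𝟙 _ ≫ cell i (r ◁ (α_ s (arr x) f).inv) ≫ 𝟙 _ ≫ cell i (α_ r (s ≫ arr x) f).inv ≫ 𝟙 _) =
        cell i (α_ (r ≫ s) (arr x) f).inv ≫ cell i ((α_ r s (arr x)).hom ▷ f)
      simp [cell_comp]))))

/-- The canonical 2-functor from `C` to 2-pro-objects. -/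
def embPseudo : Pseudofunctor C (Pro C) where
  obj A := const A
  map r := elt (const _) ⟨⟩ r
  map₂ θ := elt₂ (const _) ⟨⟩ θ
  mapId A := eltId A
  mapComp r s := eltComp (const _) ⟨⟩ r s
  map₂_id {A B} r := hom₂_ext_app fun D (x : CCat B D) => by
    change ccell (𝟙 r ▷ arr x) = 𝟙 (CCat.mk (r ≫ arr x))
    simp
  map₂_comp {A B r s t} θ η := hom₂_ext_app fun D (x : CCat B D) => by
    change ccell ((θ ≫ η) ▷ arr x) = ccell (θ ▷ arr x) ≫ ccell (η ▷ arr x)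
    simp [ccell_comp]
  map₂_whisker_left {A A' A''} r {s t} θ := hom₂_ext_app fun D (x : CCat A'' D) => by
    change ccell ((r ◁ θ) ▷ arr x) = ccell (α_ r s (arr x)).hom ≫ ccell (r ◁ (θ ▷ arr x)) ≫
      ccell (α_ r t (arr x)).inv
    simp [ccell_comp]
  map₂_whisker_right {A A' A'' r s} θ t := hom₂_ext_app fun D (x : CCat A'' D) => by
    change ccell ((θ ▷ t) ▷ arr x) = ccell (α_ r t (arr x)).hom ≫ ccell (θ ▷ (t ≫ arr x)) ≫
      ccell (α_ s t (arr x)).inv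
    simp [ccell_comp]
  map₂_associator {A₀ A₁ A₂ A₃} r s t := hom₂_ext_app fun D (x : CCat A₃ D) => by
    change ccell ((α_ r s t).hom ▷ arr x) = ccell (α_ (r ≫ s) t (arr x)).hom ≫
      ccell (α_ r s (t ≫ arr x)).hom ≫ 𝟙 (CCat.mk _) ≫ ccell (r ◁ (α_ s t (arr x)).inv) ≫
      ccell (α_ r (s ≫ t) (arr x)).inv
    simp [ccell_comp]
  map₂_left_unitor {A B} r := hom₂_ext_app fun D (x : CCat B D) => by
    change ccell ((λ_ r).hom ▷ arr x) = ccell (α_ (𝟙 A) r (arr x)).hom ≫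
      ccell (λ_ (r ≫ arr x)).hom ≫ 𝟙 _
    simp [ccell_comp]
  map₂_right_unitor {A B} r := hom₂_ext_app fun D (x : CCat B D) => by
    change ccell ((ρ_ r).hom ▷ arr x) = ccell (α_ r (𝟙 B) (arr x)).hom ≫
      ccell (r ◁ (λ_ (arr x)).hom) ≫ 𝟙 _
    simp [ccell_comp]

end Pro

section
variable {I : Type u₁} [Bicategory.{w₁, v₁} I] {C : Type u₂} [Bicategory.{w₂, v₂} C]
  (X : Pseudofunctor Iᵒᵖ C)

lemma map₂_associator_inv (F : Pseudofunctor I C) {a b c d : I} (f : a ⟶ b) (g : b ⟶ c)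
    (h : c ⟶ d) : F.map₂ (α_ f g h).inv = (F.mapComp f (g ≫ h)).hom ≫
      F.map f ◁ (F.mapComp g h).hom ≫ (α_ _ _ _).inv ≫ (F.mapComp f g).inv ▷ F.map h ≫
        (F.mapComp (f ≫ g) h).inv := by
  rw [← cancel_mono (F.map₂ (α_ f g h).hom), ← F.map₂_comp, Iso.inv_hom_id, F.map₂_id,
    F.map₂_associator]
  simp

lemma tr₂_id {i j : I} (s : i ⟶ j) : tr₂ X (𝟙 s) = 𝟙 (tr X s) := X.map₂_id _
lemma tr₂_comp {i j : I} {s t l : i ⟶ j} (α : s ⟶ t) (β : t ⟶ l) :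
    tr₂ X (α ≫ β) = tr₂ X α ≫ tr₂ X β := X.map₂_comp _ _
lemma tr₂_whiskerLeft {i j k : I} (a : i ⟶ j) {b b' : j ⟶ k} (β : b ⟶ b') :
    tr₂ X (a ◁ β) = (trComp X a b).hom ≫ tr₂ X β ▷ tr X a ≫ (trComp X a b').inv :=
  X.map₂_whisker_right (Bicategory.Opposite.op2 β) a.op
lemma tr₂_whiskerRight {i j k : I} {a a' : i ⟶ j} (α : a ⟶ a') (b : j ⟶ k) :
    tr₂ X (α ▷ b) = (trComp X a b).hom ≫ tr X b ◁ tr₂ X α ≫ (trComp X a' b).inv :=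
  X.map₂_whisker_left b.op (Bicategory.Opposite.op2 α)
lemma tr₂_associator {i j k l : I} (a : i ⟶ j) (b : j ⟶ k) (c : k ⟶ l) :
    tr₂ X (α_ a b c).hom = (trComp X (a ≫ b) c).hom ≫ tr X c ◁ (trComp X a b).hom ≫
      (α_ _ _ _).inv ≫ (trComp X b c).inv ▷ tr X a ≫ (trComp X a (b ≫ c)).inv :=
  map₂_associator_inv X c.op b.op a.op
lemma tr₂_leftUnitor {i j : I} (a : i ⟶ j) :
    tr₂ X (λ_ a).hom = (trComp X (𝟙 i) a).hom ≫ tr X a ◁ (trId X i).hom ≫ (ρ_ _).hom :=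
  X.map₂_right_unitor a.op
lemma tr₂_rightUnitor {i j : I} (a : i ⟶ j) :
    tr₂ X (ρ_ a).hom = (trComp X a (𝟙 j)).hom ≫ (trId X j).hom ▷ tr X a ≫ (λ_ _).hom :=
  X.map₂_left_unitor a.op
end

section
variable {B : Type u₁} [Bicategory.{w₁, v₁} B]

/-- The pasting with identities giving the identity 1-cells of `𝒦.Obj`. -/
@[simps!]
def pasteId {x P : B} {T : x ⟶ x} (K : T ≅ 𝟙 x) (p : x ⟶ P) {r : P ⟶ P} (M : r ≅ 𝟙 P) :
    T ≫ p ≅ p ≫ r :=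
  whiskerRightIso K p ≪≫ λ_ _ ≪≫ (ρ_ _).symm ≪≫ whiskerLeftIso p M.symm

/-- The pasting `r φ' ∘ φ X^{a'}` of two 2-cells `φ : a ≫ p ≅ q ≫ r` and `φ' : b ≫ q ≅ l ≫ s`
(called `ψ` below); `K` and `M` are the coherence isomorphisms of the ambient bicategory functors,
which are identities for 2-functors. -/
@[simps!]
def paste {x y z P Q R : B} {a : y ⟶ x} {b : z ⟶ y} {ab : z ⟶ x} {p : x ⟶ P} {q : y ⟶ Q}
    {l : z ⟶ R} {r : Q ⟶ P} {s : R ⟶ Q} {sr : R ⟶ P} (K : ab ≅ b ≫ a) (φ : a ≫ p ≅ q ≫ r)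
    (ψ : b ≫ q ≅ l ≫ s) (M : sr ≅ s ≫ r) : ab ≫ p ≅ l ≫ sr :=
  whiskerRightIso K p ≪≫ α_ _ _ _ ≪≫ whiskerLeftIso b φ ≪≫ (α_ _ _ _).symm ≪≫
    whiskerRightIso ψ r ≪≫ α_ _ _ _ ≪≫ whiskerLeftIso l M.symm

variable {x y z t P Q R S : B} {p : x ⟶ P} {q : y ⟶ Q} {l : z ⟶ R} {m : t ⟶ S}

lemma paste_whiskerLeft {a : y ⟶ x} {b b' : z ⟶ y} {ab ab' : z ⟶ x}
    {r : Q ⟶ P} {s s' : R ⟶ Q} {sr sr' : R ⟶ P} (K : ab ≅ b ≫ a) (K' : ab' ≅ b' ≫ a)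
    (φ : a ≫ p ≅ q ≫ r) (ψ : b ≫ q ≅ l ≫ s) (ψ' : b' ≫ q ≅ l ≫ s')
    (M : sr ≅ s ≫ r) (M' : sr' ≅ s' ≫ r) {β : b ⟶ b'} {θ : s ⟶ s'} {aβ : ab ⟶ ab'}
    {θr : sr ⟶ sr'} (hβ : aβ = K.hom ≫ β ▷ a ≫ K'.inv) (hθ : θr = M.hom ≫ θ ▷ r ≫ M'.inv)
    (w : β ▷ q ≫ ψ'.hom = ψ.hom ≫ l ◁ θ) :
    aβ ▷ p ≫ (paste K' φ ψ' M').hom = (paste K φ ψ M).hom ≫ l ◁ θr := by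
  have w' := congrArg (fun t => t ▷ r) w
  simp only [comp_whiskerRight] at w'
  subst hβ hθ
  have e := whisker_exchange_assoc β φ.hom ((α_ _ _ _).inv ≫ ψ'.hom ▷ r ≫ (α_ _ _ _).hom)
  simp only [whiskerRight_comp, Category.assoc] at e
  have e' := congrArg (fun t => t ≫ (α_ _ _ _).hom ≫ l ◁ M'.inv) w'
  simp only [Category.assoc] at e'
  simp only [paste_hom, comp_whiskerRight, whiskerLeft_comp, Category.assoc,
    inv_hom_whiskerRight_assoc, whiskerLeft_inv_hom_assoc, associator_naturality_left_assoc]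
  rw [← whisker_exchange_assoc]
  simp only [whiskerRight_comp, Category.assoc, Iso.hom_inv_id_assoc, reassoc_of% w']
  simp

lemma paste_whiskerRight {a a' : y ⟶ x} {b : z ⟶ y} {ab ab' : z ⟶ x}
    {r r' : Q ⟶ P} {s : R ⟶ Q} {sr sr' : R ⟶ P} (K : ab ≅ b ≫ a) (K' : ab' ≅ b ≫ a')
    (φ : a ≫ p ≅ q ≫ r) (φ' : a' ≫ p ≅ q ≫ r') (ψ : b ≫ q ≅ l ≫ s)
    (M : sr ≅ s ≫ r) (M' : sr' ≅ s ≫ r') {β : a ⟶ a'} {θ : r ⟶ r'} {βb : ab ⟶ ab'}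
    {sθ : sr ⟶ sr'} (hβ : βb = K.hom ≫ b ◁ β ≫ K'.inv) (hθ : sθ = M.hom ≫ s ◁ θ ≫ M'.inv)
    (w : β ▷ p ≫ φ'.hom = φ.hom ≫ q ◁ θ) :
    βb ▷ p ≫ (paste K' φ' ψ M').hom = (paste K φ ψ M).hom ≫ l ◁ sθ := by
  have w' := congrArg (fun t => b ◁ t) w
  simp only [whiskerLeft_comp] at w'
  subst hβ hθ
  simp only [paste_hom, comp_whiskerRight, whiskerLeft_comp, Category.assoc,
    inv_hom_whiskerRight_assoc, whiskerLeft_inv_hom_assoc, whisker_assoc,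
    Iso.inv_hom_id_assoc, reassoc_of% w', associator_inv_naturality_right_assoc,
    whisker_exchange_assoc, associator_naturality_right_assoc]

lemma paste_assoc {a : y ⟶ x} {b : z ⟶ y} {e : t ⟶ z} {ab : z ⟶ x} {be : t ⟶ y} {ab_e a_be : t ⟶ x}
    {r : Q ⟶ P} {s : R ⟶ Q} {u : S ⟶ R} {sr : R ⟶ P} {us : S ⟶ Q} {u_sr us_r : S ⟶ P}
    (φ : a ≫ p ≅ q ≫ r) (ψ : b ≫ q ≅ l ≫ s) (χ : e ≫ l ≅ m ≫ u)
    (K₁ : ab ≅ b ≫ a) (K₂ : be ≅ e ≫ b) (K₃ : ab_e ≅ e ≫ ab) (K₄ : a_be ≅ be ≫ a)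
    (M₁ : sr ≅ s ≫ r) (M₂ : us ≅ u ≫ s) (M₃ : u_sr ≅ u ≫ sr) (M₄ : us_r ≅ us ≫ r)
    {β : ab_e ⟶ a_be} {θ : u_sr ⟶ us_r}
    (hβ : β = K₃.hom ≫ e ◁ K₁.hom ≫ (α_ _ _ _).inv ≫ K₂.inv ▷ a ≫ K₄.inv)
    (hθ : θ = M₃.hom ≫ u ◁ M₁.hom ≫ (α_ _ _ _).inv ≫ M₂.inv ▷ r ≫ M₄.inv) :
    β ▷ p ≫ (paste K₄ φ (paste K₂ ψ χ M₂) M₄).hom =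
      (paste K₃ (paste K₁ φ ψ M₁) χ M₃).hom ≫ m ◁ θ := by
  subst hβ hθ
  have e₁ : be ◁ φ.hom ≫ (α_ be q r).inv ≫ K₂.hom ▷ q ▷ r = (α_ be a p).inv ≫
      K₂.hom ▷ a ▷ p ≫ (α_ (e ≫ b) a p).hom ≫ (e ≫ b) ◁ φ.hom ≫ (α_ (e ≫ b) q r).inv := by
    have := whisker_exchange_assoc K₂.hom φ.hom (α_ _ _ _).inv
    simp only [whiskerRight_comp, Category.assoc, Iso.hom_inv_id, Category.comp_id] at this
    exact this
  have e₂ : (α_ e l sr).inv ≫ χ.hom ▷ sr ≫ (α_ m u sr).hom ≫ m ◁ u ◁ M₁.hom =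
      e ◁ l ◁ M₁.hom ≫ (α_ e l (s ≫ r)).inv ≫ χ.hom ▷ (s ≫ r) ≫ (α_ m u (s ≫ r)).hom := by
    rw [← associator_naturality_right, ← whisker_exchange_assoc,
      associator_inv_naturality_right_assoc]
  simp only [paste_hom, comp_whiskerRight, whiskerLeft_comp, Category.assoc,
    whisker_assoc, Iso.inv_hom_id_assoc, inv_hom_whiskerRight_assoc, whiskerLeft_inv_hom_assoc,
    reassoc_of% e₁, reassoc_of% e₂]
  simp

lemma paste_id_left {a : y ⟶ x} {i : x ⟶ x} {ia : y ⟶ x} {r : Q ⟶ P} {j : P ⟶ P} {rj : Q ⟶ P}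
    (φ : a ≫ p ≅ q ≫ r) (K : i ≅ 𝟙 x) (M : j ≅ 𝟙 P) (K' : ia ≅ a ≫ i) (M' : rj ≅ r ≫ j)
    {β : ia ⟶ a} {θ : rj ⟶ r} (hβ : β = K'.hom ≫ a ◁ K.hom ≫ (ρ_ _).hom)
    (hθ : θ = M'.hom ≫ r ◁ M.hom ≫ (ρ_ _).hom) :
    β ▷ p ≫ φ.hom = (paste K' (pasteId K p M) φ M').hom ≫ q ◁ θ := by
  subst hβ hθ
  have e : (α_ a p j).inv ≫ φ.hom ▷ j ≫ (α_ q r j).hom ≫ q ◁ r ◁ M.hom =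
      a ◁ p ◁ M.hom ≫ (α_ a p (𝟙 P)).inv ≫ φ.hom ▷ 𝟙 P ≫ (α_ q r (𝟙 P)).hom := by
    rw [← associator_naturality_right, ← whisker_exchange_assoc,
      associator_inv_naturality_right_assoc]
  simp [reassoc_of% e]

lemma paste_id_right {a : y ⟶ x} {i : y ⟶ y} {ai : y ⟶ x} {r : Q ⟶ P} {j : Q ⟶ Q} {jr : Q ⟶ P}
    (φ : a ≫ p ≅ q ≫ r) (K : i ≅ 𝟙 y) (M : j ≅ 𝟙 Q) (K' : ai ≅ i ≫ a) (M' : jr ≅ j ≫ r)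
    {β : ai ⟶ a} {θ : jr ⟶ r} (hβ : β = K'.hom ≫ K.hom ▷ a ≫ (λ_ _).hom)
    (hθ : θ = M'.hom ≫ M.hom ▷ r ≫ (λ_ _).hom) :
    β ▷ p ≫ φ.hom = (paste K' φ (pasteId K q M) M').hom ≫ q ◁ θ := by
  subst hβ hθ
  have e := whisker_exchange_assoc K.hom φ.hom (λ_ _).hom
  simp at e
  simp [e]

end

/-- A diagram `X` in `B`, a 2-functor `c : C ⥤ B`, and for each `j` a family of 1-cells
`p j i : X j ⟶ c (A j i)`. -/
structure KData {J : Type v₁} [Bicategory.{v, v} J] {C : Type v₂} [Bicategory.{v, v} C]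
    {B : Type u₁} [Bicategory.{w₁, v₃} B] (c : Pseudofunctor C B) (X : Pseudofunctor Jᵒᵖ B) where
  I : J → Type u₂
  A : ∀ j, I j → C
  p : ∀ j i, X.obj (op j) ⟶ c.obj (A j i)

namespace KData

variable {J : Type v₁} [Bicategory.{v, v} J] {C : Type v₂} [Bicategory.{v, v} C]
    {B : Type u₁} [Bicategory.{w₁, v₃} B] {c : Pseudofunctor C B} {X : Pseudofunctor Jᵒᵖ B}
    (𝒦 : KData.{w₁, v₃, v₁, v₂, u₁, u₂} c X)

/-- Objects: pairs of `j` and an index `i` of the family belonging to `j`. -/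
structure Obj where
  j : J
  i : 𝒦.I j

variable {𝒦}

abbrev Obj.A (x : 𝒦.Obj) : C := 𝒦.A x.j x.i
abbrev Obj.p (x : 𝒦.Obj) : X.obj (op x.j) ⟶ c.obj x.A := 𝒦.p x.j x.i

/-- 1-cells `(j, i) ⟶ (j', i')`: triples `(a, r, φ)` with `a : j ⟶ j'`, `r : A j' i' ⟶ A j i` and an
invertible 2-cell `φ : p_i ∘ X^a ⟹ r ∘ p_{i'}`. -/
structure Hom (x y : 𝒦.Obj) : Type (max v w₁) where
  a : x.j ⟶ y.j
  r : y.A ⟶ x.A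
  φ : tr X a ≫ x.p ≅ y.p ≫ c.map r

/-- 2-cells `(a, r, φ) ⟶ (b, s, ψ)`: pairs `(α, θ)` with `α : a ⟶ b`, `θ : r ⟶ s` and
`(θ p_{i'}) ∘ φ = ψ ∘ (p_i X^α)`. -/
@[ext]
structure Hom₂ {x y : 𝒦.Obj} (f g : Hom x y) : Type (max v w₁) where
  α : f.a ⟶ g.a
  θ : f.r ⟶ g.r
  w : tr₂ X α ▷ x.p ≫ g.φ.hom = f.φ.hom ≫ y.p ◁ c.map₂ θ

namespace Hom

@[simps]
def id (x : 𝒦.Obj) : Hom x x where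
  a := 𝟙 _
  r := 𝟙 _
  φ := pasteId (trId X x.j) x.p (c.mapId x.A)

@[simps]
def comp {x y z : 𝒦.Obj} (f : Hom x y) (g : Hom y z) : Hom x z where
  a := f.a ≫ g.a
  r := g.r ≫ f.r
  φ := paste (trComp X f.a g.a) f.φ g.φ (c.mapComp g.r f.r)

end Hom

instance : CategoryStruct 𝒦.Obj where
  Hom x y := Hom x y
  id x := Hom.id x
  comp f g := Hom.comp f g

instance homCategory (x y : 𝒦.Obj) : Category (x ⟶ y) where
  Hom f g := Hom₂ f g
  id f := ⟨𝟙 _, 𝟙 _, by simp [tr₂_id]⟩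
  comp η κ := ⟨η.α ≫ κ.α, η.θ ≫ κ.θ, by
    simp [tr₂_comp, κ.w, reassoc_of% η.w]⟩
  id_comp _ := Hom₂.ext (Category.id_comp _) (Category.id_comp _)
  comp_id _ := Hom₂.ext (Category.comp_id _) (Category.comp_id _)
  assoc _ _ _ := Hom₂.ext (Category.assoc _ _ _) (Category.assoc _ _ _)

@[simps]
def isoMk {x y : 𝒦.Obj} {f g : x ⟶ y} (α : Hom.a f ≅ Hom.a g) (θ : Hom.r f ≅ Hom.r g)
    (w : tr₂ X α.hom ▷ x.p ≫ (Hom.φ g).hom = (Hom.φ f).hom ≫ y.p ◁ c.map₂ θ.hom) : f ≅ g where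
  hom := ⟨α.hom, θ.hom, w⟩
  inv := ⟨α.inv, θ.inv, by
    have h₁ : tr₂ X α.inv ▷ x.p ≫ tr₂ X α.hom ▷ x.p = 𝟙 _ := by
      rw [← comp_whiskerRight, ← tr₂_comp, α.inv_hom_id, tr₂_id, id_whiskerRight]
    have h₂ : y.p ◁ c.map₂ θ.hom ≫ y.p ◁ c.map₂ θ.inv = 𝟙 _ := by
      rw [← whiskerLeft_comp, ← c.map₂_comp, θ.hom_inv_id, c.map₂_id, whiskerLeft_id]
    calc tr₂ X α.inv ▷ x.p ≫ (Hom.φ f).hom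
        = tr₂ X α.inv ▷ x.p ≫ ((Hom.φ f).hom ≫ y.p ◁ c.map₂ θ.hom) ≫ y.p ◁ c.map₂ θ.inv := by
          rw [Category.assoc, h₂, Category.comp_id]
      _ = (Hom.φ g).hom ≫ y.p ◁ c.map₂ θ.inv := by
          rw [← w, Category.assoc, reassoc_of% h₁]⟩
  hom_inv_id := Hom₂.ext (Iso.hom_inv_id _) (Iso.hom_inv_id _)
  inv_hom_id := Hom₂.ext (Iso.inv_hom_id _) (Iso.inv_hom_id _)

instance : Bicategory 𝒦.Obj where
  homCategory := homCategory
  whiskerLeft f _ _ η := Hom₂.mk (Hom.a f ◁ Hom₂.α η) (Hom₂.θ η ▷ Hom.r f)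
    (paste_whiskerLeft _ _ _ _ _ _ _ (tr₂_whiskerLeft X _ _) (c.map₂_whisker_right _ _) η.w)
  whiskerRight η h := Hom₂.mk (Hom₂.α η ▷ Hom.a h) (Hom.r h ◁ Hom₂.θ η)
    (paste_whiskerRight _ _ _ _ _ _ _ (tr₂_whiskerRight X _ _) (c.map₂_whisker_left _ _) η.w)
  associator f g h := isoMk (α_ (Hom.a f) (Hom.a g) (Hom.a h))
    (α_ (Hom.r h) (Hom.r g) (Hom.r f)).symm
    (paste_assoc _ _ _ _ _ _ _ _ _ _ _ (tr₂_associator X _ _ _) (map₂_associator_inv c _ _ _))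
  leftUnitor f := isoMk (λ_ (Hom.a f)) (ρ_ (Hom.r f))
    (paste_id_left _ _ _ _ _ (tr₂_leftUnitor X _) (c.map₂_right_unitor _))
  rightUnitor f := isoMk (ρ_ (Hom.a f)) (λ_ (Hom.r f))
    (paste_id_right _ _ _ _ _ (tr₂_rightUnitor X _) (c.map₂_left_unitor _))
  whiskerLeft_id _ _ := Hom₂.ext (whiskerLeft_id _ _) (id_whiskerRight _ _)
  whiskerLeft_comp _ _ _ _ _ _ := Hom₂.ext (whiskerLeft_comp _ _ _) (comp_whiskerRight _ _ _)
  id_whiskerLeft _ := Hom₂.ext (id_whiskerLeft _) (whiskerRight_id _)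
  comp_whiskerLeft _ _ _ _ _ := Hom₂.ext (comp_whiskerLeft _ _ _) (whiskerRight_comp _ _ _)
  id_whiskerRight _ _ := Hom₂.ext (id_whiskerRight _ _) (whiskerLeft_id _ _)
  comp_whiskerRight _ _ _ := Hom₂.ext (comp_whiskerRight _ _ _) (whiskerLeft_comp _ _ _)
  whiskerRight_id _ := Hom₂.ext (whiskerRight_id _) (id_whiskerLeft _)
  whiskerRight_comp _ _ _ := Hom₂.ext (whiskerRight_comp _ _ _) (comp_whiskerLeft _ _ _)
  whisker_assoc _ _ _ _ _ := Hom₂.ext (whisker_assoc _ _ _) (whisker_assoc_symm _ _ _)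
  whisker_exchange _ _ := Hom₂.ext (whisker_exchange _ _) (whisker_exchange _ _).symm
  pentagon _ _ _ _ := Hom₂.ext (pentagon _ _ _ _) (pentagon_inv _ _ _ _)
  triangle _ _ := Hom₂.ext (triangle _ _) (triangle_assoc_comp_right _ _)

/-- An invertible 2-cell with identity components is an identity. -/
lemma eq_eqToIso {x y : 𝒦.Obj} {f g : x ⟶ y} (e : f ≅ g) (ha : Hom.a f = Hom.a g)
    (hr : Hom.r f = Hom.r g) (hα : Hom₂.α e.hom = eqToHom ha) (hθ : Hom₂.θ e.hom = eqToHom hr) :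
    ∃ h : f = g, e = eqToIso h := by
  obtain ⟨a, r, φ⟩ := f
  obtain ⟨a', r', φ'⟩ := g
  obtain rfl : a = a' := ha
  obtain rfl : r = r' := hr
  have w := Hom₂.w e.hom
  rw [hα, hθ] at w
  obtain rfl : φ = φ' := by
    ext
    simpa [tr₂_id] using w.symm
  refine ⟨rfl, ?_⟩
  ext1
  exact Hom₂.ext hα hθ

instance [Strict J] [Strict C] : Strict 𝒦.Obj := by
  have h₁ {x y : 𝒦.Obj} (f : x ⟶ y) := eq_eqToIso (λ_ f) (Strict.id_comp _) (Strict.comp_id _)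
    (congrArg Iso.hom (Strict.leftUnitor_eqToIso (Hom.a f)))
    (congrArg Iso.hom (Strict.rightUnitor_eqToIso (Hom.r f)))
  have h₂ {x y : 𝒦.Obj} (f : x ⟶ y) := eq_eqToIso (ρ_ f) (Strict.comp_id _) (Strict.id_comp _)
    (congrArg Iso.hom (Strict.rightUnitor_eqToIso (Hom.a f)))
    (congrArg Iso.hom (Strict.leftUnitor_eqToIso (Hom.r f)))
  have h₃ {x y z t : 𝒦.Obj} (f : x ⟶ y) (g : y ⟶ z) (h : z ⟶ t) := eq_eqToIso (α_ f g h)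
    (Strict.assoc _ _ _) (Strict.assoc _ _ _).symm
    (congrArg Iso.hom (Strict.associator_eqToIso (Hom.a f) (Hom.a g) (Hom.a h)))
    (congrArg Iso.inv (Strict.associator_eqToIso (Hom.r h) (Hom.r g) (Hom.r f)))
  exact
    { id_comp := fun f => (h₁ f).1
      comp_id := fun f => (h₂ f).1
      assoc := fun f g h => (h₃ f g h).1
      leftUnitor_eqToIso := fun f => (h₁ f).2
      rightUnitor_eqToIso := fun f => (h₂ f).2
      associator_eqToIso := fun f g h => (h₃ f g h).2 }

variable (𝒦) in
/-- The 2-functor `(j, i) ↦ A j i`, `(a, r, φ) ↦ r`, `(α, θ) ↦ θ`. -/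
def diagram [Strict C] : StrictPseudofunctor 𝒦.Objᵒᵖ C where
  obj x := x.unop.A
  map f := Hom.r f.unop
  map₂ η := Hom₂.θ η.unop2
  mapId _ := Iso.refl _
  mapComp _ _ := Iso.refl _
  map₂_id _ := rfl
  map₂_comp _ _ := rfl
  map₂_whisker_left f _ _ η := by
    change Hom.r f.unop ◁ Hom₂.θ η.unop2 = 𝟙 _ ≫ Hom.r f.unop ◁ Hom₂.θ η.unop2 ≫ 𝟙 _
    simp
  map₂_whisker_right η f := by
    change Hom₂.θ η.unop2 ▷ Hom.r f.unop = 𝟙 _ ≫ Hom₂.θ η.unop2 ▷ Hom.r f.unop ≫ 𝟙 _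
    simp
  map₂_associator f g h := by
    change (α_ (Hom.r f.unop) (Hom.r g.unop) (Hom.r h.unop)).hom = 𝟙 _ ≫ 𝟙 _ ▷ _ ≫
      (α_ (Hom.r f.unop) (Hom.r g.unop) (Hom.r h.unop)).hom ≫ _ ◁ 𝟙 _ ≫ 𝟙 _
    simp
  map₂_left_unitor f := by
    change (λ_ (Hom.r f.unop)).hom = 𝟙 _ ≫ 𝟙 _ ▷ _ ≫ (λ_ (Hom.r f.unop)).hom
    simp
  map₂_right_unitor f := by
    change (ρ_ (Hom.r f.unop)).hom = 𝟙 _ ≫ _ ◁ 𝟙 _ ≫ (ρ_ (Hom.r f.unop)).hom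
    simp
  map_id _ := rfl
  mapId_eq_eqToIso _ := rfl
  map_comp _ _ := rfl
  mapComp_eq_eqToIso _ _ := rfl

end KData

namespace Pro
open scoped Pseudofunctor.StrongTrans
variable {C : Type u} [Bicategory.{v, v} C] [Strict C]

/-- An invertible 2-cell between morphisms of 2-pro-objects whose components are identities is an
identity. -/
lemma eq_eqToIso {X Y : Pro C} {f g : X ⟶ Y} (e : f ≅ g)
    (happ : ∀ D, ∃ h : (Hom.trans f).app D = (Hom.trans g).app D,
      (Hom₂.mod e.hom).as.app D = eqToHom h) : ∃ h : f = g, e = eqToIso h := by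
  obtain ⟨⟨app, nat, _, _, _⟩, hf⟩ := f
  obtain ⟨⟨app', nat', _, _, _⟩, hg⟩ := g
  obtain rfl : app = app' := funext fun D => (happ D).1
  obtain rfl : @nat = @nat' := by
    funext D D' r
    obtain ⟨_, h₁⟩ := hf r
    obtain ⟨_, h₂⟩ := hg r
    exact h₁.trans h₂.symm
  refine ⟨rfl, ?_⟩
  ext1
  apply hom₂_ext
  apply Pseudofunctor.StrongTrans.homCategory.ext
  intro D
  exact (happ D).2

instance : Strict (Pro C) := by
  have h₁ {X Y : Pro C} (f : X ⟶ Y) := eq_eqToIso (λ_ f) (fun D => ⟨Strict.comp_id _,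
    congrArg Iso.hom (Strict.rightUnitor_eqToIso ((Hom.trans f).app D))⟩)
  have h₂ {X Y : Pro C} (f : X ⟶ Y) := eq_eqToIso (ρ_ f) (fun D => ⟨Strict.id_comp _,
    congrArg Iso.hom (Strict.leftUnitor_eqToIso ((Hom.trans f).app D))⟩)
  have h₃ {X Y Z W : Pro C} (f : X ⟶ Y) (g : Y ⟶ Z) (h : Z ⟶ W) := eq_eqToIso (α_ f g h)
    (fun D => ⟨(Strict.assoc _ _ _).symm, congrArg Iso.inv (Strict.associator_eqToIso
      ((Hom.trans h).app D) ((Hom.trans g).app D) ((Hom.trans f).app D))⟩)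
  exact
    { id_comp := fun f => (h₁ f).1
      comp_id := fun f => (h₂ f).1
      assoc := fun f g h => (h₃ f g h).1
      leftUnitor_eqToIso := fun f => (h₁ f).2
      rightUnitor_eqToIso := fun f => (h₂ f).2
      associator_eqToIso := fun f g h => (h₃ f g h).2 }

lemma eltId_eq (A : C) : ∃ h : elt (const A) ⟨⟩ (𝟙 A) = 𝟙 (const A), eltId A = eqToIso h :=
  eq_eqToIso _ fun D => by
    obtain ⟨h, e⟩ := Cat.eq_eqToIso (Cat.Hom.isoMk (eltIdNat A D))
      (fun (x : CCat A D) => congrArg CCat.mk (Strict.id_comp (arr x))) (fun (x : CCat A D) => by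
        change ccell (λ_ (arr x)).hom = _
        rw [Strict.leftUnitor_eqToIso, eqToIso.hom]
        exact cell_eqToHom _ _)
    exact ⟨h, congrArg Iso.hom e⟩

lemma eltComp_eq (X : Pro C) (i : X.idx) {A B : C} (r : X.at' i ⟶ A) (s : A ⟶ B) :
    ∃ h : elt X i (r ≫ s) = elt X i r ≫ elt (const A) ⟨⟩ s, eltComp X i r s = eqToIso h :=
  eq_eqToIso _ fun D => by
    obtain ⟨h, e⟩ := Cat.eq_eqToIso (Cat.Hom.isoMk (eltCompNat X i r s D))
      (fun (x : CCat B D) => congrArg (ColimObj.mk i) (Strict.assoc r s (arr x)))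
      (fun (x : CCat B D) => by
        change cell i (α_ r s (arr x)).hom = _
        rw [Strict.associator_eqToIso, eqToIso.hom]
        exact cell_eqToHom _ _)
    exact ⟨h, congrArg Iso.hom e⟩

/-- The canonical 2-functor from `C` to 2-pro-objects. -/
def emb : StrictPseudofunctor C (Pro C) where
  __ := embPseudo
  map_id A := (eltId_eq A).1
  mapId_eq_eqToIso A := (eltId_eq A).2
  map_comp r s := (eltComp_eq (const _) ⟨⟩ r s).1
  mapComp_eq_eqToIso r s := (eltComp_eq (const _) ⟨⟩ r s).2

variable {J : Type v} [Bicategory.{v, v} J]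

/-- The projections `π_i : X^j ⟶ X^j_i` of a diagram `X` of 2-pro-objects. -/
def kData (X : StrictPseudofunctor Jᵒᵖ (Pro C)) :
    KData.{max u v, max u v, v, u, max (u + 1) (v + 1), v} (emb (C := C)).toPseudofunctor X.toPseudofunctor where
  I j := (X.obj (op j)).idx
  A j i := (X.obj (op j)).at' i
  p j i := (X.obj (op j)).π i

/-- The index 2-category `K_X`: its objects are the pairs `(j, i)`, its 1-cells the triples
`(a, r, φ)` with `(r, φ)` representing `X^a`, its 2-cells the pairs `(α, θ)` with `(θ, r, φ, s, ψ)`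
representing `X^α`. -/
abbrev K (X : StrictPseudofunctor Jᵒᵖ (Pro C)) : Type v := (kData X).Obj

/-- The 2-pro-object indexed by `K_X` with values `(j, i) ↦ X^j_i`. -/
def lim [Strict J] (X : StrictPseudofunctor Jᵒᵖ (Pro C)) (hs : IsSmallTwoCategory (K X))
    (hf : IsTwoFiltered (K X)) : Pro C where
  idx := K X
  small := hs
  filtered := hf
  diagram := (kData X).diagram

end Pro

section Cone
open scoped Pseudofunctor.StrongTrans

variable (A : Type u₁) [Bicategory.{w₁, v₁} A] {B : Type u₂} [Bicategory.{w₂, v₂} B]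

/-- The constant 2-functor with value `W`. -/
@[simps]
def constPseudo (W : B) : Pseudofunctor A B where
  obj _ := W
  map _ := 𝟙 W
  map₂ _ := 𝟙 _
  mapId _ := Iso.refl _
  mapComp _ _ := (λ_ (𝟙 W)).symm

/-- A 1-cell as a transformation of constant 2-functors. -/
@[simps]
def constTrans {W V : B} (f : W ⟶ V) : constPseudo A W ⟶ constPseudo A V where
  app _ := f
  naturality _ := λ_ f ≪≫ (ρ_ f).symm
  naturality_naturality _ := by
    change 𝟙 (𝟙 W) ▷ f ≫ (λ_ f).hom ≫ (ρ_ f).inv = ((λ_ f).hom ≫ (ρ_ f).inv) ≫ f ◁ 𝟙 (𝟙 V)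
    simp
  naturality_id _ := by
    change ((λ_ f).hom ≫ (ρ_ f).inv) ≫ f ◁ 𝟙 (𝟙 V) = 𝟙 (𝟙 W) ▷ f ≫ (λ_ f).hom ≫ (ρ_ f).inv
    simp
  naturality_comp _ _ := by
    change ((λ_ f).hom ≫ (ρ_ f).inv) ≫ f ◁ (λ_ (𝟙 V)).inv = (λ_ (𝟙 W)).inv ▷ f ≫
      (α_ (𝟙 W) (𝟙 W) f).hom ≫ 𝟙 W ◁ ((λ_ f).hom ≫ (ρ_ f).inv) ≫ (α_ (𝟙 W) f (𝟙 V)).inv ≫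
      ((λ_ f).hom ≫ (ρ_ f).inv) ▷ 𝟙 V ≫ (α_ f (𝟙 V) (𝟙 V)).hom
    bicategory

/-- A 2-cell as a modification. -/
def constMod {W V : B} {f g : W ⟶ V} (η : f ⟶ g) : constTrans A f ⟶ constTrans A g where
  as :=
    { app _ := η
      naturality _ := by
        change 𝟙 W ◁ η ≫ (λ_ g).hom ≫ (ρ_ g).inv = ((λ_ f).hom ≫ (ρ_ f).inv) ≫ η ▷ 𝟙 V
        simp }

variable {A}

/-- Pseudocones over `F` with vertex `W`: pseudonatural transformations from the constant 2-functor;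
they form a category whose morphisms are the modifications. -/
abbrev Pseudocone (F : Pseudofunctor A B) (W : B) := constPseudo A W ⟶ F

/-- Precomposition of a pseudocone with the 1-cells and 2-cells into its vertex. -/
def Pseudocone.precomp {F : Pseudofunctor A B} {L : B} (π : Pseudocone F L) (W : B) :
    (W ⟶ L) ⥤ Pseudocone F W where
  obj f := constTrans A f ≫ π
  map η := constMod A η ▷ π
  map_id f := id_whiskerRight (constTrans A f) π
  map_comp η θ := comp_whiskerRight (constMod A η) (constMod A θ) π

/-- A pseudocone is universal (its vertex is the pseudolimit) if for every `W` the functor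
`B(W, L) ⥤ PC(W, F)` is an isomorphism of categories, that is, fully faithful and bijective on
objects. -/
structure IsPseudolimit {F : Pseudofunctor A B} {L : B} (π : Pseudocone F L) : Prop where
  full (W : B) : (π.precomp W).Full
  faithful (W : B) : (π.precomp W).Faithful
  bijective (W : B) : Function.Bijective (π.precomp W).obj
end Cone

end TwoPro

open CategoryTheory TwoPro

/-! A functor out of `colim_i C(X^j_i, D)` is a pseudocone under the categories `C(X^j_i, D)`. A
pseudocone over `X` with vertex `W` therefore consists of functors from all the `C(X^j_i, D)` to
`colim C(W_w, D)`, of isomorphisms between them for the transition 1-cells of each `X^j`, and of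
isomorphisms for each `X^a`, all natural in `D`. The value of `X^a` at `(i, id)` is some object `(k,
r)`, so `X^a` is represented at `i` by `r`, and the isomorphism for `X^a` becomes one attached to
the 1-cell `(a, r, φ)` of `K_X`. A transition 1-cell of `X^j` represents the identity of `X^j`, so
it is also attached to a 1-cell of `K_X`. Hence pseudocones over `X` are pseudocones indexed by
`K_X`, natural in `D`, and these are the 1-cells from `W` to the 2-pro-object indexed by `K_X`.

For this one needs `K_X` to be 2-filtered, and the isomorphism for `X^a` must not depend on the
chosen representative (`cmp_comp₂`, `cmp_eq`). Both rest on a calculus of fractions in 2-filtered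
pseudocolimits. Every morphism is a fraction (`Frac.exists_eval_eq`), 2-cells that agree in the
pseudocolimit agree at a later index (`exists_whiskerLeft_eq_of_cell_eq`), and isomorphisms are
represented by invertible 2-cells (`exists_up_cellIso_down`). The second statement needs an
invariant that detects equality of words. It is the functor to sets obtained from fractions out of a
fixed object modulo `Frac.Rel`, which exists by the universal property of the pseudocolimit.

The link with 2-pro-objects is a Yoneda argument: a 2-cell between 1-cells `X ⟶ A` with `A` in `C`
is determined by its component at `𝟙 A`, and every isomorphism between the values at `𝟙 A` occurs
(`comp₂_ext_id`, `isoOfIso`). So the condition defining 2-cells of `K_X` is an equation in a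
pseudocolimit, and fractions turn morphisms there into 2-cells of `K_X` (`isCell_comp_up_of_eval`).

The comparison with pseudocones has to be an isomorphism of categories. Injectivity and surjectivity
on objects both follow from the fact that an invertible 2-cell with identity components is an
identity. -/

namespace TwoPro

open CategoryTheory Bicategory Opposite

/-! ### Consequences of the 2-filteredness axioms. -/

namespace IsTwoFiltered

variable {I : Type u₁} [Bicategory.{w₁, v₁} I]

/-- F1 gives some invertible 2-cell between the same 1-cells at a later stage, and F2 identifies `α`
with it. This makes arbitrary 2-cells of the index usable in `Frac.Rel`, which only allows
invertible ones. -/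
lemma exists_isIso_whiskerRight (hI : IsTwoFiltered I) {a b : I} {f g : a ⟶ b} (α : f ⟶ g) :
    ∃ (c : I) (h : b ⟶ c), IsIso (α ▷ h) := by
  obtain ⟨c, h, ⟨e⟩⟩ := hI.f1 f g
  obtain ⟨d, k, hk⟩ := hI.f2 (α ▷ h) e.hom
  refine ⟨d, h ≫ k, ?_⟩
  rw [whiskerRight_comp, hk]
  infer_instance

lemma exists_square (hI : IsTwoFiltered I) {a b c : I} (f : a ⟶ b) (g : a ⟶ c) :
    ∃ (d : I) (h : b ⟶ d) (k : c ⟶ d), Nonempty (f ≫ h ≅ g ≫ k) := by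
  obtain ⟨d, ⟨h⟩, ⟨k⟩⟩ := hI.f0 b c
  obtain ⟨e, l, ⟨i⟩⟩ := hI.f1 (f ≫ h) (g ≫ k)
  exact ⟨e, h ≫ l, k ≫ l, ⟨(α_ _ _ _).symm ≪≫ i ≪≫ α_ _ _ _⟩⟩

end IsTwoFiltered

/-! ### Calculus of fractions in 2-filtered pseudocolimits of categories. -/

section Fractions

variable {I : Type u₁} [Bicategory.{w₁, v₁} I] {C : Type u₂} [Bicategory.{w₂, v₂} C]
  {X : Pseudofunctor Iᵒᵖ C} {D : C}

/-- Compatibility of `θ` and `θ'` with the 2-cells `α` and `β` of the index 2-category. -/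
def Sq {i j k : I} {r : X.obj (op i) ⟶ D} {s : X.obj (op j) ⟶ D} {u u' : i ⟶ k} {v v' : j ⟶ k}
    (α : u ⟶ u') (β : v ⟶ v') (θ : tr X u ≫ r ⟶ tr X v ≫ s)
    (θ' : tr X u' ≫ r ⟶ tr X v' ≫ s) : Prop :=
  θ ≫ tr₂ X β ▷ s = tr₂ X α ▷ r ≫ θ'

/-- The transition of a 2-cell along a 1-cell `w` of the index 2-category. -/
def shift {i j k m : I} {r : X.obj (op i) ⟶ D} {s : X.obj (op j) ⟶ D} {u : i ⟶ k} {v : j ⟶ k}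
    (θ : tr X u ≫ r ⟶ tr X v ≫ s) (w : k ⟶ m) :
    tr X (u ≫ w) ≫ r ⟶ tr X (v ≫ w) ≫ s :=
  (trComp X u w).hom ▷ r ≫ (α_ _ _ _).hom ≫ tr X w ◁ θ ≫ (α_ _ _ _).inv ≫
    (trComp X v w).inv ▷ s

namespace Sq

variable {i j k m n : I} {r : X.obj (op i) ⟶ D} {s : X.obj (op j) ⟶ D} {u u' u'' : i ⟶ k}
  {v v' v'' : j ⟶ k} {θ : tr X u ≫ r ⟶ tr X v ≫ s} {θ' : tr X u' ≫ r ⟶ tr X v' ≫ s}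
  {θ'' : tr X u'' ≫ r ⟶ tr X v'' ≫ s}

lemma refl (θ : tr X u ≫ r ⟶ tr X v ≫ s) : Sq (𝟙 u) (𝟙 v) θ θ := by
  simp [Sq, tr₂_id]

lemma trans {α : u ⟶ u'} {α' : u' ⟶ u''} {β : v ⟶ v'} {β' : v' ⟶ v''}
    (h : Sq α β θ θ') (h' : Sq α' β' θ' θ'') : Sq (α ≫ α') (β ≫ β') θ θ'' := by
  unfold Sq at *
  simp only [tr₂_comp, comp_whiskerRight, Category.assoc, ← h', reassoc_of% h]

lemma symm {α : u ≅ u'} {β : v ≅ v'} (h : Sq α.hom β.hom θ θ') : Sq α.inv β.inv θ' θ := by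
  unfold Sq at *
  have h₁ : tr₂ X α.inv ▷ r ≫ tr₂ X α.hom ▷ r = 𝟙 _ := by
    rw [← comp_whiskerRight, ← tr₂_comp, α.inv_hom_id, tr₂_id, id_whiskerRight]
  have h₂ : tr₂ X β.hom ▷ s ≫ tr₂ X β.inv ▷ s = 𝟙 _ := by
    rw [← comp_whiskerRight, ← tr₂_comp, β.hom_inv_id, tr₂_id, id_whiskerRight]
  calc θ' ≫ tr₂ X β.inv ▷ s = tr₂ X α.inv ▷ r ≫ (tr₂ X α.hom ▷ r ≫ θ') ≫ tr₂ X β.inv ▷ s := by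
        rw [Category.assoc, reassoc_of% h₁]
    _ = _ := by rw [← h, Category.assoc, h₂, Category.comp_id]

lemma whiskerRight {α : u ⟶ u'} {β : v ⟶ v'} (h : Sq α β θ θ') (w : k ⟶ m) :
    Sq (α ▷ w) (β ▷ w) (shift θ w) (shift θ' w) := by
  unfold Sq shift at *
  have h' := congrArg (fun t => tr X w ◁ t) h
  simp only [whiskerLeft_comp] at h'
  simp only [tr₂_whiskerRight, comp_whiskerRight, Category.assoc,
    inv_hom_whiskerRight_assoc, whisker_assoc, Iso.inv_hom_id_assoc, reassoc_of% h']

lemma whiskerLeft (θ : tr X u ≫ r ⟶ tr X v ≫ s) {w w' : k ⟶ m} (γ : w ⟶ w') :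
    Sq (u ◁ γ) (v ◁ γ) (shift θ w) (shift θ w') := by
  unfold Sq shift
  simp only [tr₂_whiskerLeft, comp_whiskerRight, Category.assoc, inv_hom_whiskerRight_assoc]
  rw [← associator_inv_naturality_left_assoc, whisker_exchange_assoc,
    associator_naturality_left_assoc]

/-- Successive shifts live over differently bracketed legs, so functoriality of `shift` is a square
over the associators and not an equation. -/
lemma shift_shift (θ : tr X u ≫ r ⟶ tr X v ≫ s) (w : k ⟶ m) (w' : m ⟶ n) :
    Sq (α_ u w w').hom (α_ v w w').hom (shift (shift θ w) w') (shift θ (w ≫ w')) := by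
  unfold Sq shift
  simp only [tr₂_associator, comp_whiskerRight, whiskerLeft_comp, Category.assoc,
    inv_hom_whiskerRight_assoc, whisker_assoc, Iso.inv_hom_id_assoc]
  have e : (trComp X w w').inv ▷ tr X u ▷ r ≫ (α_ _ _ _).hom ≫ tr X (w ≫ w') ◁ θ =
      (α_ _ _ _).hom ≫ (tr X w' ≫ tr X w) ◁ θ ≫ (trComp X w w').inv ▷ (tr X v ≫ s) := by
    rw [whisker_exchange, associator_naturality_left_assoc]
  simp [reassoc_of% e]

end Sq

lemma up_up_cell {i j k : I} (s : i ⟶ j) (t : j ⟶ k) (r : X.obj (op i) ⟶ D) :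
    (up s r).hom ≫ (up t (tr X s ≫ r)).hom ≫ cell k ((α_ _ _ _).inv ≫ (trComp X s t).inv ▷ r) =
      (up (s ≫ t) r).hom := by
  rw [← up_comp_assoc, cell_comp]
  simp

variable (x y : ColimObj X D)

/-- A fraction from `x` to `y`: a 2-cell between restrictions of `x` and `y` to a common index. -/
structure Frac where
  k : I
  u : x.idx ⟶ k
  v : y.idx ⟶ k
  θ : tr X u ≫ x.arr ⟶ tr X v ≫ y.arr

variable {x y}

namespace Frac

/-- The morphism of the pseudocolimit represented by a fraction. -/
def eval (p : Frac x y) : x ⟶ y := (up p.u x.arr).hom ≫ cell p.k p.θ ≫ (up p.v y.arr).inv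

/-- Two fractions are related if they become isomorphic at a common later index. -/
def Rel (p q : Frac x y) : Prop :=
  ∃ (m : I) (w : p.k ⟶ m) (w' : q.k ⟶ m) (α : p.u ≫ w ≅ q.u ≫ w') (β : p.v ≫ w ≅ q.v ≫ w'),
    Sq α.hom β.hom (shift p.θ w) (shift q.θ w')

lemma Rel.symm {p q : Frac x y} : Rel p q → Rel q p := fun ⟨m, w, w', α, β, h⟩ =>
  ⟨m, w', w, α.symm, β.symm, h.symm⟩

lemma Rel.trans (hI : IsTwoFiltered I) {p q t : Frac x y} : Rel p q → Rel q t → Rel p t := by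
  rintro ⟨m, w, w₁, α, β, h⟩ ⟨m', w₂, w₃, α', β', h'⟩
  -- The two comparisons use two shifts `w₁`, `w₂` of the middle fraction `q`. One and the same `γ`
  -- acts on both legs of `q`, which is what `Sq.whiskerLeft` requires.
  obtain ⟨n, y, y', ⟨γ⟩⟩ := hI.exists_square w₁ w₂
  refine ⟨n, w ≫ y, w₃ ≫ y',
    (α_ _ _ _).symm ≪≫ whiskerRightIso α y ≪≫ α_ _ _ _ ≪≫ whiskerLeftIso _ γ ≪≫
      (α_ _ _ _).symm ≪≫ whiskerRightIso α' y' ≪≫ α_ _ _ _,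
    (α_ _ _ _).symm ≪≫ whiskerRightIso β y ≪≫ α_ _ _ _ ≪≫ whiskerLeftIso _ γ ≪≫
      (α_ _ _ _).symm ≪≫ whiskerRightIso β' y' ≪≫ α_ _ _ _, ?_⟩
  exact (Sq.shift_shift p.θ w y).symm.trans ((h.whiskerRight y).trans
    ((Sq.shift_shift q.θ w₁ y).trans ((Sq.whiskerLeft q.θ γ.hom).trans
      ((Sq.shift_shift q.θ w₂ y').symm.trans ((h'.whiskerRight y').trans
        (Sq.shift_shift t.θ w₃ y'))))))

lemma Rel.of_sq {k : I} {u u' : x.idx ⟶ k} {v v' : y.idx ⟶ k} (α : u ≅ u') (β : v ≅ v')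
    {θ : tr X u ≫ x.arr ⟶ tr X v ≫ y.arr} {θ' : tr X u' ≫ x.arr ⟶ tr X v' ≫ y.arr}
    (h : Sq α.hom β.hom θ θ') : Rel (x := x) (y := y) ⟨k, u, v, θ⟩ ⟨k, u', v', θ'⟩ :=
  ⟨k, 𝟙 k, 𝟙 k, whiskerRightIso α _, whiskerRightIso β _, h.whiskerRight _⟩

lemma Rel.refl (p : Frac x y) : Rel p p := Rel.of_sq (Iso.refl _) (Iso.refl _) (Sq.refl _)

/-- By `up_cell` the structure isomorphisms for `u` and `u'` differ exactly by the cell of `α`.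
Hence `α` and `β` need not be invertible. -/
lemma eval_congr {k : I} {u u' : x.idx ⟶ k} {v v' : y.idx ⟶ k} {α : u ⟶ u'} {β : v ⟶ v'}
    {θ : tr X u ≫ x.arr ⟶ tr X v ≫ y.arr} {θ' : tr X u' ≫ x.arr ⟶ tr X v' ≫ y.arr}
    (h : Sq α β θ θ') : eval (x := x) (y := y) ⟨k, u, v, θ⟩ = eval ⟨k, u', v', θ'⟩ := by
  unfold Sq at h
  simp only [eval]
  rw [← up_cell α, Category.assoc, ← Category.assoc (cell _ _) (cell _ _), cell_comp, ← h,
    ← cell_comp, Category.assoc, ← cancel_mono (up v' y.arr).hom]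
  simp only [Category.assoc, Iso.inv_hom_id, Category.comp_id]
  rw [← up_cell β y.arr, Iso.inv_hom_id_assoc]

lemma eval_shift (p : Frac x y) {m : I} (w : p.k ⟶ m) :
    eval (x := x) (y := y) ⟨m, p.u ≫ w, p.v ≫ w, shift p.θ w⟩ = eval p := by
  simp only [eval]
  rw [← Category.assoc, Iso.comp_inv_eq, ← up_up_cell p.u w, ← up_up_cell p.v w]
  simp only [Category.assoc, Iso.inv_hom_id_assoc, cell_up_assoc, cell_comp]
  simp [shift]

/-- Composition of a fraction with a 2-cell. -/
def mapCell {i : I} {r s : X.obj (op i) ⟶ D} (p : Frac x ⟨i, r⟩) (θ : r ⟶ s) : Frac x ⟨i, s⟩ :=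
  ⟨p.k, p.u, p.v, p.θ ≫ tr X p.v ◁ θ⟩

lemma eval_mapCell {i : I} {r s : X.obj (op i) ⟶ D} (p : Frac x ⟨i, r⟩) (θ : r ⟶ s) :
    (p.mapCell θ).eval = p.eval ≫ cell i θ := by
  simp only [eval, mapCell, ← cell_comp, Category.assoc]
  congr 2
  rw [Iso.eq_inv_comp, ← Category.assoc, ← cell_up]
  simp

lemma Rel.mapCell {i : I} {r s : X.obj (op i) ⟶ D} {p q : Frac x ⟨i, r⟩} (θ : r ⟶ s) :
    Rel p q → Rel (p.mapCell θ) (q.mapCell θ) := fun ⟨m, w, w', α, β, h⟩ =>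
  ⟨m, w, w', α, β, by
    unfold Sq at *
    have e {k : I} {u : x.idx ⟶ k} {v : i ⟶ k} (η : tr X u ≫ x.arr ⟶ tr X v ≫ r) (w : k ⟶ m) :
        shift (η ≫ tr X v ◁ θ) w = shift η w ≫ tr X (v ≫ w) ◁ θ := by
      simp only [shift, whiskerLeft_comp, Category.assoc, ← whisker_exchange]
      simp
    dsimp only [Frac.mapCell]
    rw [e, e, reassoc_of% h.symm, Category.assoc, ← whisker_exchange]⟩

/-- The composite of `η` with the coherence 2-cell for `s` and `v`. -/
def dn {i j k : I} {r : X.obj (op i) ⟶ D} {a : X.obj (op k) ⟶ D} (s : i ⟶ j) {v : j ⟶ k}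
    (η : a ⟶ tr X v ≫ tr X s ≫ r) : a ⟶ tr X (s ≫ v) ≫ r :=
  η ≫ (α_ _ _ _).inv ≫ (trComp X s v).inv ▷ r

/-- Composition of a fraction with the inverse of a structure isomorphism. -/
def mapDown {i j : I} {r : X.obj (op i) ⟶ D} (s : i ⟶ j) (p : Frac x ⟨j, tr X s ≫ r⟩) :
    Frac x ⟨i, r⟩ :=
  ⟨p.k, p.u, s ≫ p.v, dn s p.θ⟩

lemma eval_mapDown {i j : I} {r : X.obj (op i) ⟶ D} (s : i ⟶ j) (p : Frac x ⟨j, tr X s ≫ r⟩) :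
    (mapDown s p).eval = p.eval ≫ (up s r).inv := by
  simp only [eval, mapDown, dn, ← cell_comp, Category.assoc]
  congr 2
  rw [← Category.assoc, Iso.comp_inv_eq, Category.assoc, Iso.eq_inv_comp, cell_comp, Iso.eq_inv_comp,
    up_up_cell]

lemma shift_dn {i j k m : I} {r : X.obj (op i) ⟶ D} (s : i ⟶ j) {u : x.idx ⟶ k} {v : j ⟶ k}
    (η : tr X u ≫ x.arr ⟶ tr X v ≫ tr X s ≫ r) (w : k ⟶ m) :
    Sq (𝟙 _) (α_ s v w).hom (shift (dn s η) w) (dn s (shift η w)) := by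
  simp [Sq, shift, dn, tr₂_id, tr₂_associator]

/-- `dn s` is composition with an invertible coherence 2-cell, so nothing is lost. The direction
that strips `dn s` serves the injectivity of `down`, the other one its well-definedness. -/
lemma sq_dn_iff {i j k : I} {r : X.obj (op i) ⟶ D} (s : i ⟶ j) {u u' : x.idx ⟶ k} {v v' : j ⟶ k}
    {α : u ⟶ u'} {β : v ⟶ v'} {η : tr X u ≫ x.arr ⟶ tr X v ≫ tr X s ≫ r}
    {η' : tr X u' ≫ x.arr ⟶ tr X v' ≫ tr X s ≫ r} :
    Sq α (s ◁ β) (dn s η) (dn s η') ↔ Sq α β η η' := by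
  have e : dn s η ≫ tr₂ X (s ◁ β) ▷ r = dn s (η ≫ tr₂ X β ▷ (tr X s ≫ r)) := by
    simp [dn, tr₂_whiskerLeft]
  unfold Sq
  rw [e]
  simp only [dn, ← Category.assoc]
  rw [cancel_mono, cancel_mono]

lemma sq_shift_dn {i j k m : I} {r : X.obj (op i) ⟶ D} (s : i ⟶ j) {u u' : x.idx ⟶ k}
    {v v' : j ⟶ k} {α : u ⟶ u'} {β : s ≫ v ⟶ s ≫ v'} {η : tr X u ≫ x.arr ⟶ tr X v ≫ tr X s ≫ r}
    {η' : tr X u' ≫ x.arr ⟶ tr X v' ≫ tr X s ≫ r} (h : Sq α β (dn s η) (dn s η')) (w : k ⟶ m) :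
    Sq (α ▷ w) ((α_ s v w).inv ≫ β ▷ w ≫ (α_ s v' w).hom) (dn s (shift η w))
      (dn s (shift η' w)) := by
  have := (Sq.symm (α := Iso.refl _) (β := α_ _ _ _) (shift_dn s η w)).trans
    ((h.whiskerRight w).trans (shift_dn s η' w))
  simpa only [Iso.refl_inv, Category.id_comp, Category.comp_id] using this

lemma Rel.mapDown {i j : I} {r : X.obj (op i) ⟶ D} (s : i ⟶ j) {p q : Frac x ⟨j, tr X s ≫ r⟩} :
    Rel p q → Rel (p.mapDown s) (q.mapDown s) := fun ⟨m, w, w', α, β, h⟩ =>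
  ⟨m, w, w', Iso.refl _ ≪≫ α ≪≫ (Iso.refl _).symm,
    α_ _ _ _ ≪≫ whiskerLeftIso s β ≪≫ (α_ _ _ _).symm,
    (shift_dn s p.θ w).trans (((sq_dn_iff s).2 h).trans
      (Sq.symm (α := Iso.refl _) (β := α_ _ _ _) (shift_dn s q.θ w')))⟩

/-- The shifted fraction is shifted once more along `𝟙 m`, which changes nothing up to the right
unitors of the legs. -/
lemma Rel.shift (p : Frac x y) {m : I} (w : p.k ⟶ m) :
    Rel p ⟨m, p.u ≫ w, p.v ≫ w, TwoPro.shift p.θ w⟩ :=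
  ⟨m, w, 𝟙 m, (ρ_ _).symm, (ρ_ _).symm, by
    refine Sq.symm (α := ρ_ _) (β := ρ_ _) ?_
    generalize TwoPro.shift p.θ w = θ
    have e := whisker_exchange_assoc (trId X m).hom θ (λ_ _).hom
    simp only [whiskerRight_comp, id_whiskerLeft, Category.assoc, Iso.inv_hom_id,
      Category.comp_id] at e
    simp [Sq, TwoPro.shift, tr₂_rightUnitor, e]⟩

/-- Surjectivity of `down`: completing the leg `p.v` and `s` to a square makes the shifted leg
factor through `s` up to isomorphism. -/
lemma Rel.exists_mapDown (hI : IsTwoFiltered I) {i j : I} {r : X.obj (op i) ⟶ D} (s : i ⟶ j)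
    (p : Frac x ⟨i, r⟩) : ∃ q : Frac x ⟨j, tr X s ≫ r⟩, Rel (q.mapDown s) p := by
  obtain ⟨m, w, t, ⟨e⟩⟩ := hI.exists_square p.v s
  let η := TwoPro.shift p.θ w ≫ tr₂ X e.hom ▷ r ≫ (trComp X s t).hom ▷ r ≫ (α_ _ _ _).hom
  refine ⟨⟨m, p.u ≫ w, t, η⟩, ((Rel.shift p w).trans hI (Rel.of_sq (Iso.refl _) e ?_)).symm⟩
  simp [Sq, η, dn, tr₂_id]

/-- Injectivity of `down`. The given isomorphism compares legs that start with `s`, and it must be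
replaced by one of the form `s ◁ γ`, from which `s` can be removed. -/
lemma Rel.of_mapDown (hI : IsTwoFiltered I) {i j : I} {r : X.obj (op i) ⟶ D} (s : i ⟶ j)
    {p q : Frac x ⟨j, tr X s ≫ r⟩} (h : Rel (p.mapDown s) (q.mapDown s)) : Rel p q := by
  obtain ⟨k, u, v, θ⟩ := p
  obtain ⟨k', u', v', θ'⟩ := q
  obtain ⟨m, w, w', α, β, h⟩ : ∃ (m : I) (w : k ⟶ m) (w' : k' ⟶ m) (α : u ≫ w ≅ u' ≫ w')
    (β : (s ≫ v) ≫ w ≅ (s ≫ v') ≫ w'), Sq α.hom β.hom (TwoPro.shift (dn s θ) w)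
      (TwoPro.shift (dn s θ') w') := h
  obtain ⟨n, y, ⟨γ⟩⟩ := hI.f1 (v ≫ w) (v' ≫ w')
  let β' := (α_ s v w).inv ≫ β.hom ≫ (α_ s v' w').hom
  -- F1 produced `γ` without any relation to `β`. F2 forces `s ◁ γ` and `β` to agree after `z`.
  obtain ⟨l, z, hz⟩ := hI.f2 (s ◁ γ.hom) ((α_ s _ y).inv ≫ β' ▷ y ≫ (α_ s _ y).hom)
  have h₁ : Sq α.hom β' (dn s (TwoPro.shift θ w)) (dn s (TwoPro.shift θ' w')) := by
    have := (Sq.symm (α := Iso.refl _) (β := α_ _ _ _) (shift_dn s θ w)).trans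
      (h.trans (shift_dn s θ' w'))
    simpa only [Iso.refl_inv, Category.id_comp, Category.comp_id] using this
  have h₂ := sq_shift_dn s (sq_shift_dn s h₁ y) z
  rw [← hz, whisker_assoc, Category.assoc, Category.assoc, Iso.inv_hom_id, Iso.inv_hom_id_assoc,
    Category.comp_id, sq_dn_iff] at h₂
  have h₃ := Rel.of_sq (x := x) (y := ⟨j, tr X s ≫ r⟩) (whiskerRightIso (whiskerRightIso α y) z)
    (whiskerRightIso γ z) h₂
  have h₄ {k m n l : I} {u : x.idx ⟶ k} {v : j ⟶ k} (θ : tr X u ≫ x.arr ⟶ tr X v ≫ tr X s ≫ r)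
      (w : k ⟶ m) (y : m ⟶ n) (z : n ⟶ l) :
      Rel (x := x) (y := ⟨j, tr X s ≫ r⟩) ⟨k, u, v, θ⟩
        ⟨l, _, _, TwoPro.shift (TwoPro.shift (TwoPro.shift θ w) y) z⟩ :=
    (Rel.shift (y := ⟨j, tr X s ≫ r⟩) ⟨k, u, v, θ⟩ w).trans hI
      ((Rel.shift (y := ⟨j, tr X s ≫ r⟩) ⟨m, _, _, TwoPro.shift θ w⟩ y).trans hI
        (Rel.shift (y := ⟨j, tr X s ≫ r⟩) ⟨n, _, _, TwoPro.shift (TwoPro.shift θ w) y⟩ z))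
  exact (h₄ θ w y z).trans hI (h₃.trans hI (h₄ θ' w' y z).symm)

lemma Rel.eval_eq {p q : Frac x y} : Rel p q → p.eval = q.eval := fun ⟨_, w, w', _, _, h⟩ =>
  (eval_shift p w).symm.trans ((eval_congr h).trans (eval_shift q w'))

variable (x y) in
def setoid (hI : IsTwoFiltered I) : Setoid (Frac x y) where
  r := Rel
  iseqv := ⟨Rel.refl, Rel.symm, Rel.trans hI⟩

def down (hI : IsTwoFiltered I) {i j : I} (s : i ⟶ j) (r : X.obj (op i) ⟶ D) :
    Quotient (setoid x ⟨j, tr X s ≫ r⟩ hI) → Quotient (setoid x ⟨i, r⟩ hI) :=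
  Quotient.map (mapDown s) fun _ _ => Rel.mapDown s

/-- A pseudocone has invertible structure maps. Bijectivity lets `down` serve as their inverses in
the pseudocone `desc` of sets. -/
lemma down_bijective (hI : IsTwoFiltered I) {i j : I} (s : i ⟶ j) (r : X.obj (op i) ⟶ D) :
    Function.Bijective (down (x := x) hI s r) := by
  constructor
  · rintro ⟨p⟩ ⟨q⟩ h
    exact Quotient.sound (Rel.of_mapDown hI s (Quotient.exact h))
  · rintro ⟨p⟩
    obtain ⟨q, hq⟩ := Rel.exists_mapDown hI s p
    exact ⟨Quotient.mk _ q, Quotient.sound hq⟩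

def map (hI : IsTwoFiltered I) {i : I} {r s : X.obj (op i) ⟶ D} (θ : r ⟶ s) :
    Quotient (setoid x ⟨i, r⟩ hI) → Quotient (setoid x ⟨i, s⟩ hI) :=
  Quotient.map (fun p => p.mapCell θ) fun _ _ => Rel.mapCell θ

noncomputable def downIso (hI : IsTwoFiltered I) {i j : I} (s : i ⟶ j) (r : X.obj (op i) ⟶ D) :
    Quotient (setoid x ⟨j, tr X s ≫ r⟩ hI) ≅ Quotient (setoid x ⟨i, r⟩ hI) :=
  (Equiv.ofBijective _ (down_bijective hI s r)).toIso

/-- Fractions out of `x` up to equivalence, as a pseudocone in the category of sets. -/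
noncomputable def desc (hI : IsTwoFiltered I) (x : ColimObj X D) :
    ColimDesc X D (Type (max u₁ v₁ w₂)) where
  obj i r := Quotient (setoid x ⟨i, r⟩ hI)
  map i _ _ θ := ↾(map hI θ)
  iso s r := (downIso hI s r).symm
  map_id i r := by
    ext ⟨p⟩
    exact congrArg (Quotient.mk _) (by simp [mapCell])
  map_comp i r s t θ η := by
    ext ⟨p⟩
    have e : p.θ ≫ tr X p.v ◁ (θ ≫ η) = (p.θ ≫ tr X p.v ◁ θ) ≫ tr X p.v ◁ η := by simp
    exact congrArg (fun η => Quotient.mk _ (Frac.mk (x := x) (y := ⟨i, t⟩) p.k p.u p.v η)) e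
  naturality {i j} s r t θ := by
    rw [Iso.symm_hom, Iso.symm_hom, Iso.comp_inv_eq, Category.assoc, Iso.eq_inv_comp]
    ext ⟨p⟩
    have e {a : X.obj (op p.k) ⟶ D} (η : a ⟶ tr X p.v ≫ tr X s ≫ r) :
        dn s η ≫ tr X (s ≫ p.v) ◁ θ = dn s (η ≫ tr X p.v ◁ tr X s ◁ θ) := by
      simp only [dn, Category.assoc, ← whisker_exchange]
      simp
    exact congrArg (fun η => Quotient.mk _
      (Frac.mk (x := x) (y := ⟨i, t⟩) p.k p.u (s ≫ p.v) η)) (e p.θ)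
  iso_id i r := by
    rw [Iso.symm_hom, Iso.inv_comp_eq, Category.comp_id]
    ext ⟨p⟩
    refine Quotient.sound (Rel.of_sq (Iso.refl _) (λ_ _).symm (Sq.symm (α := Iso.refl _) ?_))
    simp [Sq, dn, tr₂_id, tr₂_leftUnitor]
  iso_comp {i j k} s t r := by
    simp only [Iso.symm_hom]
    rw [Iso.inv_comp_eq, ← Category.assoc, Iso.eq_comp_inv, Iso.eq_comp_inv]
    ext ⟨p⟩
    refine Quotient.sound (Rel.symm (Rel.of_sq (Iso.refl _) (α_ s t p.v) ?_))
    have e {a : X.obj (op p.k) ⟶ D} (η : a ⟶ tr X p.v ≫ tr X (s ≫ t) ≫ r) :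
        dn s (dn t (η ≫ tr X p.v ◁ ((trComp X s t).hom ▷ r ≫ (α_ _ _ _).hom))) =
          dn (s ≫ t) η ≫ tr₂ X (α_ s t p.v).hom ▷ r := by
      simp [dn, tr₂_associator]
    change dn (s ≫ t) p.θ ≫ tr₂ X (α_ s t p.v).hom ▷ r = tr₂ X (𝟙 p.u) ▷ x.arr ≫ dn s (dn t
      (p.θ ≫ tr X p.v ◁ ((trComp X s t).hom ▷ r ≫ (α_ (tr X t) (tr X s) r).hom)))
    rw [e, tr₂_id, id_whiskerRight, Category.id_comp]
  iso_cell {i j s t} α r := by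
    simp only [Iso.symm_hom]
    rw [Iso.inv_comp_eq, Iso.eq_comp_inv]
    ext ⟨p⟩
    -- `α` is an arbitrary 2-cell, while `Rel` asks for invertible comparisons of legs, so one first
    -- moves to an index where `α ▷ p.v` is invertible.
    obtain ⟨m, w, hw⟩ := hI.exists_isIso_whiskerRight (α ▷ p.v)
    refine Quotient.sound (Rel.symm ⟨m, w, w, Iso.refl _, @asIso _ _ _ _ _ hw, ?_⟩)
    have : Sq (𝟙 p.u) (α ▷ p.v) (dn s p.θ) (dn t (p.θ ≫ tr X p.v ◁ tr₂ X α ▷ r)) := by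
      simp [Sq, dn, tr₂_id, tr₂_whiskerRight]
    have := this.whiskerRight w
    rw [id_whiskerRight] at this
    exact this

/-- The identity fraction. -/
def id (x : ColimObj X D) : Frac x x := ⟨x.idx, 𝟙 _, 𝟙 _, 𝟙 _⟩

lemma eval_id (x : ColimObj X D) : (id x).eval = 𝟙 x := by
  simp [id, eval]

/-- Fractions absorb each generator. Cells and inverses of structure isomorphisms act directly on a
fraction; only `up s` uses filteredness, through a preimage under `mapDown s`. -/
lemma exists_eval_comp (hI : IsTwoFiltered I) {z : ColimObj X D} (f : y ⟶ z) :
    ∀ p : Frac x y, ∃ q : Frac x z, q.eval = p.eval ≫ f := by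
  induction f using hom_induction with
  | h_id x => exact fun p => ⟨p, (Category.comp_id _).symm⟩
  | h_comp f g hf hg =>
    intro p
    obtain ⟨q, hq⟩ := hf p
    obtain ⟨t, ht⟩ := hg q
    exact ⟨t, by rw [ht, hq, Category.assoc]⟩
  | h_cell i θ => exact fun p => ⟨p.mapCell θ, p.eval_mapCell θ⟩
  | h_up s r =>
    intro p
    obtain ⟨q, hq⟩ := Rel.exists_mapDown hI s p
    exact ⟨q, by rw [← hq.eval_eq, eval_mapDown]; simp⟩
  | h_down s r => exact fun p => ⟨p.mapDown s, p.eval_mapDown s⟩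

/-- Every morphism of the pseudocolimit is represented by a fraction. -/
lemma exists_eval_eq (hI : IsTwoFiltered I) (f : x ⟶ y) : ∃ p : Frac x y, p.eval = f := by
  obtain ⟨q, hq⟩ := exists_eval_comp hI f (id x)
  exact ⟨q, by rw [hq, eval_id, Category.id_comp]⟩

end Frac

lemma shift_whiskerLeft {i k m : I} {r s : X.obj (op i) ⟶ D} (θ : r ⟶ s) (u : i ⟶ k)
    (w : k ⟶ m) : shift (tr X u ◁ θ) w = tr X (u ≫ w) ◁ θ := by
  have e := whisker_exchange_assoc (trComp X u w).hom θ ((trComp X u w).inv ▷ s)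
  rw [hom_inv_whiskerRight, Category.comp_id, comp_whiskerLeft] at e
  rw [e]
  simp [shift]

/-- Two 2-cells that agree in the pseudocolimit agree at a later index. -/
lemma exists_whiskerLeft_eq_of_cell_eq (hI : IsTwoFiltered I) {i : I} {r s : X.obj (op i) ⟶ D}
    {θ η : r ⟶ s} (h : cell i θ = cell i η) : ∃ (j : I) (w : i ⟶ j), tr X w ◁ θ = tr X w ◁ η := by
  -- The set-valued functor of fractions is applied to both cells and evaluated at the class of the
  -- identity fraction, so that the hypothesis becomes an instance of `Frac.Rel`.
  have h' := congrArg (fun f => (Frac.desc hI ⟨i, r⟩).desc.map f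
    (Quotient.mk _ (Frac.id ⟨i, r⟩))) h
  obtain ⟨m, w, w', α, β, e⟩ : ∃ (m : I) (w w' : i ⟶ m) (α β : 𝟙 i ≫ w ≅ 𝟙 i ≫ w'),
    Sq α.hom β.hom (shift (𝟙 _ ≫ tr X (𝟙 i) ◁ θ) w) (shift (𝟙 _ ≫ tr X (𝟙 i) ◁ η) w') :=
      Quotient.exact h'
  -- The comparisons of the two legs are parallel, so F2 equates them. The square then has the same
  -- invertible 2-cell on both sides, and it cancels by interchange.
  obtain ⟨n, z, hz⟩ := hI.f2 α.hom β.hom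
  have e' := e.whiskerRight z
  rw [Category.id_comp, Category.id_comp, shift_whiskerLeft, shift_whiskerLeft, shift_whiskerLeft,
    shift_whiskerLeft, ← hz, Sq, whisker_exchange] at e'
  have h₂ : tr₂ X (α.inv ▷ z) ▷ r ≫ tr₂ X (α.hom ▷ z) ▷ r = 𝟙 _ := by
    rw [← comp_whiskerRight, ← tr₂_comp, inv_hom_whiskerRight, tr₂_id, id_whiskerRight]
  have h₃ := congrArg (fun t => tr₂ X (α.inv ▷ z) ▷ r ≫ t) e'
  rw [reassoc_of% h₂, reassoc_of% h₂] at h₃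
  exact ⟨n, _, h₃⟩

/-- Endpoints over the same index: fractions with equal legs suffice. -/
lemma exists_up_cell_down (hI : IsTwoFiltered I) {i : I} {r s : X.obj (op i) ⟶ D}
    (f : (⟨i, r⟩ : ColimObj X D) ⟶ ⟨i, s⟩) : ∃ (j : I) (w : i ⟶ j) (θ : tr X w ≫ r ⟶ tr X w ≫ s),
      f = (up w r).hom ≫ cell j θ ≫ (up w s).inv := by
  obtain ⟨⟨k, u, v, θ⟩, rfl⟩ := Frac.exists_eval_eq hI f
  -- F1 makes the legs isomorphic at `m`, and `e.inv` carries the second leg back to the first.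
  obtain ⟨m, w, ⟨e⟩⟩ := hI.f1 u v
  refine ⟨m, u ≫ w, shift θ w ≫ tr₂ X e.inv ▷ s, ?_⟩
  rw [← Frac.eval_shift _ w]
  exact Frac.eval_congr (x := ⟨i, r⟩) (y := ⟨i, s⟩) (α := 𝟙 _) (β := e.inv) (by simp [Sq, tr₂_id])

instance isIso_shift {i j k m : I} {r : X.obj (op i) ⟶ D} {s : X.obj (op j) ⟶ D} {u : i ⟶ k}
    {v : j ⟶ k} (θ : tr X u ≫ r ⟶ tr X v ≫ s) (w : k ⟶ m) [IsIso (tr X w ◁ θ)] :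
    IsIso (shift θ w) := by
  unfold shift
  infer_instance

/-- A 2-cell that becomes invertible in the pseudocolimit becomes invertible at a later index. -/
lemma exists_isIso_whiskerLeft (hI : IsTwoFiltered I) {i : I} {r s : X.obj (op i) ⟶ D} (θ : r ⟶ s)
    [IsIso (cell i θ)] : ∃ (j : I) (w : i ⟶ j), IsIso (tr X w ◁ θ) := by
  obtain ⟨l, t, η, h⟩ := exists_up_cell_down hI (inv (cell i θ))
  have h₁ : cell l (tr X t ◁ θ ≫ η) = cell l (𝟙 _) := by
    rw [← cell_comp, ← cancel_epi (up t r).hom, ← cell_up_assoc, ← cancel_mono (up t r).inv,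
      Category.assoc, Category.assoc, ← h]
    simp
  have h₂ : cell l (η ≫ tr X t ◁ θ) = cell l (𝟙 _) := by
    rw [← cell_comp, ← cancel_epi (up t s).hom, ← cancel_mono (up t s).inv]
    have : (up t s).hom ≫ cell l η = inv (cell i θ) ≫ (up t r).hom := by simp [h]
    rw [reassoc_of% this, ← cell_up]
    simp
  -- The two composites become identities at possibly different indices, so the second is first
  -- transported along `z` and then resolved at `z'`.
  obtain ⟨m, z, h₃⟩ := exists_whiskerLeft_eq_of_cell_eq hI h₁
  have h₄ : cell m (tr X z ◁ (η ≫ tr X t ◁ θ)) = cell m (𝟙 _) := by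
    rw [← cancel_epi (up z (tr X t ≫ s)).hom, ← cell_up, h₂]
    simp
  obtain ⟨n, z', h₅⟩ := exists_whiskerLeft_eq_of_cell_eq hI h₄
  have : IsIso (tr X z' ◁ tr X z ◁ tr X t ◁ θ) := by
    refine ⟨tr X z' ◁ tr X z ◁ η, ?_, ?_⟩
    · rw [← whiskerLeft_comp, ← whiskerLeft_comp, h₃]
      simp
    · rw [← whiskerLeft_comp, ← whiskerLeft_comp, h₅]
      simp
  refine ⟨n, t ≫ z ≫ z', ?_⟩
  -- Iterated whiskering is replaced by whiskering with one transition 1-cell. `shift` differs from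
  -- whiskering by invertible coherence cells only, so `isIso_shift` applies.
  have h₆ : IsIso (tr X (z ≫ z') ◁ tr X t ◁ θ) := by
    rw [← shift_whiskerLeft]
    infer_instance
  rw [← shift_whiskerLeft]
  infer_instance

/-- Isomorphisms are represented by invertible 2-cells. -/
lemma exists_up_cellIso_down (hI : IsTwoFiltered I) {i : I} {r s : X.obj (op i) ⟶ D}
    (f : (⟨i, r⟩ : ColimObj X D) ≅ ⟨i, s⟩) : ∃ (j : I) (w : i ⟶ j) (θ : tr X w ≫ r ≅ tr X w ≫ s),
      f.hom = (up w r).hom ≫ cell j θ.hom ≫ (up w s).inv := by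
  obtain ⟨j, w, θ, h⟩ := exists_up_cell_down hI f.hom
  have : cell j θ = (up w r).inv ≫ f.hom ≫ (up w s).hom := by simp [h]
  have : IsIso (cell j θ) := by
    rw [this]
    infer_instance
  obtain ⟨k, z, _⟩ := exists_isIso_whiskerLeft hI θ
  exact ⟨k, w ≫ z, asIso (shift θ z), h.trans (Frac.eval_shift (x := ⟨i, r⟩) (y := ⟨i, s⟩)
    ⟨j, w, w, θ⟩ z).symm⟩

/-- Words may form a type in a larger universe, but fractions form a small set and evaluate onto all
morphisms. -/
lemma small_hom {x y : ColimObj X D} [Small.{v} I] [∀ i j : I, Small.{v} (i ⟶ j)]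
    [∀ (A : C) (f g : A ⟶ D), Small.{v} (f ⟶ g)] (hI : IsTwoFiltered I) : Small.{v} (x ⟶ y) := by
  let F : (Σ (k : I) (u : x.idx ⟶ k) (v : y.idx ⟶ k), tr X u ≫ x.arr ⟶ tr X v ≫ y.arr) → (x ⟶ y) :=
    fun t => Frac.eval ⟨t.1, t.2.1, t.2.2.1, t.2.2.2⟩
  refine small_of_surjective (f := F) fun f => ?_
  obtain ⟨p, rfl⟩ := Frac.exists_eval_eq hI f
  exact ⟨⟨p.k, p.u, p.v, p.θ⟩, rfl⟩

end Fractions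
end TwoPro

namespace TwoPro

open CategoryTheory Bicategory Opposite

/-! ### Components of 1-cells and 2-cells of 2-pro-objects, and the Yoneda argument for 1-cells into
objects of `C`. -/

namespace Pro
open scoped Pseudofunctor.StrongTrans
variable {C : Type u} [Bicategory.{v, v} C] [Strict C] {X Y Z : Pro C}

/-- The functor `colim_j C(Y_j, D) ⥤ colim_i C(X_i, D)` underlying a 1-cell `X ⟶ Y`. -/
def ev (f : X ⟶ Y) (D : C) : PCat Y D ⥤ PCat X D := ((Hom.trans f).app D).toFunctor

/-- The components of a 2-cell. -/
def comp₂ {f g : X ⟶ Y} (η : f ⟶ g) {D : C} (x : PCat Y D) : (ev f D).obj x ⟶ (ev g D).obj x :=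
  ((Hom₂.mod η).as.app D).toNatTrans.app x

lemma comp₂_ext {f g : X ⟶ Y} {η θ : f ⟶ g} (h : ∀ (D : C) (x : PCat Y D), comp₂ η x = comp₂ θ x) :
    η = θ := hom₂_ext_app h

abbrev post (X : Pro C) {D D' : C} (t : D ⟶ D') : PCat X D ⥤ PCat X D' :=
  postMap X.diagram.toPseudofunctor t

/-- The naturality 2-cells of a 1-cell of 2-pro-objects. -/
def nt (f : X ⟶ Y) {D D' : C} (t : D ⟶ D') (x : PCat Y D) :
    (ev f D').obj ((Y.post t).obj x) ≅ (X.post t).obj ((ev f D).obj x) :=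
  (Cat.Hom.toNatIso ((Hom.trans f).naturality t)).app x

section

variable {f g h : X ⟶ Y} {D D' : C}

lemma comp₂_naturality (η : f ⟶ g) {x y : PCat Y D} (m : x ⟶ y) :
    (ev f D).map m ≫ comp₂ η y = comp₂ η x ≫ (ev g D).map m :=
  ((Hom₂.mod η).as.app D).toNatTrans.naturality m

@[simp] lemma comp₂_id (f : X ⟶ Y) (x : PCat Y D) : comp₂ (𝟙 f) x = 𝟙 _ := rfl

@[simp] lemma comp₂_comp (η : f ⟶ g) (θ : g ⟶ h) (x : PCat Y D) :
    comp₂ (η ≫ θ) x = comp₂ η x ≫ comp₂ θ x := rfl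

@[simps]
def comp₂Iso (η : f ≅ g) (x : PCat Y D) : (ev f D).obj x ≅ (ev g D).obj x where
  hom := comp₂ η.hom x
  inv := comp₂ η.inv x
  hom_inv_id := by rw [← comp₂_comp, η.hom_inv_id, comp₂_id]
  inv_hom_id := by rw [← comp₂_comp, η.inv_hom_id, comp₂_id]

lemma nt_naturality (f : X ⟶ Y) (t : D ⟶ D') {x y : PCat Y D} (m : x ⟶ y) :
    (ev f D').map ((Y.post t).map m) ≫ (nt f t y).hom = (nt f t x).hom ≫ (X.post t).map ((ev f D).map m) :=
  (Cat.Hom.toNatIso ((Hom.trans f).naturality t)).hom.naturality m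

lemma comp₂_nt (η : f ⟶ g) (t : D ⟶ D') (x : PCat Y D) :
    comp₂ η ((Y.post t).obj x) ≫ (nt g t x).hom = (nt f t x).hom ≫ (X.post t).map (comp₂ η x) :=
  congrArg (fun m => m.toNatTrans.app x) ((Hom₂.mod η).as.naturality t)

lemma nt_comp (f : X ⟶ Y) (g : Y ⟶ Z) (t : D ⟶ D') (x : PCat Z D) :
    (nt (f ≫ g) t x).hom = (ev f D').map ((nt g t x).hom) ≫ (nt f t ((ev g D).obj x)).hom := by
  -- The identities are the components of the associators of `Cat`, which enter the naturality cell
  -- of a composite.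
  change 𝟙 _ ≫ (ev f D').map ((nt g t x).hom) ≫ 𝟙 _ ≫ (nt f t ((ev g D).obj x)).hom ≫ 𝟙 _ = _
  simp

lemma nt_postMap₂ (f : X ⟶ Y) {s t : D ⟶ D'} (σ : s ⟶ t) (x : PCat Y D) :
    (ev f D').map ((postMap₂ Y.diagram.toPseudofunctor σ).app x) ≫ (nt f t x).hom =
      (nt f s x).hom ≫ (postMap₂ X.diagram.toPseudofunctor σ).app ((ev f D).obj x) :=
  congrArg (fun m => m.toNatTrans.app x) ((Hom.trans f).naturality_naturality σ)

lemma nt_id (f : X ⟶ Y) (x : PCat Y D) :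
    (nt f (𝟙 D) x).hom ≫ cell _ (ρ_ ((ev f D).obj x).arr).hom =
      (ev f D).map (cell _ (ρ_ x.arr).hom) := by
  have := congrArg (fun m => m.toNatTrans.app x) ((Hom.trans f).naturality_id D)
  refine this.trans ?_
  change (ev f D).map (cell _ (ρ_ x.arr).hom) ≫ 𝟙 _ ≫ 𝟙 _ = _
  simp

lemma nt_post_comp (f : X ⟶ Y) {D'' : C} (s : D ⟶ D') (t : D' ⟶ D'') (x : PCat Y D) :
    (nt f (s ≫ t) x).hom ≫ cell _ (α_ ((ev f D).obj x).arr s t).inv =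
      (ev f D'').map (cell _ (α_ x.arr s t).inv) ≫ (nt f t ((Y.post s).obj x)).hom ≫
        (X.post t).map (nt f s x).hom := by
  have := congrArg (fun m => m.toNatTrans.app x) ((Hom.trans f).naturality_comp s t)
  refine this.trans ?_
  change (ev f D'').map (cell _ (α_ x.arr s t).inv) ≫ 𝟙 _ ≫ (nt f t ((Y.post s).obj x)).hom ≫ 𝟙 _ ≫
        (X.post t).map (nt f s x).hom ≫ 𝟙 _ = _
  rw [Category.id_comp, Category.id_comp]
  exact congrArg (fun m => _ ≫ _ ≫ m) (Category.comp_id _)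

end

/-! Morphisms to an object of `C`. -/

section

variable {A D D' : C}

/-- The object `s : A ⟶ D` of the pseudocolimit for `A` regarded as a 2-pro-object. -/
def pt (s : A ⟶ D) : PCat (const A) D := CCat.mk s

def ptMap {s t : A ⟶ D} (θ : s ⟶ t) : pt s ⟶ pt t := ccell θ

@[simp] lemma ptMap_id (s : A ⟶ D) : ptMap (𝟙 s) = 𝟙 (pt s) := ccell_id s

lemma ptMap_comp {s t l : A ⟶ D} (θ : s ⟶ t) (η : t ⟶ l) :
    ptMap θ ≫ ptMap η = ptMap (θ ≫ η) := ccell_comp θ η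

@[simps]
def ptIso {s t : A ⟶ D} (θ : s ≅ t) : pt s ≅ pt t where
  hom := ptMap θ.hom
  inv := ptMap θ.inv
  hom_inv_id := by simp [ptMap_comp]
  inv_hom_id := by simp [ptMap_comp]

variable (f g : X ⟶ const A)

/-- The naturality 2-cells at the object `s`. -/
def ntPt (s : A ⟶ D) (t : D ⟶ D') :
    (ev f D').obj (pt (s ≫ t)) ≅ (X.post t).obj ((ev f D).obj (pt s)) := nt f t (pt s)

variable {f g} in
lemma comp₂_ntPt (η : f ⟶ g) (s : A ⟶ D) (t : D ⟶ D') :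
    comp₂ η (pt (s ≫ t)) ≫ (ntPt g s t).hom =
      (ntPt f s t).hom ≫ (X.post t).map (comp₂ η (pt s)) := comp₂_nt η t (pt s)

lemma ntPt_naturality {s s' : A ⟶ D} (θ : s ⟶ s') (t : D ⟶ D') :
    (ev f D').map (ptMap (θ ▷ t)) ≫ (ntPt f s' t).hom =
      (ntPt f s t).hom ≫ (X.post t).map ((ev f D).map (ptMap θ)) := nt_naturality f t (ptMap θ)

lemma ntPt_postMap₂ (s : A ⟶ D) {t t' : D ⟶ D'} (σ : t ⟶ t') :
    (ev f D').map (ptMap (s ◁ σ)) ≫ (ntPt f s t').hom =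
      (ntPt f s t).hom ≫ (postMap₂ X.diagram.toPseudofunctor σ).app ((ev f D).obj (pt s)) :=
  nt_postMap₂ f σ (pt s)

lemma ntPt_comp {D'' : C} (s : A ⟶ D) (t : D ⟶ D') (l : D' ⟶ D'') :
    (ntPt f s (t ≫ l)).hom ≫ (postMapComp X.diagram.toPseudofunctor t l).hom.app _ =
      (ev f D'').map (ptMap (α_ s t l).inv) ≫ (ntPt f (s ≫ t) l).hom ≫
        (X.post l).map (ntPt f s t).hom := nt_post_comp f t l (pt s)

/-- A 1-cell `f : X ⟶ A` is determined by its value at the identity of `A`. -/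
def evIso (s : A ⟶ D) : (ev f D).obj (pt s) ≅ (X.post s).obj ((ev f A).obj (pt (𝟙 A))) :=
  (ev f D).mapIso (ptIso (λ_ s).symm) ≪≫ ntPt f (𝟙 A) s

variable {f g} in
lemma comp₂_evIso (η : f ⟶ g) (s : A ⟶ D) :
    comp₂ η (pt s) ≫ (evIso g s).hom =
      (evIso f s).hom ≫ (X.post s).map (comp₂ η (pt (𝟙 A))) := by
  simp only [evIso, Iso.trans_hom, Functor.mapIso_hom, ptIso_hom, Category.assoc, ← comp₂_ntPt,
    reassoc_of% @comp₂_naturality]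

lemma map_ptMap_evIso {s t : A ⟶ D} (θ : s ⟶ t) :
    (ev f D).map (ptMap θ) ≫ (evIso f t).hom =
      (evIso f s).hom ≫ (postMap₂ X.diagram.toPseudofunctor θ).app _ := by
  simp only [evIso, Iso.trans_hom, Functor.mapIso_hom, ptIso_hom, Category.assoc, ← ntPt_postMap₂]
  simp only [← Functor.map_comp_assoc, ptMap_comp, Iso.symm_hom, leftUnitor_inv_naturality]

lemma ntPt_evIso (s : A ⟶ D) (t : D ⟶ D') :
    (ntPt f s t).hom ≫ (X.post t).map (evIso f s).hom =
      (evIso f (s ≫ t)).hom ≫ (postMapComp X.diagram.toPseudofunctor s t).hom.app _ := by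
  simp only [evIso, Iso.trans_hom, Functor.mapIso_hom, ptIso_hom, Category.assoc, ntPt_comp,
    Functor.map_comp]
  rw [← reassoc_of% ntPt_naturality]
  simp only [← Functor.map_comp_assoc, ptMap_comp, Iso.symm_hom]
  simp

variable {f g} in
-- Yoneda: conjugation by `evIso` turns the component at `s` into the image under postcomposition
-- with `s` of the component at `𝟙 A`.
lemma comp₂_ext_id {η θ : f ⟶ g} (h : comp₂ η (pt (𝟙 A)) = comp₂ θ (pt (𝟙 A))) :
    η = θ :=
  comp₂_ext fun D x => by
    change comp₂ η (pt (arr x)) = comp₂ θ (pt (arr x))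
    rw [← cancel_mono (evIso g (arr x)).hom, comp₂_evIso, comp₂_evIso, h]

variable {f g} in
/-- The components of the 2-cell with given component at the identity of `A`. -/
def isoAt (m : (ev f A).obj (pt (𝟙 A)) ≅ (ev g A).obj (pt (𝟙 A))) (s : A ⟶ D) :
    (ev f D).obj (pt s) ≅ (ev g D).obj (pt s) :=
  evIso f s ≪≫ (X.post s).mapIso m ≪≫ (evIso g s).symm

variable {f g} in
lemma isoAt_naturality (m : (ev f A).obj (pt (𝟙 A)) ≅ (ev g A).obj (pt (𝟙 A))) {s t : A ⟶ D}
    (θ : s ⟶ t) : (ev f D).map (ptMap θ) ≫ (isoAt m t).hom =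
      (isoAt m s).hom ≫ (ev g D).map (ptMap θ) := by
  rw [← cancel_mono (evIso g t).hom, Category.assoc, Category.assoc, map_ptMap_evIso]
  simp only [isoAt, Iso.trans_hom, Category.assoc, Iso.symm_hom, Iso.inv_hom_id, Category.comp_id,
    Functor.mapIso_hom, reassoc_of% @map_ptMap_evIso, Iso.inv_hom_id_assoc]
  exact congrArg (fun m => (evIso f s).hom ≫ m)
    ((postMap₂ X.diagram.toPseudofunctor θ).naturality m.hom).symm

variable {f g} in
lemma isoAt_ntPt (m : (ev f A).obj (pt (𝟙 A)) ≅ (ev g A).obj (pt (𝟙 A))) (s : A ⟶ D)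
    (t : D ⟶ D') : (isoAt m (s ≫ t)).hom ≫ (ntPt g s t).hom =
      (ntPt f s t).hom ≫ (X.post t).map (isoAt m s).hom := by
  rw [← cancel_mono ((X.post t).map (evIso g s).hom), Category.assoc, Category.assoc, ntPt_evIso,
    ← Functor.map_comp]
  simp only [isoAt, Iso.trans_hom, Category.assoc, Iso.symm_hom, Iso.inv_hom_id,
    Iso.inv_hom_id_assoc, Category.comp_id, Functor.map_comp]
  rw [reassoc_of% ntPt_evIso]
  exact congrArg (fun m => (evIso f (s ≫ t)).hom ≫ m)
    ((postMapComp X.diagram.toPseudofunctor s t).hom.naturality m.hom)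

variable {f g} in
/-- Every isomorphism between the values at the identity of `A` is induced by a 2-cell. -/
def isoOfIso (m : (ev f A).obj (pt (𝟙 A)) ≅ (ev g A).obj (pt (𝟙 A))) : f ≅ g :=
  isoMk (Pseudofunctor.StrongTrans.isoMk (fun D => Cat.Hom.isoMk
      (NatIso.ofComponents (F := ev f D) (G := ev g D) (fun x => isoAt m (arr x))
        (cnat (G := ev f D) (H := ev g D) (fun s => (isoAt m s).hom)
          (fun θ => isoAt_naturality m θ))))
    (fun {D _} t => Cat.Hom₂.ext (NatTrans.ext (funext fun (x : CCat A D) =>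
      isoAt_ntPt m (arr x) t))))

/-- The left unitor in `evIso` and the right unitor from `nt_id` coincide on `𝟙 A`. Therefore the
2-cell built by `isoOfIso` has the prescribed component at `𝟙 A`. -/
lemma evIso_id : (evIso f (𝟙 A)).hom ≫ (postMapId X.diagram.toPseudofunctor A).hom.app _ = 𝟙 _ := by
  have e : (ntPt f (𝟙 A) (𝟙 A)).hom ≫ (postMapId X.diagram.toPseudofunctor A).hom.app _ =
    (ev f A).map (ptMap (ρ_ (𝟙 A)).hom) := nt_id f (pt (𝟙 A))
  rw [evIso, Iso.trans_hom, Category.assoc, e, Functor.mapIso_hom, ptIso_hom, ← Functor.map_comp,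
    ptMap_comp, Iso.symm_hom, ← unitors_equal, Iso.inv_hom_id, ptMap_id, CategoryTheory.Functor.map_id]

variable {f g} in
lemma comp₂_isoOfIso (m : (ev f A).obj (pt (𝟙 A)) ≅ (ev g A).obj (pt (𝟙 A))) :
    comp₂ (isoOfIso m).hom (pt (𝟙 A)) = m.hom := by
  change (isoAt m (𝟙 A)).hom = _
  have e : (X.post (𝟙 A)).map m.hom ≫ (postMapId X.diagram.toPseudofunctor A).hom.app _ = 
    (postMapId X.diagram.toPseudofunctor A).hom.app _ ≫ m.hom :=
      (postMapId X.diagram.toPseudofunctor A).hom.naturality m.hom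
  rw [isoAt, Iso.trans_hom, Iso.trans_hom, Iso.symm_hom, Functor.mapIso_hom, ← Category.assoc,
    Iso.comp_inv_eq, ← cancel_mono ((postMapId X.diagram.toPseudofunctor A).hom.app _),
    Category.assoc, Category.assoc, e, evIso_id, Category.comp_id, ← Category.assoc, evIso_id,
    Category.id_comp]

end

/-! ### Representing data as isomorphisms in pseudocolimits. -/

section

variable {D D' : C}

variable {i : X.idx} {k : Y.idx} {h h' : Y ⟶ X} {r r' : Y.at' k ⟶ X.at' i}

/-- The components of an invertible 2-cell to a composite. -/
def compIso {c : Z ⟶ X} {b : Z ⟶ Y} {a : Y ⟶ X} (K : c ≅ b ≫ a) (x : PCat X D) :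
    (ev c D).obj x ≅ (ev b D).obj ((ev a D).obj x) := comp₂Iso K x

lemma compIso_naturality {c : Z ⟶ X} {b : Z ⟶ Y} {a : Y ⟶ X} (K : c ≅ b ≫ a) {x y : PCat X D}
    (m : x ⟶ y) : (ev c D).map m ≫ (compIso K y).hom =
      (compIso K x).hom ≫ (ev b D).map ((ev a D).map m) := comp₂_naturality K.hom m

/-- The components of an invertible 2-cell to an identity. -/
def idIso {a : X ⟶ X} (K : a ≅ 𝟙 X) (x : PCat X D) : (ev a D).obj x ≅ x := comp₂Iso K x

lemma idIso_naturality {a : X ⟶ X} (K : a ≅ 𝟙 X) {x y : PCat X D} (m : x ⟶ y) :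
    (ev a D).map m ≫ (idIso K y).hom = (idIso K x).hom ≫ m := comp₂_naturality K.hom m

/-- The naturality 2-cells at an object `(i, s)`. -/
def ntMk (h : Y ⟶ X) (t : D ⟶ D') (i : X.idx) (s : X.at' i ⟶ D) :
    (ev h D').obj ⟨i, s ≫ t⟩ ≅ (Y.post t).obj ((ev h D).obj ⟨i, s⟩) := nt h t ⟨i, s⟩

lemma ntMk_naturality (h : Y ⟶ X) (t : D ⟶ D') (i : X.idx) {s s' : X.at' i ⟶ D} (θ : s ⟶ s') :
    (ev h D').map (cell i (θ ▷ t)) ≫ (ntMk h t i s').hom =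
      (ntMk h t i s).hom ≫ (Y.post t).map ((ev h D).map (cell i θ)) :=
  nt_naturality h t (cell i θ)

/-- The effect of postcomposition on a morphism to `(k, q)`. -/
def postTo {y : PCat Y D} {k : Y.idx} {q : Y.at' k ⟶ D} (m : y ⟶ ⟨k, q⟩) (t : D ⟶ D') :
    (Y.post t).obj y ⟶ ⟨k, q ≫ t⟩ := (Y.post t).map m

lemma map_postTo {x y : PCat Y D} {k : Y.idx} {q : Y.at' k ⟶ D} (m' : x ⟶ y) (m : y ⟶ ⟨k, q⟩)
    (t : D ⟶ D') : (Y.post t).map m' ≫ postTo m t = postTo (m' ≫ m) t :=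
  ((Y.post t).map_comp m' m).symm

lemma postTo_cell {y : PCat Y D} {k : Y.idx} {q q' : Y.at' k ⟶ D} (m : y ⟶ ⟨k, q⟩) (θ : q ⟶ q')
    (t : D ⟶ D') : postTo (m ≫ cell k θ) t = postTo m t ≫ cell k (θ ▷ t) :=
  (Y.post t).map_comp m (cell k θ)

/-- The components of a 2-cell `φ` such that `(r, φ)` represents `h`. -/
def repPt (φ : h ≫ X.π i ≅ Y.π k ≫ emb.map r) (s : X.at' i ⟶ D) :
    (ev h D).obj ⟨i, 𝟙 _ ≫ s⟩ ≅ ⟨k, 𝟙 _ ≫ r ≫ s⟩ :=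
  comp₂Iso φ (pt s)

lemma repPt_naturality (φ : h ≫ X.π i ≅ Y.π k ≫ emb.map r) {s t : X.at' i ⟶ D} (θ : s ⟶ t) :
    (ev h D).map (cell i (𝟙 _ ◁ θ)) ≫ (repPt φ t).hom =
      (repPt φ s).hom ≫ cell k (𝟙 _ ◁ r ◁ θ) := comp₂_naturality φ.hom (ptMap θ)

lemma ntMk_repPt (φ : h ≫ X.π i ≅ Y.π k ≫ emb.map r) (s : X.at' i ⟶ D) (t : D ⟶ D') :
    (repPt φ (s ≫ t)).hom ≫ cell k (𝟙 _ ◁ (α_ r s t).inv) ≫ cell k (α_ (𝟙 _) (r ≫ s) t).inv =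
      (ev h D').map (cell i (α_ (𝟙 _) s t).inv) ≫ (ntMk h t i (𝟙 _ ≫ s)).hom ≫
        postTo (repPt φ s).hom t := by
  have e := comp₂_nt φ.hom t (pt s)
  have e₁ := nt_comp h (X.π i) t (pt s)
  have e₂ := nt_comp (Y.π k) (emb.map r) t (pt s)
  exact (congrArg (fun m => (repPt φ (s ≫ t)).hom ≫ m) e₂.symm).trans (e.trans
    ((congrArg (fun m => m ≫ postTo (repPt φ s).hom t) e₁).trans (Category.assoc _ _ _)))

lemma comp₂_repPt (φ : h ≫ X.π i ≅ Y.π k ≫ emb.map r) (φ' : h' ≫ X.π i ≅ Y.π k ≫ emb.map r')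
    {η : h ⟶ h'} {θ : r ⟶ r'} (w : η ▷ X.π i ≫ φ'.hom = φ.hom ≫ Y.π k ◁ emb.map₂ θ)
    (s : X.at' i ⟶ D) :
    comp₂ η ⟨i, 𝟙 _ ≫ s⟩ ≫ (repPt φ' s).hom = (repPt φ s).hom ≫ cell k (𝟙 _ ◁ (θ ▷ s)) :=
  congrArg (fun m => comp₂ m (pt s)) w

lemma eq_of_comp₂_repPt (φ : h ≫ X.π i ≅ Y.π k ≫ emb.map r)
    (φ' : h' ≫ X.π i ≅ Y.π k ≫ emb.map r') {η : h ⟶ h'} {θ : r ⟶ r'}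
    (w : comp₂ η ⟨i, 𝟙 _ ≫ 𝟙 _⟩ ≫ (repPt φ' (𝟙 _)).hom =
      (repPt φ (𝟙 _)).hom ≫ cell k (𝟙 _ ◁ (θ ▷ 𝟙 _))) :
    η ▷ X.π i ≫ φ'.hom = φ.hom ≫ Y.π k ◁ emb.map₂ θ :=
  comp₂_ext_id w

/-- The components of a 2-cell `φ` such that `(r, φ)` represents `h`, with unitors removed. -/
def rep (φ : h ≫ X.π i ≅ Y.π k ≫ emb.map r) (s : X.at' i ⟶ D) :
    (ev h D).obj ⟨i, s⟩ ≅ ⟨k, r ≫ s⟩ :=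
  (ev h D).mapIso (cellIso i (λ_ s).symm) ≪≫ repPt φ s ≪≫ cellIso k (λ_ (r ≫ s))

lemma rep_hom (φ : h ≫ X.π i ≅ Y.π k ≫ emb.map r) (s : X.at' i ⟶ D) :
    (rep φ s).hom =
      (ev h D).map (cell i (λ_ s).inv) ≫ (repPt φ s).hom ≫ cell k (λ_ (r ≫ s)).hom := rfl

lemma repPt_hom (φ : h ≫ X.π i ≅ Y.π k ≫ emb.map r) (s : X.at' i ⟶ D) :
    (repPt φ s).hom =
      (ev h D).map (cell i (λ_ s).hom) ≫ (rep φ s).hom ≫ cell k (λ_ (r ≫ s)).inv := by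
  simp only [rep_hom, Category.assoc, cell_comp]
  rw [← Functor.map_comp_assoc, cell_comp]
  simp

lemma rep_naturality (φ : h ≫ X.π i ≅ Y.π k ≫ emb.map r) {s t : X.at' i ⟶ D} (θ : s ⟶ t) :
    (ev h D).map (cell i θ) ≫ (rep φ t).hom = (rep φ s).hom ≫ cell k (r ◁ θ) := by
  have e := repPt_naturality φ θ
  simp only [rep_hom, Category.assoc, cell_comp]
  rw [← Functor.map_comp_assoc, cell_comp, leftUnitor_inv_naturality, ← cell_comp,
    Functor.map_comp_assoc, reassoc_of% e, cell_comp, leftUnitor_naturality]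

/-- This is the modification axiom of `φ` with the unitors removed. It says how the component at `s
≫ t` comes from the one at `s`. -/
lemma ntMk_rep (φ : h ≫ X.π i ≅ Y.π k ≫ emb.map r) (s : X.at' i ⟶ D) (t : D ⟶ D') :
    (ntMk h t i s).hom ≫ postTo (rep φ s).hom t =
      (rep φ (s ≫ t)).hom ≫ cell k (α_ r s t).inv := by
  have e := ntMk_repPt φ s t
  have e' := ntMk_naturality h t i (λ_ s).inv
  have e'' : cell i ((λ_ s).inv ▷ t) = cell i (λ_ (s ≫ t)).inv ≫
    cell (X := X.diagram.toPseudofunctor) i (α_ (𝟙 _) s t).inv := by simp [cell_comp]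
  rw [rep_hom, ← map_postTo, postTo_cell, rep_hom]
  simp only [Category.assoc]
  rw [← reassoc_of% e', e'', Functor.map_comp_assoc, ← reassoc_of% e]
  simp only [cell_comp]
  simp

lemma comp₂_rep (φ : h ≫ X.π i ≅ Y.π k ≫ emb.map r) (φ' : h' ≫ X.π i ≅ Y.π k ≫ emb.map r')
    {η : h ⟶ h'} {θ : r ⟶ r'} (w : η ▷ X.π i ≫ φ'.hom = φ.hom ≫ Y.π k ◁ emb.map₂ θ)
    (s : X.at' i ⟶ D) : comp₂ η ⟨i, s⟩ ≫ (rep φ' s).hom = (rep φ s).hom ≫ cell k (θ ▷ s) := by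
  simp only [rep_hom, Category.assoc]
  rw [← reassoc_of% @comp₂_naturality, reassoc_of% (comp₂_repPt φ φ' w s)]
  simp [cell_comp]

/-- By Yoneda the representing condition has to be tested only at the identity of `X_i`, so it is
one equation in a pseudocolimit, to which fractions apply. -/
lemma eq_of_comp₂_rep (φ : h ≫ X.π i ≅ Y.π k ≫ emb.map r) (φ' : h' ≫ X.π i ≅ Y.π k ≫ emb.map r')
    {η : h ⟶ h'} {θ : r ⟶ r'} (w : comp₂ η ⟨i, 𝟙 _⟩ ≫ (rep φ' (𝟙 _)).hom =
      (rep φ (𝟙 _)).hom ≫ cell k (θ ▷ 𝟙 _)) :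
    η ▷ X.π i ≫ φ'.hom = φ.hom ≫ Y.π k ◁ emb.map₂ θ := by
  apply eq_of_comp₂_repPt
  simp only [repPt_hom, Category.assoc]
  rw [← reassoc_of% @comp₂_naturality, reassoc_of% w]
  simp only [cell_comp, leftUnitor_inv_naturality]

/-- `isoOfIso` applied to `m` conjugated by left unitors. Those unitors appear because `π` is the
element `(i, 𝟙)`, so that its composites insert an identity. -/
lemma exists_rep_eq (m : (ev h _).obj ⟨i, 𝟙 _⟩ ≅ ⟨k, r ≫ 𝟙 _⟩) :
    ∃ φ : h ≫ X.π i ≅ Y.π k ≫ emb.map r, (rep φ (𝟙 _)).hom = m.hom := by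
  let m' : (ev h _).obj ⟨i, 𝟙 _ ≫ 𝟙 _⟩ ≅ (⟨k, 𝟙 _ ≫ r ≫ 𝟙 _⟩ : PCat Y _) :=
    (ev h _).mapIso (cellIso i (λ_ (𝟙 _))) ≪≫ m ≪≫ cellIso k (λ_ (r ≫ 𝟙 _)).symm
  let φ : h ≫ X.π i ≅ Y.π k ≫ emb.map r :=
    isoOfIso (f := h ≫ X.π i) (g := Y.π k ≫ emb.map r) m'
  have e : (repPt φ (𝟙 _)).hom = m'.hom :=
    comp₂_isoOfIso (f := h ≫ X.π i) (g := Y.π k ≫ emb.map r) m'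
  refine ⟨φ, ?_⟩
  rw [rep_hom, e]
  simp only [m', Iso.trans_hom, Functor.mapIso_hom, Category.assoc, cellIso_hom, Iso.symm_hom,
    cell_comp, Iso.inv_hom_id, cell_id, Category.comp_id]
  rw [← Functor.map_comp_assoc, cell_comp]
  simp

lemma exists_rep (m : (ev h _).obj ⟨i, 𝟙 _⟩ ≅ ⟨k, r⟩) :
    Nonempty (h ≫ X.π i ≅ Y.π k ≫ emb.map r) :=
  let ⟨φ, _⟩ := exists_rep_eq (m ≪≫ cellIso k (ρ_ r).symm)
  ⟨φ⟩

lemma ntMk_idIso {a : X ⟶ X} (K : a ≅ 𝟙 X) (i : X.idx) (s : X.at' i ⟶ D) (t : D ⟶ D') :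
    (ntMk a t i s).hom ≫ postTo (idIso K ⟨i, s⟩).hom t = (idIso K ⟨i, s ≫ t⟩).hom := by
  refine (comp₂_nt K.hom t ⟨i, s⟩).symm.trans ?_
  change (idIso K ⟨i, s ≫ t⟩).hom ≫ 𝟙 _ ≫ 𝟙 _ = _
  simp only [Category.comp_id]

/-- The transition 1-cells represent the identity. -/
lemma exists_rep_eq_up {a : X ⟶ X} (K : a ≅ 𝟙 X) {i k : X.idx} (u : i ⟶ k) :
    ∃ φ : a ≫ X.π i ≅ X.π k ≫ emb.map (tr X.diagram.toPseudofunctor u),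
      ∀ {D : C} (s : X.at' i ⟶ D), (rep φ s).hom = (idIso K ⟨i, s⟩).hom ≫ (up u s).hom := by
  obtain ⟨φ, hφ⟩ := exists_rep_eq (idIso K ⟨i, 𝟙 _⟩ ≪≫ up u (𝟙 (X.at' i)))
  refine ⟨φ, fun {D} s => ?_⟩
  -- The formula is known at `𝟙`. It passes to `𝟙 ≫ s` by postcomposition (`e₂`) and to `s` by
  -- naturality along the unitor (`e₁`).
  have e₁ := rep_naturality φ (λ_ s).inv
  have e₂ := ntMk_rep φ (𝟙 _) s
  have e₃ : postTo ((idIso K ⟨i, 𝟙 _⟩).hom ≫ (up u (𝟙 (X.at' i))).hom) s =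
      postTo (idIso K ⟨i, 𝟙 _⟩).hom s ≫ (up u (𝟙 (X.at' i) ≫ s)).hom ≫ cell k (α_ _ _ _).inv :=
    (X.post s).map_comp _ _
  rw [hφ, Iso.trans_hom, e₃, reassoc_of% ntMk_idIso, ← Category.assoc, ← cellIso_inv,
    cancel_mono] at e₂
  rw [← e₂, reassoc_of% @idIso_naturality, cell_up] at e₁
  have : IsIso (cell k (tr X.diagram.toPseudofunctor u ◁ (λ_ s).inv)) :=
    (cellIso k (whiskerLeftIso (tr X.diagram.toPseudofunctor u) (λ_ s).symm)).isIso_hom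
  exact ((cancel_mono _).1 ((Category.assoc _ _ _).trans e₁)).symm

lemma rep_paste {j : Z.idx} {a : Y ⟶ X} {b : Z ⟶ Y} {c : Z ⟶ X} (K : c ≅ b ≫ a)
    {q : Z.at' j ⟶ Y.at' k} (φ : a ≫ X.π i ≅ Y.π k ≫ emb.map r)
    (ψ : b ≫ Y.π k ≅ Z.π j ≫ emb.map q) (s : X.at' i ⟶ D) :
    (rep (r := q ≫ r) (paste K φ ψ (emb.mapComp q r)) s).hom =
      (compIso K ⟨i, s⟩).hom ≫ (ev b D).map (rep φ s).hom ≫ (rep ψ (r ≫ s)).hom ≫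
        cell j (α_ q r s).inv := by
  have e : (repPt (r := q ≫ r) (paste K φ ψ (emb.mapComp q r)) s).hom =
      (compIso K ⟨i, 𝟙 _ ≫ s⟩).hom ≫ (ev b D).map (repPt φ s).hom ≫ (repPt ψ (r ≫ s)).hom ≫
      cell j (𝟙 _ ◁ (α_ q r s).inv) := by
    change comp₂ K.hom ⟨i, 𝟙 _ ≫ s⟩ ≫ 𝟙 _ ≫ (ev b D).map (repPt φ s).hom ≫ 𝟙 _ ≫
      (repPt ψ (r ≫ s)).hom ≫ 𝟙 _ ≫ cell j (𝟙 _ ◁ (α_ q r s).inv) = _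
    simp only [Category.id_comp]
    rfl
  have e' : cell k (λ_ (r ≫ s)).inv ≫ cell k (λ_ (r ≫ s)).hom =
    𝟙 (⟨k, r ≫ s⟩ : PCat Y D) := by simp [cell_comp]
  rw [rep_hom, e]
  simp only [repPt_hom, Category.assoc, Functor.map_comp, ← reassoc_of% @compIso_naturality]
  rw [← Functor.map_comp_assoc, cell_comp, ← Functor.map_comp_assoc (ev b D) (cell k _), e']
  simp [cell_comp]

lemma rep_pasteId {a : X ⟶ X} (K : a ≅ 𝟙 X) (s : X.at' i ⟶ D) :
    (rep (r := 𝟙 _) (pasteId K (X.π i) (emb.mapId _)) s).hom =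
      (idIso K ⟨i, s⟩).hom ≫ cell i (λ_ s).inv := by
  have e : (repPt (r := 𝟙 _) (pasteId K (X.π i) (emb.mapId _)) s).hom =
      (idIso K ⟨i, 𝟙 _ ≫ s⟩).hom ≫ cell i (𝟙 _ ◁ (λ_ s).inv) := by
    change (idIso K ⟨i, 𝟙 _ ≫ s⟩).hom ≫ 𝟙 _ ≫ 𝟙 _ ≫ cell i (𝟙 _ ◁ (λ_ s).inv) = _
    simp only [Category.id_comp]
  rw [rep_hom, e, Category.assoc, reassoc_of% @idIso_naturality]
  simp [cell_comp]

end

end Pro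
end TwoPro

namespace TwoPro

open CategoryTheory Bicategory Opposite

/-! ### Representing data for a diagram of 2-pro-objects, and the cells of `K_X`. -/

namespace Pro
open scoped Pseudofunctor.StrongTrans
variable {C : Type u} [Bicategory.{v, v} C] [Strict C] {J : Type v} [Bicategory.{v, v} J]
  (X : StrictPseudofunctor Jᵒᵖ (Pro C))

/-- The 2-pro-object `X^j`. -/
abbrev fib (j : J) : Pro C := X.toPseudofunctor.obj (op j)

/-- The transition 1-cell `X^a`. -/
abbrev ftr {j j' : J} (a : j ⟶ j') : fib X j' ⟶ fib X j := tr X.toPseudofunctor a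

variable {X}

def kobj (j : J) (i : (fib X j).idx) : K X := ⟨j, i⟩

section

variable {j j' j'' : J} {i : (fib X j).idx} {k : (fib X j').idx} {l : (fib X j'').idx}

/-- The 2-cells `φ` such that `(r, φ)` represents `X^a`. -/
abbrev Rep (X : StrictPseudofunctor Jᵒᵖ (Pro C)) {j j' : J} (a : j ⟶ j') (i : (fib X j).idx)
    (k : (fib X j').idx) (r : (fib X j').at' k ⟶ (fib X j).at' i) :=
  ftr X a ≫ (fib X j).π i ≅ (fib X j').π k ≫ emb.map r

/-- The composite of two representing 2-cells. -/
def Rep.comp {a : j ⟶ j'} {b : j' ⟶ j''} {r : (fib X j').at' k ⟶ (fib X j).at' i}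
    {q : (fib X j'').at' l ⟶ (fib X j').at' k} (φ : Rep X a i k r) (ψ : Rep X b k l q) :
    Rep X (a ≫ b) i l (q ≫ r) :=
  paste (trComp X.toPseudofunctor a b) φ ψ (emb.mapComp q r)

variable (i) in
/-- The representing 2-cell of the identity. -/
def Rep.id : Rep X (𝟙 j) i i (𝟙 _) := pasteId (trId X.toPseudofunctor j) _ (emb.mapId _)

lemma Rep.exists_up {i i' : (fib X j).idx} (u : i ⟶ i') :
    ∃ φ : Rep X (𝟙 j) i i' (tr _ u), ∀ {D : C} (s : (fib X j).at' i ⟶ D),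
        (rep φ s).hom = (idIso (trId X.toPseudofunctor j) ⟨i, s⟩).hom ≫ (up u s).hom :=
  exists_rep_eq_up _ u

/-- The representing 2-cell of a transition 1-cell. -/
noncomputable def Rep.up {i i' : (fib X j).idx} (u : i ⟶ i') : Rep X (𝟙 j) i i' (tr _ u) :=
  (Rep.exists_up u).choose

/-- The value of `X^a` at `(i, 𝟙)` is an object of the pseudocolimit, that is, an index `k` with a
1-cell `r`. The identity of that object is the required isomorphism. -/
lemma Rep.exists (a : j ⟶ j') (i : (fib X j).idx) :
    ∃ (k : (fib X j').idx) (r : (fib X j').at' k ⟶ (fib X j).at' i), Nonempty (Rep X a i k r) :=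
  ⟨_, _, exists_rep (h := ftr X a) (i := i) (k := ((ev (ftr X a) _).obj ⟨i, 𝟙 _⟩).idx)
    (r := ((ev (ftr X a) _).obj ⟨i, 𝟙 _⟩).arr) (Iso.refl _)⟩

section

variable {D : C}

lemma rep_comp {a : j ⟶ j'} {b : j' ⟶ j''} {r : (fib X j').at' k ⟶ (fib X j).at' i}
    {q : (fib X j'').at' l ⟶ (fib X j').at' k} (φ : Rep X a i k r) (ψ : Rep X b k l q)
    (s : (fib X j).at' i ⟶ D) : (rep (φ.comp ψ) s).hom =
      (compIso (trComp X.toPseudofunctor a b) ⟨i, s⟩).hom ≫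
        (ev (ftr X b) D).map (rep φ s).hom ≫ (rep ψ (r ≫ s)).hom ≫ cell l (α_ q r s).inv :=
  rep_paste _ φ ψ s

lemma rep_id (s : (fib X j).at' i ⟶ D) : (rep (Rep.id i) s).hom =
    (idIso (trId X.toPseudofunctor j) ⟨i, s⟩).hom ≫ cell i (λ_ s).inv :=
  rep_pasteId (trId X.toPseudofunctor j) s

lemma rep_up {i i' : (fib X j).idx} (u : i ⟶ i') (s : (fib X j).at' i ⟶ D) :
    (rep (Rep.up u) s).hom = (idIso (trId X.toPseudofunctor j) ⟨i, s⟩).hom ≫ (up u s).hom :=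
  (Rep.exists_up u).choose_spec s

lemma compIso_idIso (a : j ⟶ j') (x : PCat (fib X j) D) :
    (compIso (trComp X.toPseudofunctor a (𝟙 j')) x).hom ≫
      (idIso (trId X.toPseudofunctor j') ((ev (ftr X a) D).obj x)).hom =
      comp₂ (tr₂ X.toPseudofunctor (ρ_ a).hom) x := by
  rw [tr₂_rightUnitor]
  exact congrArg (fun m => _ ≫ m) (Category.comp_id _).symm

lemma idIso_compIso (a : j ⟶ j') (x : PCat (fib X j) D) :
    (compIso (trComp X.toPseudofunctor (𝟙 j) a) x).hom ≫
      (ev (ftr X a) D).map (idIso (trId X.toPseudofunctor j) x).hom =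
      comp₂ (tr₂ X.toPseudofunctor (λ_ a).hom) x := by
  rw [tr₂_leftUnitor]
  exact congrArg (fun m => _ ≫ m) (Category.comp_id _).symm

lemma rep_comp_up {a : j ⟶ j'} {r : (fib X j').at' k ⟶ (fib X j).at' i} (φ : Rep X a i k r)
    {k' : (fib X j').idx} (u : k ⟶ k') (s : (fib X j).at' i ⟶ D) :
    (rep (φ.comp (Rep.up u)) s).hom = comp₂ (tr₂ X.toPseudofunctor (ρ_ a).hom) ⟨i, s⟩ ≫
      (rep φ s).hom ≫ (up u (r ≫ s)).hom ≫ cell k' (α_ (tr _ u) r s).inv := by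
  rw [rep_comp, rep_up, ← compIso_idIso]
  simp only [Category.assoc, reassoc_of% @idIso_naturality]

end

section

variable {a b c : j ⟶ j'} {r q p : (fib X j').at' k ⟶ (fib X j).at' i}

/-- The 1-cell `(a, r, φ)` of `K_X`. -/
def kmk (φ : Rep X a i k r) : kobj (X := X) j i ⟶ kobj j' k := KData.Hom.mk a r φ

/-- The compatibility of `(α, θ)` with the representing 2-cells. -/
def IsCell (φ : Rep X a i k r) (ψ : Rep X b i k q) (α : a ⟶ b) (θ : r ⟶ q) : Prop :=
  tr₂ X.toPseudofunctor α ▷ (fib X j).π i ≫ ψ.hom = φ.hom ≫ (fib X j').π k ◁ emb.map₂ θ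

lemma IsCell.comp₂_rep {φ : Rep X a i k r} {ψ : Rep X b i k q} {α : a ⟶ b} {θ : r ⟶ q}
    (h : IsCell φ ψ α θ) {D : C} (s : (fib X j).at' i ⟶ D) :
    comp₂ (tr₂ X.toPseudofunctor α) ⟨i, s⟩ ≫ (rep ψ s).hom = (rep φ s).hom ≫ cell k (θ ▷ s) :=
  Pro.comp₂_rep φ ψ h s

lemma IsCell.mk {φ : Rep X a i k r} {ψ : Rep X b i k q} {α : a ⟶ b} {θ : r ⟶ q}
    (h : comp₂ (tr₂ X.toPseudofunctor α) ⟨i, 𝟙 _⟩ ≫ (rep ψ (𝟙 _)).hom =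
      (rep φ (𝟙 _)).hom ≫ cell k (θ ▷ 𝟙 _)) : IsCell φ ψ α θ :=
  eq_of_comp₂_rep φ ψ h

/-- The 2-cell `(α, θ)` of `K_X`. -/
def kmk₂ {φ : Rep X a i k r} {ψ : Rep X b i k q} (α : a ⟶ b) (θ : r ⟶ q) (h : IsCell φ ψ α θ) :
    kmk φ ⟶ kmk ψ := KData.Hom₂.mk α θ h

/-- An invertible 2-cell of `K_X` from its components. -/
def kisoMk {φ : Rep X a i k r} {ψ : Rep X b i k q} (α : a ≅ b) (θ : r ≅ q)
    (h : IsCell φ ψ α.hom θ.hom) : kmk φ ≅ kmk ψ := KData.isoMk α θ h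

lemma kmk₂_congr {φ : Rep X a i k r} {ψ : Rep X b i k q} {α α' : a ⟶ b} {θ θ' : r ⟶ q}
    (hα : α = α') (hθ : θ = θ') (h : IsCell φ ψ α θ) (h' : IsCell φ ψ α' θ') :
    kmk₂ α θ h = kmk₂ α' θ' h' := by
  subst hα hθ
  rfl

lemma kmk₂_whiskerRight {φ : Rep X a i k r} {ψ : Rep X b i k q} {α : a ⟶ b} {θ : r ⟶ q}
    (h : IsCell φ ψ α θ) {d : j' ⟶ j''} {t : (fib X j'').at' l ⟶ (fib X j').at' k}
    (χ : Rep X d k l t) : ∃ h' : IsCell (φ.comp χ) (ψ.comp χ) (α ▷ d) (t ◁ θ),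
      kmk₂ α θ h ▷ kmk χ = kmk₂ (α ▷ d) (t ◁ θ) h' :=
  ⟨(kmk₂ α θ h ▷ kmk χ).w, rfl⟩

/-- Fractions between representing data give 2-cells of `K_X`. -/
lemma isCell_comp_up {l n : (fib X j').idx} {q : (fib X j').at' l ⟶ (fib X j).at' i}
    (φ : Rep X a i k r) (ψ : Rep X b i l q) (α : a ⟶ b) (u : k ⟶ n) (v : l ⟶ n)
    (θ : tr _ u ≫ r ⟶ tr _ v ≫ q)
    (h : comp₂ (tr₂ X.toPseudofunctor α) ⟨i, 𝟙 _⟩ ≫ (rep ψ (𝟙 _)).hom ≫ (up v (q ≫ 𝟙 _)).hom ≫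
      cell n (α_ (tr _ v) q (𝟙 _)).inv = (rep φ (𝟙 _)).hom ≫ (up u (r ≫ 𝟙 _)).hom ≫
        cell n (α_ (tr _ u) r (𝟙 _)).inv ≫ cell n (θ ▷ 𝟙 _)) :
    IsCell (φ.comp (Rep.up u)) (ψ.comp (Rep.up v)) ((ρ_ a).hom ≫ α ≫ (ρ_ b).inv) θ := by
  refine IsCell.mk ?_
  simp only [rep_comp_up, tr₂_comp, comp₂_comp, Category.assoc]
  rw [← h, ← reassoc_of% (comp₂_comp (tr₂ X.toPseudofunctor (ρ_ b).inv)
    (tr₂ X.toPseudofunctor (ρ_ b).hom)), ← tr₂_comp, Iso.inv_hom_id,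
    tr₂_id, comp₂_id, Category.id_comp]

end

end

end Pro
end TwoPro

/-! ### `K_X` is 2-filtered and small. -/

namespace TwoPro

open CategoryTheory Bicategory Opposite

section

variable {I : Type u₁} [Bicategory.{w₁, v₁} I] {C : Type u₂} [Bicategory.{w₂, v₂} C]
  (X : Pseudofunctor Iᵒᵖ C)

/-- The transition of an invertible 2-cell. -/
@[simps]
def trIso {i j : I} {s t : i ⟶ j} (α : s ≅ t) : tr X s ≅ tr X t where
  hom := tr₂ X α.hom
  inv := tr₂ X α.inv
  hom_inv_id := by rw [← tr₂_comp, α.hom_inv_id, tr₂_id]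
  inv_hom_id := by rw [← tr₂_comp, α.inv_hom_id, tr₂_id]

variable {X} {D : C}

lemma up_inv_rightUnitor {i j : I} (v : i ⟶ j) (q : X.obj (op i) ⟶ D) :
    (up v q).inv ≫ cell i (ρ_ q).inv ≫ (up v (q ≫ 𝟙 D)).hom ≫ cell j (α_ (tr X v) q (𝟙 D)).inv =
      cell j (ρ_ (tr X v ≫ q)).inv := by
  rw [cell_up_assoc, Iso.inv_hom_id_assoc, cell_comp]
  simp

lemma up_id_cell (i : I) (r : X.obj (op i) ⟶ D) :
    (up (𝟙 i) r).hom ≫ cell i ((trId X i).hom ▷ r) = cell i (λ_ r).inv := by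
  have h := congrArg (fun m => m ≫ cell i (λ_ r).inv) (up_id i r)
  simpa [cell_comp] using h

lemma up_comp_cell {i j k : I} (s : i ⟶ j) (t : j ⟶ k) (r : X.obj (op i) ⟶ D) :
    (up (s ≫ t) r).hom ≫ cell k ((trComp X s t).hom ▷ r) =
      (up s r).hom ≫ (up t (tr X s ≫ r)).hom ≫ cell k (α_ (tr X t) (tr X s) r).inv := by
  have h := congrArg (fun m => m ≫ cell k (α_ (tr X t) (tr X s) r).inv) (up_comp s t r)
  simpa [cell_comp] using h

end

namespace Pro
open scoped Pseudofunctor.StrongTrans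
variable {C : Type u} [Bicategory.{v, v} C] [Strict C] {J : Type v} [Bicategory.{v, v} J]
  {X : StrictPseudofunctor Jᵒᵖ (Pro C)} {j j' j'' : J} {i : (fib X j).idx} {k l : (fib X j').idx}

/-- `φ` and `ψ` turn `X^α` at the identity into a morphism `(k, r) ⟶ (l, q)`. If a fraction
represents it, its 2-cell lies over `α` in `K_X` once the two 1-cells are followed by the
transitions along its legs. The unitors absorb the extra identity 1-cell of `J`. -/
lemma isCell_comp_up_of_eval {a b : j ⟶ j'} {r : (fib X j').at' k ⟶ (fib X j).at' i}
    {q : (fib X j').at' l ⟶ (fib X j).at' i}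
    (φ : Rep X a i k r) (ψ : Rep X b i l q) (α : a ⟶ b)
    (p : Frac (⟨k, r⟩ : PCat (fib X j') ((fib X j).at' i)) ⟨l, q⟩)
    (h : comp₂ (tr₂ X.toPseudofunctor α) ⟨i, 𝟙 _⟩ ≫ (rep ψ (𝟙 _)).hom =
      (rep φ (𝟙 _)).hom ≫ cell k (ρ_ r).hom ≫ p.eval ≫ cell l (ρ_ q).inv) :
    IsCell (φ.comp (Rep.up p.u)) (ψ.comp (Rep.up p.v)) ((ρ_ a).hom ≫ α ≫ (ρ_ b).inv) p.θ := by
  obtain ⟨n, u, v, θ⟩ := p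
  refine isCell_comp_up φ ψ α u v θ ?_
  rw [reassoc_of% h]
  refine congrArg (fun m => (rep φ (𝟙 _)).hom ≫ m) ?_
  simp only [Frac.eval, Category.assoc]
  rw [up_inv_rightUnitor, cell_up_assoc]
  simp [cell_comp]

/-- F1 for `K_X`: F1 in `J` yields `α`, and `X^α` gives an isomorphism in a pseudocolimit over the
indices of `X^c`. An invertible 2-cell at a later index represents it. -/
lemma exists_iso_comp (hJ : IsTwoFiltered J) {a b : j ⟶ j'}
    {r q : (fib X j').at' k ⟶ (fib X j).at' i} (φ : Rep X a i k r) (ψ : Rep X b i k q) :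
    ∃ (z : K X) (h : kobj j' k ⟶ z), Nonempty (kmk φ ≫ h ≅ kmk ψ ≫ h) := by
  obtain ⟨c, d, ⟨α⟩⟩ := hJ.f1 a b
  obtain ⟨l, t, ⟨χ⟩⟩ := Rep.exists d k
  let e : (⟨l, t ≫ r⟩ : PCat (fib X c) ((fib X j).at' i)) ≅ ⟨l, t ≫ q⟩ :=
    cellIso l (ρ_ _).symm ≪≫ (rep (φ.comp χ) (𝟙 _)).symm ≪≫
      comp₂Iso (trIso X.toPseudofunctor α) ⟨i, 𝟙 _⟩ ≪≫ rep (ψ.comp χ) (𝟙 _) ≪≫ cellIso l (ρ_ _)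
  obtain ⟨n, w, θ, h⟩ := exists_up_cellIso_down (fib X c).filtered e
  have hc := isCell_comp_up_of_eval (φ.comp χ) (ψ.comp χ) α.hom ⟨n, w, w, θ.hom⟩ (by
    refine Eq.trans ?_ (congrArg (fun m => (rep (φ.comp χ) (𝟙 _)).hom ≫ cell l (ρ_ _).hom ≫ m ≫
      cell l (ρ_ _).inv) h)
    have h' : cell l (ρ_ (t ≫ r)).hom ≫ cell l (ρ_ (t ≫ r)).inv =
      𝟙 (⟨l, (t ≫ r) ≫ 𝟙 _⟩ : PCat (fib X c) _) := by simp [cell_comp]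
    simp [e, cell_comp, reassoc_of% h'])
  have e' : (kmk φ ≫ kmk χ) ≫ kmk (Rep.up w) ≅ (kmk ψ ≫ kmk χ) ≫ kmk (Rep.up w) :=
    kisoMk (φ := (φ.comp χ).comp (Rep.up w)) (ψ := (ψ.comp χ).comp (Rep.up w))
      (ρ_ _ ≪≫ α ≪≫ (ρ_ _).symm) θ hc
  exact ⟨_, kmk χ ≫ kmk (Rep.up w), ⟨(α_ _ _ _).symm ≪≫ e' ≪≫ α_ _ _ _⟩⟩

/-- F2 for `K_X`: F2 in `J` equates the first components. This forces the second components to agree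
in the pseudocolimit, and hence at a later index of the fibre. -/
lemma exists_whiskerRight_eq (hJ : IsTwoFiltered J) {a b : j ⟶ j'}
    {r q : (fib X j').at' k ⟶ (fib X j).at' i} {φ : Rep X a i k r} {ψ : Rep X b i k q}
    {α α' : a ⟶ b} {θ θ' : r ⟶ q} (h : IsCell φ ψ α θ) (h' : IsCell φ ψ α' θ') :
    ∃ (z : K X) (f : kobj j' k ⟶ z), kmk₂ α θ h ▷ f = kmk₂ α' θ' h' ▷ f := by
  obtain ⟨c, d, hd⟩ := hJ.f2 α α'
  obtain ⟨l, t, ⟨χ⟩⟩ := Rep.exists d k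
  obtain ⟨h₁, e₁⟩ := kmk₂_whiskerRight h χ
  obtain ⟨h₂, e₂⟩ := kmk₂_whiskerRight h' χ
  -- Both cells are the same 2-cell of 2-pro-objects, read through the isomorphisms of the
  -- representing data.
  have e : cell (X := (fib X c).diagram.toPseudofunctor) l (t ◁ θ) = cell l (t ◁ θ') := by
    have := h₁.comp₂_rep (𝟙 _)
    rw [hd, h₂.comp₂_rep, cancel_epi] at this
    have := congrArg (fun m => cell l (ρ_ _).inv ≫ m ≫ cell l (ρ_ _).hom) this
    simpa [cell_comp] using this.symm
  obtain ⟨n, w, hw⟩ := exists_whiskerLeft_eq_of_cell_eq (fib X c).filtered e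
  obtain ⟨h₃, e₃⟩ := kmk₂_whiskerRight h₁ (Rep.up w)
  obtain ⟨h₄, e₄⟩ := kmk₂_whiskerRight h₂ (Rep.up w)
  refine ⟨_, kmk χ ≫ kmk (Rep.up w), ?_⟩
  rw [whiskerRight_comp, whiskerRight_comp, e₁, e₂]
  refine congrArg (fun m => (α_ _ _ _).inv ≫ m ≫ (α_ _ _ _).hom) ?_
  refine e₃.trans ((kmk₂_congr (by rw [hd]) hw _ _).trans e₄.symm)

lemma isTwoFiltered_K (hJ : IsTwoFiltered J) : IsTwoFiltered (K X) where
  f0 x y := by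
    obtain ⟨c, ⟨a⟩, ⟨b⟩⟩ := hJ.f0 x.j y.j
    obtain ⟨k, r, ⟨φ⟩⟩ := Rep.exists a x.i
    obtain ⟨l, q, ⟨ψ⟩⟩ := Rep.exists b y.i
    -- The representatives of `a` and `b` start at different indices over the same `c`; a common
    -- later index is found inside the fibre.
    obtain ⟨m, ⟨u⟩, ⟨v⟩⟩ := (fib X c).filtered.f0 k l
    exact ⟨kobj c m, ⟨kmk (φ.comp (Rep.up u))⟩, ⟨kmk (ψ.comp (Rep.up v))⟩⟩
  f1 {x y} f g := exists_iso_comp (i := x.i) (k := y.i) hJ f.φ g.φ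
  f2 {x y f g} η κ := exists_whiskerRight_eq (i := x.i) (k := y.i) hJ η.w κ.w

/-- `φ` is determined by its component at the identity, which is a morphism of a pseudocolimit with
small hom-sets. -/
lemma small_rep (a : j ⟶ j') (r : (fib X j').at' k ⟶ (fib X j).at' i) :
    Small.{v} (Rep X a i k r) := by
  have := (fib X j').small.small_hom
  have : Small.{v} ((ev (ftr X a) _).obj ⟨i, 𝟙 _⟩ ⟶ (⟨k, r ≫ 𝟙 _⟩ : PCat (fib X j') _)) :=
    small_hom (fib X j').filtered
  refine small_of_injective (f := fun φ : Rep X a i k r => (rep φ (𝟙 _)).hom) fun φ ψ h => ?_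
  ext1
  have : IsCell φ ψ (𝟙 a) (𝟙 r) := IsCell.mk (by simpa [tr₂_id] using h.symm)
  rw [IsCell, tr₂_id, id_whiskerRight, Category.id_comp, emb.map₂_id] at this
  exact (Category.comp_id _).symm.trans
    ((congrArg (fun m => φ.hom ≫ m) (whiskerLeft_id _ _)).symm.trans this.symm)

lemma isSmallTwoCategory_K : IsSmallTwoCategory (K X) where
  small_hom x y := by
    have := fun (a : x.j ⟶ y.j) r => small_rep (i := x.i) (k := y.i) a r
    refine small_of_injective (β := Σ (a : x.j ⟶ y.j) (r : (fib X y.j).at' y.i ⟶ (fib X x.j).at' x.i),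
      Rep X a x.i y.i r) (f := fun f => ⟨f.a, f.r, f.φ⟩) ?_
    rintro ⟨a, r, φ⟩ ⟨b, q, ψ⟩ h
    cases h
    rfl
  small_hom₂ f g :=
    small_of_injective (β := (f.a ⟶ g.a) × (f.r ⟶ g.r)) (f := fun η => ⟨η.α, η.θ⟩)
      fun η κ h => KData.Hom₂.ext (congrArg Prod.fst h) (congrArg Prod.snd h)

end Pro
end TwoPro

namespace TwoPro

open CategoryTheory Bicategory Opposite

/-! ### 1-cells, 2-cells and pseudocones of 2-pro-objects in terms of components. -/

namespace Pro
open scoped Pseudofunctor.StrongTrans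
variable {C : Type u} [Bicategory.{v, v} C] [Strict C]

section

variable {X Y : Pro C}

/-- A 1-cell from functors `colim_j C(Y_j, D) ⥤ colim_i C(X_i, D)` compatible with
postcomposition. -/
def homMk (F : ∀ D, PCat Y D ⥤ PCat X D)
    (N : ∀ {D D' : C} (t : D ⟶ D') (x : PCat Y D),
      (F D').obj ((Y.post t).obj x) ≅ (X.post t).obj ((F D).obj x))
    (nat : ∀ {D D' : C} (t : D ⟶ D') {x y : PCat Y D} (m : x ⟶ y),
      (F D').map ((Y.post t).map m) ≫ (N t y).hom = (N t x).hom ≫ (X.post t).map ((F D).map m))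
    (nat₂ : ∀ {D D' : C} {s t : D ⟶ D'} (σ : s ⟶ t) (x : PCat Y D),
      (F D').map ((postMap₂ Y.diagram.toPseudofunctor σ).app x) ≫ (N t x).hom =
        (N s x).hom ≫ (postMap₂ X.diagram.toPseudofunctor σ).app ((F D).obj x))
    (nat_id : ∀ {D : C} (x : PCat Y D), (N (𝟙 D) x).hom ≫ cell _ (ρ_ ((F D).obj x).arr).hom =
      (F D).map (cell _ (ρ_ x.arr).hom))
    (nat_comp : ∀ {D D' D'' : C} (s : D ⟶ D') (t : D' ⟶ D'') (x : PCat Y D),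
      (N (s ≫ t) x).hom ≫ cell _ (α_ ((F D).obj x).arr s t).inv =
        (F D'').map (cell _ (α_ x.arr s t).inv) ≫ (N t ((Y.post s).obj x)).hom ≫
          (X.post t).map (N s x).hom)
    (hN : ∀ {D D' : C} (t : D ⟶ D') (x : PCat Y D), ∃ h, (N t x).hom = eqToHom h) : X ⟶ Y where
  trans :=
    { app D := (F D).toCatHom
      naturality {D D'} t := Cat.Hom.isoMk
        (NatIso.ofComponents (F := Y.post t ⋙ F D') (G := F D ⋙ X.post t) (N t) (nat t))
      naturality_naturality σ := Cat.Hom₂.ext (NatTrans.ext (funext (nat₂ σ)))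
      naturality_id D := Cat.Hom₂.ext (NatTrans.ext (funext fun x => (nat_id x).trans (by
        change _ = (F D).map (cell _ (ρ_ x.arr).hom) ≫ 𝟙 _ ≫ 𝟙 _
        simp)))
      naturality_comp {D D' D''} s t := Cat.Hom₂.ext (NatTrans.ext (funext fun x =>
        (nat_comp s t x).trans (by
          change _ = (F D'').map (cell _ (α_ x.arr s t).inv) ≫ 𝟙 _ ≫ (N t ((Y.post s).obj x)).hom ≫
            𝟙 _ ≫ (X.post t).map (N s x).hom ≫ 𝟙 _
          rw [Category.id_comp, Category.id_comp]
          exact congrArg (fun m => _ ≫ _ ≫ m) (Category.comp_id _).symm))) }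
  isTwoNatural _ _ t := Cat.eq_eqToIso _ (fun x => (hN t x).1) (fun x => (hN t x).2)

/-- A 2-cell from its components. -/
def hom₂Mk {f g : X ⟶ Y} (app : ∀ (D : C) (x : PCat Y D), (ev f D).obj x ⟶ (ev g D).obj x)
    (nat : ∀ (D : C) {x y : PCat Y D} (m : x ⟶ y),
      (ev f D).map m ≫ app D y = app D x ≫ (ev g D).map m)
    (hnt : ∀ {D D' : C} (t : D ⟶ D') (x : PCat Y D),
      app D' ((Y.post t).obj x) ≫ (nt g t x).hom = (nt f t x).hom ≫ (X.post t).map (app D x)) :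
    f ⟶ g :=
  Hom₂.mk (Pseudofunctor.StrongTrans.Hom.of
   { app D := NatTrans.toCatHom₂ (F := ev f D) (G := ev g D)
      { app := app D, naturality := fun _ _ m => nat D m }
     naturality t := Cat.Hom₂.ext (NatTrans.ext (funext (hnt t))) })

/-- An invertible 2-cell from its components. -/
def hom₂MkIso {f g : X ⟶ Y} (app : ∀ (D : C) (x : PCat Y D), (ev f D).obj x ≅ (ev g D).obj x)
    (nat : ∀ (D : C) {x y : PCat Y D} (m : x ⟶ y),
      (ev f D).map m ≫ (app D y).hom = (app D x).hom ≫ (ev g D).map m)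
    (hnt : ∀ {D D' : C} (t : D ⟶ D') (x : PCat Y D),
      (app D' ((Y.post t).obj x)).hom ≫ (nt g t x).hom =
        (nt f t x).hom ≫ (X.post t).map (app D x).hom) : f ≅ g :=
  isoMk (Pseudofunctor.StrongTrans.isoMk (fun D => Cat.Hom.isoMk
    (NatIso.ofComponents (F := ev f D) (G := ev g D) (app D) (nat D)))
    (fun t => Cat.Hom₂.ext (NatTrans.ext (funext (hnt t)))))

end

section

variable {J : Type v} [Bicategory.{v, v} J] {X : StrictPseudofunctor Jᵒᵖ (Pro C)} {W : Pro C}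
  {j j' j'' : J} {D D' : C}

/-- The component at `j` of a pseudocone. -/
def leg (ρ : Pseudocone X.toPseudofunctor W) (j : J) : W ⟶ fib X j :=
  Pseudofunctor.StrongTrans.app ρ (op j)

/-- The components of the structure 2-cells of a pseudocone. -/
def pnat (ρ : Pseudocone X.toPseudofunctor W) (a : j ⟶ j') (x : PCat (fib X j) D) :
    (ev (leg ρ j) D).obj x ≅ (ev (leg ρ j') D).obj ((ev (ftr X a) D).obj x) :=
  comp₂Iso (Pseudofunctor.StrongTrans.naturality ρ a.op) x

section

variable (ρ : Pseudocone X.toPseudofunctor W)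

lemma pnat_naturality (a : j ⟶ j') {x y : PCat (fib X j) D} (m : x ⟶ y) :
    (ev (leg ρ j) D).map m ≫ (pnat ρ a y).hom =
      (pnat ρ a x).hom ≫ (ev (leg ρ j') D).map ((ev (ftr X a) D).map m) :=
  comp₂_naturality (Pseudofunctor.StrongTrans.naturality ρ a.op).hom m

lemma pnat_comp₂ {a b : j ⟶ j'} (α : a ⟶ b) (x : PCat (fib X j) D) :
    (pnat ρ a x).hom ≫ (ev (leg ρ j') D).map (comp₂ (tr₂ X.toPseudofunctor α) x) =
      (pnat ρ b x).hom := by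
  have e := congrArg (fun m => comp₂ m x)
    (Pseudofunctor.StrongTrans.naturality_naturality ρ (Bicategory.Opposite.op2 α))
  exact e.symm.trans (Category.id_comp _)

lemma pnat_id (x : PCat (fib X j) D) : (pnat ρ (𝟙 j) x).hom ≫
    (ev (leg ρ j) D).map (idIso (trId X.toPseudofunctor j) x).hom = 𝟙 _ := by
  have e := congrArg (fun m => comp₂ m x) (Pseudofunctor.StrongTrans.naturality_id ρ (op j))
  refine e.trans ?_
  exact (Category.id_comp _).trans (Category.id_comp _)

lemma pnat_comp (a : j ⟶ j') (b : j' ⟶ j'') (x : PCat (fib X j) D) :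
    (pnat ρ (a ≫ b) x).hom ≫
      (ev (leg ρ j'') D).map (compIso (trComp X.toPseudofunctor a b) x).hom =
      (pnat ρ a x).hom ≫ (pnat ρ b ((ev (ftr X a) D).obj x)).hom := by
  have e := congrArg (fun m => comp₂ m x)
    (Pseudofunctor.StrongTrans.naturality_comp ρ b.op a.op)
  refine e.trans ?_
  change 𝟙 _ ≫ 𝟙 _ ≫ (pnat ρ a x).hom ≫ 𝟙 _ ≫ (pnat ρ b ((ev (ftr X a) D).obj x)).hom ≫ 𝟙 _ = _
  simp only [Category.id_comp]
  exact congrArg (fun m => _ ≫ m) (Category.comp_id _)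

lemma pnat_nt (a : j ⟶ j') (t : D ⟶ D') (x : PCat (fib X j) D) :
    (pnat ρ a (((fib X j).post t).obj x)).hom ≫ (ev (leg ρ j') D').map (nt (ftr X a) t x).hom ≫
      (nt (leg ρ j') t ((ev (ftr X a) D).obj x)).hom =
      (nt (leg ρ j) t x).hom ≫ (W.post t).map (pnat ρ a x).hom := by
  have e := comp₂_nt (Pseudofunctor.StrongTrans.naturality ρ a.op).hom t x
  have e₁ := nt_comp (leg ρ j') (ftr X a) t x
  have e₂ : (nt (𝟙 W ≫ leg ρ j) t x).hom = (nt (leg ρ j) t x).hom := by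
    refine (nt_comp (𝟙 W) (leg ρ j) t x).trans ?_
    change (nt (leg ρ j) t x).hom ≫ 𝟙 _ ≫ 𝟙 _ = _
    simp only [Category.id_comp]
    exact Category.comp_id _
  exact ((congrArg (fun m => (pnat ρ a (((fib X j).post t).obj x)).hom ≫ m) e₁).symm.trans e).trans
    (congrArg (fun m => m ≫ (W.post t).map (pnat ρ a x).hom) e₂)

end

/-- A pseudocone from its components. -/
def coneMk (app : ∀ j, W ⟶ fib X j) (e : ∀ {j j' : J} (a : j ⟶ j'), app j ≅ app j' ≫ ftr X a)
    (he₂ : ∀ {j j' : J} {a b : j ⟶ j'} (α : a ⟶ b) (D : C) (x : PCat (fib X j) D),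
      (compIso (e a) x).hom ≫ (ev (app j') D).map (comp₂ (tr₂ X.toPseudofunctor α) x) =
        (compIso (e b) x).hom)
    (he_id : ∀ (j : J) (D : C) (x : PCat (fib X j) D), (compIso (e (𝟙 j)) x).hom ≫
      (ev (app j) D).map (idIso (trId X.toPseudofunctor j) x).hom = 𝟙 _)
    (he_comp : ∀ {j j' j'' : J} (a : j ⟶ j') (b : j' ⟶ j'') (D : C) (x : PCat (fib X j) D),
      (compIso (e (a ≫ b)) x).hom ≫
        (ev (app j'') D).map (compIso (trComp X.toPseudofunctor a b) x).hom =
        (compIso (e a) x).hom ≫ (compIso (e b) ((ev (ftr X a) D).obj x)).hom) :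
    Pseudocone X.toPseudofunctor W :=
  Pseudofunctor.StrongTrans.mk (fun j => app j.unop) (fun a => λ_ _ ≪≫ e a.unop)
    (fun {j j' a b} α => comp₂_ext fun D x => by
      change 𝟙 _ ≫ 𝟙 _ ≫ (compIso (e b.unop) x).hom = (𝟙 _ ≫ (compIso (e a.unop) x).hom) ≫ _
      simp only [Category.id_comp]
      exact (he₂ α.unop2 D x).symm)
    (fun j => comp₂_ext fun D x => by
      change (𝟙 _ ≫ (compIso (e (𝟙 j.unop)) x).hom) ≫ (ev (app j.unop) D).map
        (idIso (trId X.toPseudofunctor j.unop) x).hom = 𝟙 _ ≫ 𝟙 _ ≫ 𝟙 _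
      simp only [Category.id_comp]
      exact he_id j.unop D x)
    (fun {j j' j''} b a => comp₂_ext fun D x => by
      refine Eq.trans (congrArg (fun m => m ≫ _) (Category.id_comp _))
        ((he_comp a.unop b.unop D x).trans ?_)
      change _ = 𝟙 _ ≫ 𝟙 _ ≫ (𝟙 _ ≫ (compIso (e a.unop) x).hom) ≫ 𝟙 _ ≫
        (𝟙 _ ≫ (compIso (e b.unop) ((ev (ftr X a.unop) D).obj x)).hom) ≫ 𝟙 _
      simp only [Category.id_comp]
      exact congrArg (fun m => _ ≫ m) (Category.comp_id _).symm)

end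

end Pro
end TwoPro

namespace TwoPro

open CategoryTheory Bicategory Opposite

/-! ### The legs of the limit cone. -/

namespace Pro
open scoped Pseudofunctor.StrongTrans
variable {C : Type u} [Bicategory.{v, v} C] [Strict C]
variable {J : Type v} [Bicategory.{v, v} J]

section

variable {X : StrictPseudofunctor Jᵒᵖ (Pro C)} {j : J}

/-- Together with `isCell_up_comp` and `isCell_up_cell`, this gives the coherence data of the
inclusion of the index 2-category of `X^j` into `K_X` along `Rep.up`. Restriction along it defines
the legs. -/
lemma isCell_up_id (i : (fib X j).idx) : IsCell (Rep.up (𝟙 i)) (Rep.id i) (𝟙 (𝟙 j))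
    (trId (fib X j).diagram.toPseudofunctor i).hom := by
  refine IsCell.mk ?_
  rw [tr₂_id, comp₂_id, rep_up]
  refine (Category.id_comp _).trans ((rep_id _).trans (Eq.trans ?_ (Category.assoc _ _ _).symm))
  exact congrArg (fun m => _ ≫ m) (up_id_cell i _).symm

lemma isCell_up_comp {i i' i'' : (fib X j).idx} (u : i ⟶ i') (w : i' ⟶ i'') :
    IsCell (Rep.up (u ≫ w)) ((Rep.up u).comp (Rep.up w)) (ρ_ (𝟙 j)).inv
      (trComp (fib X j).diagram.toPseudofunctor u w).hom := by
  refine IsCell.mk ?_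
  rw [rep_comp_up, ← reassoc_of% @comp₂_comp, ← tr₂_comp, Iso.inv_hom_id, tr₂_id, comp₂_id,
    Category.id_comp, rep_up, rep_up]
  refine (Category.assoc _ _ _).trans (Eq.trans ?_ (Category.assoc _ _ _).symm)
  exact congrArg (fun m => _ ≫ m) (up_comp_cell u w _).symm

lemma isCell_up_cell {i i' : (fib X j).idx} {u w : i ⟶ i'} (α : u ⟶ w) :
    IsCell (Rep.up u) (Rep.up w) (𝟙 (𝟙 j)) (tr₂ (fib X j).diagram.toPseudofunctor α) := by
  refine IsCell.mk ?_
  rw [tr₂_id, comp₂_id, Category.id_comp, rep_up, rep_up, Category.assoc]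
  exact congrArg (fun m => _ ≫ m) (up_cell α _).symm

end

variable [Strict J]

/-- The 2-pro-object indexed by `K_X`. -/
abbrev klim (X : StrictPseudofunctor Jᵒᵖ (Pro C)) (hJ : IsTwoFiltered J) : Pro C :=
  lim X isSmallTwoCategory_K (isTwoFiltered_K hJ)

variable {X : StrictPseudofunctor Jᵒᵖ (Pro C)} {hJ : IsTwoFiltered J}
  {j j' j'' : J} {i : (fib X j).idx} {k : (fib X j').idx} {l : (fib X j'').idx} {D D' : C}

section

variable (hJ) in
def lobj (j : J) (i : (fib X j).idx) (s : (fib X j).at' i ⟶ D) : PCat (klim X hJ) D :=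
  ⟨kobj j i, s⟩

variable (hJ) in
def lcell {s t : (fib X j).at' i ⟶ D} (θ : s ⟶ t) : lobj hJ j i s ⟶ lobj hJ j i t :=
  cell (X := (klim X hJ).diagram.toPseudofunctor) (kobj j i) θ

variable (hJ) in
def lup {a : j ⟶ j'} {r : (fib X j').at' k ⟶ (fib X j).at' i} (φ : Rep X a i k r)
    (s : (fib X j).at' i ⟶ D) : lobj hJ j i s ≅ lobj hJ j' k (r ≫ s) :=
  up (X := (klim X hJ).diagram.toPseudofunctor) (kmk φ) s

lemma lcell_id (s : (fib X j).at' i ⟶ D) : lcell hJ (𝟙 s) = 𝟙 _ :=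
  cell_id (X := (klim X hJ).diagram.toPseudofunctor) (kobj j i) s

lemma lcell_comp {s t p : (fib X j).at' i ⟶ D} (θ : s ⟶ t) (η : t ⟶ p) :
    lcell hJ θ ≫ lcell hJ η = lcell hJ (θ ≫ η) :=
  cell_comp (X := (klim X hJ).diagram.toPseudofunctor) (kobj j i) θ η

lemma lcell_lup {a : j ⟶ j'} {r : (fib X j').at' k ⟶ (fib X j).at' i} (φ : Rep X a i k r)
    {s t : (fib X j).at' i ⟶ D} (θ : s ⟶ t) :
    lcell hJ θ ≫ (lup hJ φ t).hom = (lup hJ φ s).hom ≫ lcell hJ (r ◁ θ) :=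
  cell_up (X := (klim X hJ).diagram.toPseudofunctor) (kmk φ) θ

lemma lup_lcell {a b : j ⟶ j'} {r q : (fib X j').at' k ⟶ (fib X j).at' i} {φ : Rep X a i k r}
    {ψ : Rep X b i k q} {α : a ⟶ b} {θ : r ⟶ q} (h : IsCell φ ψ α θ) (s : (fib X j).at' i ⟶ D) :
    (lup hJ φ s).hom ≫ lcell hJ (θ ▷ s) = (lup hJ ψ s).hom :=
  up_cell (X := (klim X hJ).diagram.toPseudofunctor) (kmk₂ α θ h) s

lemma lup_comp {a : j ⟶ j'} {b : j' ⟶ j''} {r : (fib X j').at' k ⟶ (fib X j).at' i}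
    {q : (fib X j'').at' l ⟶ (fib X j').at' k} (φ : Rep X a i k r) (ψ : Rep X b k l q)
    (s : (fib X j).at' i ⟶ D) :
    (lup hJ (φ.comp ψ) s).hom ≫ lcell hJ (α_ q r s).hom =
      (lup hJ φ s).hom ≫ (lup hJ ψ (r ≫ s)).hom := by
  -- The diagram on `K_X` has identity composition constraints; the whiskered identity is that
  -- constraint.
  have e : 𝟙 (q ≫ r) ▷ s ≫ (α_ q r s).hom = (α_ q r s).hom := by simp
  have := up_comp (X := (klim X hJ).diagram.toPseudofunctor) (kmk φ) (kmk ψ) s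
  exact (congrArg (fun m => (lup hJ (φ.comp ψ) s).hom ≫ lcell hJ m) e).symm.trans this

lemma lup_id (s : (fib X j).at' i ⟶ D) :
    (lup hJ (Rep.id i) s).hom ≫ lcell hJ (λ_ s).hom = 𝟙 _ := by
  have e : 𝟙 (𝟙 _) ▷ s ≫ (λ_ s).hom = (λ_ s).hom := by simp
  have := up_id (X := (klim X hJ).diagram.toPseudofunctor) (kobj j i) s
  exact (congrArg (fun m => (lup hJ (Rep.id i) s).hom ≫ lcell hJ m) e).symm.trans this

end

section

variable (X hJ) in
/-- The inclusion of `colim_i C(X^j_i, D)` into the pseudocolimit indexed by `K_X`. -/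
noncomputable def inclDesc (j : J) (D : C) :
    ColimDesc (fib X j).diagram.toPseudofunctor D (PCat (klim X hJ) D) where
  obj i s := lobj hJ j i s
  map i _ _ θ := lcell hJ θ
  iso u s := lup hJ (Rep.up u) s
  map_id i s := lcell_id s
  map_comp i _ _ _ θ η := (lcell_comp θ η).symm
  naturality u _ _ θ := lcell_lup (Rep.up u) θ
  iso_id i s := by
    rw [← lcell_comp, ← Category.assoc, lup_lcell (isCell_up_id i), lup_id]
  iso_comp u w s := by
    exact (congrArg (fun m => (lup hJ (Rep.up (u ≫ w)) s).hom ≫ m) (lcell_comp _ _).symm).trans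
      ((Category.assoc _ _ _).symm.trans ((congrArg (fun m => m ≫ lcell hJ (α_ _ _ s).hom)
        (lup_lcell (isCell_up_comp u w) s)).trans (lup_comp _ _ s)))
  iso_cell α s := lup_lcell (isCell_up_cell α) s

variable (X hJ) in
/-- The leg at `j` of the limit cone. -/
noncomputable def incl (j : J) : klim X hJ ⟶ fib X j :=
  homMk (fun D => (inclDesc X hJ j D).desc) (fun t x => Iso.refl _)
    (fun {D D'} t {x y} m => naturality_of_generators
      (G := (fib X j).post t ⋙ (inclDesc X hJ j D').desc)
      (H := (inclDesc X hJ j D).desc ⋙ (klim X hJ).post t) (fun x => 𝟙 _)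
      (fun i r s θ => (Category.comp_id _).trans (Category.id_comp _).symm)
      (fun u s => (Category.comp_id _).trans (Category.id_comp _).symm) m)
    (fun σ x => (Category.comp_id _).trans (Category.id_comp _).symm)
    (fun x => Category.id_comp _)
    (fun s t x => by
      change 𝟙 _ ≫ lcell hJ (α_ x.arr s t).inv = lcell hJ (α_ x.arr s t).inv ≫ 𝟙 _ ≫
        ((klim X hJ).post t).map (𝟙 (lobj hJ j x.idx (x.arr ≫ s)))
      rw [Category.id_comp, CategoryTheory.Functor.map_id]
      exact ((congrArg (fun m => lcell hJ (α_ x.arr s t).inv ≫ m) (Category.id_comp _)).trans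
        (Category.comp_id _)).symm)
    (fun t x => ⟨rfl, rfl⟩)

end

section

variable (hJ) in
/-- The structure isomorphisms for the 1-cells of `K_X`. -/
noncomputable def inclUp {a : j ⟶ j'} {r : (fib X j').at' k ⟶ (fib X j).at' i} (φ : Rep X a i k r)
    (s : (fib X j).at' i ⟶ D) :
    (ev (incl X hJ j) D).obj ⟨i, s⟩ ≅ (ev (incl X hJ j') D).obj ⟨k, r ≫ s⟩ :=
  lup hJ φ s

lemma map_cell_inclUp {a : j ⟶ j'} {r : (fib X j').at' k ⟶ (fib X j).at' i} (φ : Rep X a i k r)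
    {s t : (fib X j).at' i ⟶ D} (θ : s ⟶ t) :
    (ev (incl X hJ j) D).map (cell i θ) ≫ (inclUp hJ φ t).hom =
      (inclUp hJ φ s).hom ≫ (ev (incl X hJ j') D).map (cell k (r ◁ θ)) :=
  lcell_lup φ θ

lemma inclUp_cell {a b : j ⟶ j'} {r q : (fib X j').at' k ⟶ (fib X j).at' i} {φ : Rep X a i k r}
    {ψ : Rep X b i k q} {α : a ⟶ b} {θ : r ⟶ q} (h : IsCell φ ψ α θ) (s : (fib X j).at' i ⟶ D) :
    (inclUp hJ φ s).hom ≫ (ev (incl X hJ j') D).map (cell k (θ ▷ s)) = (inclUp hJ ψ s).hom :=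
  lup_lcell h s

lemma inclUp_comp {a : j ⟶ j'} {b : j' ⟶ j''} {r : (fib X j').at' k ⟶ (fib X j).at' i}
    {q : (fib X j'').at' l ⟶ (fib X j').at' k} (φ : Rep X a i k r) (ψ : Rep X b k l q)
    (s : (fib X j).at' i ⟶ D) :
    (inclUp hJ (φ.comp ψ) s).hom =
      (inclUp hJ φ s).hom ≫ (inclUp hJ ψ (r ≫ s)).hom ≫
        (ev (incl X hJ j'') D).map (cell l (α_ q r s).inv) := by
  have h : (inclUp hJ (φ.comp ψ) s).hom ≫ (ev (incl X hJ j'') D).map (cell l (α_ q r s).hom) =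
      (inclUp hJ φ s).hom ≫ (inclUp hJ ψ (r ≫ s)).hom := lup_comp φ ψ s
  rw [← reassoc_of% h, ← Functor.map_comp, cell_comp]
  simp

lemma inclUp_id (s : (fib X j).at' i ⟶ D) :
    (inclUp hJ (Rep.id i) s).hom ≫ (ev (incl X hJ j) D).map (cell i (λ_ s).hom) = 𝟙 _ :=
  lup_id s

lemma inclUp_up {i i' : (fib X j).idx} (u : i ⟶ i') (s : (fib X j).at' i ⟶ D) :
    (inclUp hJ (Rep.up u) s).hom = (ev (incl X hJ j) D).map (up u s).hom := rfl

lemma ntMk_post_inclUp {a : j ⟶ j'} {r : (fib X j').at' k ⟶ (fib X j).at' i} (φ : Rep X a i k r)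
    (s : (fib X j).at' i ⟶ D) (t : D ⟶ D') :
    (ntMk (incl X hJ j) t i s).hom ≫ ((klim X hJ).post t).map (inclUp hJ φ s).hom =
      (inclUp hJ φ (s ≫ t)).hom ≫ (ev (incl X hJ j') D').map (cell k (α_ r s t).inv) ≫
        (ntMk (incl X hJ j') t k (r ≫ s)).hom :=
  (Category.id_comp _).trans
    (congrArg (fun m => (inclUp hJ φ (s ≫ t)).hom ≫ m) (Category.comp_id _).symm)

end

end Pro
end TwoPro

namespace TwoPro

open CategoryTheory Bicategory Opposite

/-! ### The structure 2-cells of the limit cone. -/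

namespace Pro
open scoped Pseudofunctor.StrongTrans
variable {C : Type u} [Bicategory.{v, v} C] [Strict C]
variable {J : Type v} [Bicategory.{v, v} J] [Strict J]
variable {X : StrictPseudofunctor Jᵒᵖ (Pro C)} {hJ : IsTwoFiltered J}
  {j j' j'' : J} {i : (fib X j).idx} {k l : (fib X j').idx} {D D' : C}

section

variable {a b : j ⟶ j'} {r q : (fib X j').at' k ⟶ (fib X j).at' i}

variable (hJ) in
/-- The structure isomorphisms of the limit cone, computed with a 1-cell representing `X^a`. -/
noncomputable def cmp (φ : Rep X a i k r) (s : (fib X j).at' i ⟶ D) :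
    (ev (incl X hJ j) D).obj ⟨i, s⟩ ≅
      (ev (incl X hJ j') D).obj ((ev (ftr X a) D).obj ⟨i, s⟩) :=
  inclUp hJ φ s ≪≫ (ev (incl X hJ j') D).mapIso (rep φ s).symm

lemma cmp_map_rep (φ : Rep X a i k r) (s : (fib X j).at' i ⟶ D) :
    (cmp hJ φ s).hom ≫ (ev (incl X hJ j') D).map (rep φ s).hom = (inclUp hJ φ s).hom := by
  simp only [cmp, Iso.trans_hom, Functor.mapIso_hom, Category.assoc, ← Functor.map_comp,
    Iso.symm_hom, Iso.inv_hom_id, CategoryTheory.Functor.map_id, Category.comp_id]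

lemma cmp_naturality (φ : Rep X a i k r) {s t : (fib X j).at' i ⟶ D} (θ : s ⟶ t) :
    (ev (incl X hJ j) D).map (cell i θ) ≫ (cmp hJ φ t).hom =
      (cmp hJ φ s).hom ≫ (ev (incl X hJ j') D).map ((ev (ftr X a) D).map (cell i θ)) := by
  rw [← cancel_mono ((ev (incl X hJ j') D).map (rep φ t).hom), Category.assoc, Category.assoc,
    cmp_map_rep, ← Functor.map_comp, rep_naturality, Functor.map_comp, reassoc_of% @cmp_map_rep,
    map_cell_inclUp]

lemma cmp_comp₂_of_isCell {φ : Rep X a i k r} {ψ : Rep X b i k q} {α : a ⟶ b} {θ : r ⟶ q}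
    (h : IsCell φ ψ α θ) (s : (fib X j).at' i ⟶ D) :
    (cmp hJ φ s).hom ≫ (ev (incl X hJ j') D).map (comp₂ (tr₂ X.toPseudofunctor α) ⟨i, s⟩) =
      (cmp hJ ψ s).hom := by
  rw [← cancel_mono ((ev (incl X hJ j') D).map (rep ψ s).hom), Category.assoc, cmp_map_rep,
    ← Functor.map_comp, h.comp₂_rep, Functor.map_comp, reassoc_of% @cmp_map_rep, inclUp_cell h]

/-- The transition along `u` enters `cmp` twice, in the structure isomorphism and inversely in
`rep`, and cancels. What remains is the unitor for `a ≫ 𝟙`. -/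
lemma cmp_comp_up (φ : Rep X a i k r) (u : k ⟶ l) (s : (fib X j).at' i ⟶ D) :
    (cmp hJ (φ.comp (Rep.up u)) s).hom ≫
      (ev (incl X hJ j') D).map (comp₂ (tr₂ X.toPseudofunctor (ρ_ a).hom) ⟨i, s⟩) =
      (cmp hJ φ s).hom := by
  let m := rep φ s ≪≫ up u (r ≫ s) ≪≫ cellIso l (α_ (tr _ u) r s).symm
  rw [← cancel_mono ((ev (incl X hJ j') D).map m.hom)]
  simp only [m, Iso.trans_hom, Functor.map_comp, Category.assoc, cellIso_hom, Iso.symm_hom,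
    reassoc_of% @cmp_map_rep]
  rw [← inclUp_up, ← inclUp_comp, ← cmp_map_rep (φ.comp _), rep_comp_up]
  simp only [Functor.map_comp, inclUp_up]

/-- The structure isomorphisms are compatible with all 2-cells of `J`. -/
lemma cmp_comp₂ {q : (fib X j').at' l ⟶ (fib X j).at' i} (φ : Rep X a i k r) (ψ : Rep X b i l q)
    (α : a ⟶ b) (s : (fib X j).at' i ⟶ D) :
    (cmp hJ φ s).hom ≫ (ev (incl X hJ j') D).map (comp₂ (tr₂ X.toPseudofunctor α) ⟨i, s⟩) =
      (cmp hJ ψ s).hom := by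
  -- `X^α`, read through `φ` and `ψ`, is written as a fraction. Its 2-cell belongs to `K_X` after
  -- transitions, and `cmp` does not see the transitions by `cmp_comp_up`.
  obtain ⟨p, hp⟩ := Frac.exists_eval_eq (fib X j').filtered (cell k (ρ_ r).inv ≫
    (rep φ (𝟙 _)).inv ≫ comp₂ (tr₂ X.toPseudofunctor α) ⟨i, 𝟙 _⟩ ≫ (rep ψ (𝟙 _)).hom ≫
      cell l (ρ_ q).hom)
  have h := isCell_comp_up_of_eval φ ψ α p (by
    have h' : cell k (ρ_ r).hom ≫ cell k (ρ_ r).inv =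
      𝟙 (⟨k, r ≫ 𝟙 _⟩ : PCat (fib X j') _) := by simp [cell_comp]
    have h'' : cell l (ρ_ q).hom ≫ cell l (ρ_ q).inv =
      𝟙 (⟨l, q ≫ 𝟙 _⟩ : PCat (fib X j') _) := by simp [cell_comp]
    simp [hp, reassoc_of% h', h''])
  rw [← cmp_comp_up φ p.u, ← cmp_comp_up ψ p.v, ← cmp_comp₂_of_isCell h]
  simp only [tr₂_comp, comp₂_comp, Functor.map_comp, Category.assoc]
  rw [← Functor.map_comp (ev (incl X hJ j') D) (comp₂ (tr₂ X.toPseudofunctor (ρ_ b).inv) _),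
    ← comp₂_comp, ← tr₂_comp, Iso.inv_hom_id, tr₂_id, comp₂_id, CategoryTheory.Functor.map_id]
  exact congrArg (fun m => _ ≫ _ ≫ m) (Category.comp_id _).symm

/-- Independence of the representative, the case of an identity 2-cell. It makes the choices in
`inclIso` harmless and lets each axiom be checked with convenient representatives. -/
lemma cmp_eq {q : (fib X j').at' l ⟶ (fib X j).at' i} (φ : Rep X a i k r) (ψ : Rep X a i l q)
    (s : (fib X j).at' i ⟶ D) : (cmp hJ φ s).hom = (cmp hJ ψ s).hom := by
  rw [← cmp_comp₂ φ ψ (𝟙 a), tr₂_id, comp₂_id, CategoryTheory.Functor.map_id]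
  exact (Category.comp_id _).symm

lemma cmp_comp {b : j' ⟶ j''} {l : (fib X j'').idx} {q : (fib X j'').at' l ⟶ (fib X j').at' k}
    (φ : Rep X a i k r) (ψ : Rep X b k l q) (s : (fib X j).at' i ⟶ D) :
    (cmp hJ (φ.comp ψ) s).hom ≫ (ev (incl X hJ j'') D).map
      ((compIso (trComp X.toPseudofunctor a b) ⟨i, s⟩).hom ≫ (ev (ftr X b) D).map (rep φ s).hom) =
      (inclUp hJ φ s).hom ≫ (cmp hJ ψ (r ≫ s)).hom := by
  let m := rep ψ (r ≫ s) ≪≫ cellIso l (α_ q r s).symm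
  rw [← cancel_mono ((ev (incl X hJ j'') D).map m.hom)]
  simp only [m, Iso.trans_hom, Functor.map_comp, Category.assoc, cellIso_hom, Iso.symm_hom,
    reassoc_of% @cmp_map_rep]
  rw [← inclUp_comp, ← cmp_map_rep (φ.comp _), rep_comp]
  simp only [Functor.map_comp]

lemma cmp_id (s : (fib X j).at' i ⟶ D) : (cmp hJ (Rep.id i) s).hom ≫
    (ev (incl X hJ j) D).map (idIso (trId X.toPseudofunctor j) ⟨i, s⟩).hom = 𝟙 _ := by
  have e := inclUp_id (hJ := hJ) s
  rw [← cmp_map_rep, rep_id, Category.assoc, ← Functor.map_comp, Category.assoc] at e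
  simpa [cell_comp] using e

lemma cmp_nt (φ : Rep X a i k r) (s : (fib X j).at' i ⟶ D) (t : D ⟶ D') :
    (cmp hJ φ (s ≫ t)).hom ≫ (ev (incl X hJ j') D').map (ntMk (ftr X a) t i s).hom ≫
      (nt (incl X hJ j') t ((ev (ftr X a) D).obj ⟨i, s⟩)).hom =
      (ntMk (incl X hJ j) t i s).hom ≫ ((klim X hJ).post t).map (cmp hJ φ s).hom := by
  have e : (ev (incl X hJ j') D').map (postTo (rep φ s).hom t) ≫
      (ntMk (incl X hJ j') t k (r ≫ s)).hom = (nt (incl X hJ j') t _).hom ≫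
        ((klim X hJ).post t).map ((ev (incl X hJ j') D).map (rep φ s).hom) := nt_naturality _ t _
  rw [← cancel_mono (((klim X hJ).post t).map ((ev (incl X hJ j') D).map (rep φ s).hom))]
  simp only [Category.assoc]
  rw [← Functor.map_comp, cmp_map_rep, ntMk_post_inclUp, ← e, ← Functor.map_comp_assoc, ntMk_rep,
    Functor.map_comp_assoc, reassoc_of% @cmp_map_rep]

/-- `(Rep.up u).comp ψ` represents `𝟙 ≫ a` at `i`, and the left unitor of `a` compares it with `φ`.
With `cmp_naturality` this is naturality on all generators. -/
lemma cmp_up {i' : (fib X j).idx} (u : i ⟶ i') {r' : (fib X j').at' l ⟶ (fib X j).at' i'}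
    (φ : Rep X a i k r) (ψ : Rep X a i' l r') (s : (fib X j).at' i ⟶ D) :
    (ev (incl X hJ j) D).map (up u s).hom ≫ (cmp hJ ψ (tr _ u ≫ s)).hom =
      (cmp hJ φ s).hom ≫ (ev (incl X hJ j') D).map ((ev (ftr X a) D).map (up u s).hom) := by
  rw [← inclUp_up, ← cmp_comp, ← cmp_comp₂ ((Rep.up u).comp ψ) φ (λ_ a).hom, ← idIso_compIso,
    rep_up]
  simp only [Functor.map_comp, Category.assoc]

variable (X hJ) in
/-- The structure 2-cells of the limit cone. -/
noncomputable def inclIso (a : j ⟶ j') : incl X hJ j ≅ incl X hJ j' ≫ ftr X a :=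
  hom₂MkIso (fun _ x => cmp hJ (Rep.exists a x.idx).choose_spec.choose_spec.some x.arr)
    (fun D _ _ m => naturality_of_generators (G := ev (incl X hJ j) D)
      (H := ev (ftr X a) D ⋙ ev (incl X hJ j') D)
      (fun x => (cmp hJ (Rep.exists a x.idx).choose_spec.choose_spec.some x.arr).hom)
      (fun _ _ _ θ => cmp_naturality _ θ) (fun u s => cmp_up u _ _ s) m)
    (fun t x => (congrArg (fun m => _ ≫ m) (nt_comp _ _ t x)).trans (cmp_nt _ x.arr t))

lemma inclIso_eq (φ : Rep X a i k r) (s : (fib X j).at' i ⟶ D) :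
    (compIso (inclIso X hJ a) ⟨i, s⟩).hom = (cmp hJ φ s).hom := cmp_eq _ φ s

variable (X hJ) in
/-- The limit cone. -/
noncomputable def limCone : Pseudocone X.toPseudofunctor (klim X hJ) :=
  coneMk (incl X hJ) (inclIso X hJ) (fun {j j' a b} α D x => cmp_comp₂ _ _ α x.arr)
    (fun j D x => by
      obtain ⟨i, s⟩ := x
      exact (congrArg (fun m => m ≫ _) (inclIso_eq (Rep.id i) s)).trans (cmp_id s))
    (fun a b D x => by
      obtain ⟨i, s⟩ := x
      obtain ⟨k, r, ⟨φ⟩⟩ := Rep.exists a i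
      obtain ⟨l, q, ⟨ψ⟩⟩ := Rep.exists b k
      have e := cmp_comp (hJ := hJ) φ ψ s
      have e' := compIso_naturality (inclIso X hJ b) (rep φ s).hom
      rw [inclIso_eq ψ] at e'
      rw [inclIso_eq (φ.comp ψ), inclIso_eq φ,
        ← cancel_mono ((ev (incl X hJ _) D).map ((ev (ftr X b) D).map (rep φ s).hom)),
        Category.assoc, Category.assoc, ← e', reassoc_of% @cmp_map_rep, ← e, Functor.map_comp])

end

end Pro
end TwoPro

namespace TwoPro

open CategoryTheory Bicategory Opposite

/-! ### Universality: full faithfulness, and injectivity on 1-cells. -/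

namespace Pro
open scoped Pseudofunctor.StrongTrans
variable {C : Type u} [Bicategory.{v, v} C] [Strict C]
variable {J : Type v} [Bicategory.{v, v} J]
variable {X : StrictPseudofunctor Jᵒᵖ (Pro C)} {W : Pro C}

lemma eq_eqToIso_of_comp₂ {Y Z : Pro C} {f g : Y ⟶ Z} (e : f ≅ g)
    (h : ∀ (D : C) (x : PCat Z D), ∃ h' : (ev f D).obj x = (ev g D).obj x,
      comp₂ e.hom x = eqToHom h') : ∃ h : f = g, e = eqToIso h :=
  eq_eqToIso e fun D => by
    obtain ⟨h₁, h₂⟩ := Cat.eq_eqToIso (Cat.Hom.isoMk (NatIso.ofComponents (F := ev f D)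
      (G := ev g D) (fun x => comp₂Iso e x) (comp₂_naturality e.hom)))
      (fun x => (h D x).1) (fun x => (h D x).2)
    exact ⟨h₁, congrArg Iso.hom h₂⟩

section

variable {ρ σ : Pseudocone X.toPseudofunctor W}

/-- The components of a morphism of pseudocones. -/
def legMap (μ : ρ ⟶ σ) (j : J) : leg ρ j ⟶ leg σ j := μ.as.app (op j)

lemma legMap_pnat (μ : ρ ⟶ σ) {j j' : J} (a : j ⟶ j') {D : C} (x : PCat (fib X j) D) :
    comp₂ (legMap μ j) x ≫ (pnat σ a x).hom =
      (pnat ρ a x).hom ≫ comp₂ (legMap μ j') ((ev (ftr X a) D).obj x) :=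
  congrArg (fun m => comp₂ m x) (μ.as.naturality a.op)

lemma legMap_ext {μ ν : ρ ⟶ σ} (h : ∀ j, legMap μ j = legMap ν j) : μ = ν :=
  Pseudofunctor.StrongTrans.homCategory.ext fun j => h j.unop

lemma comp₂_legMap_eqToHom (h : ρ = σ) {j : J} {D : C}
    (x : PCat (fib X j) D) : ∃ h', comp₂ (legMap (eqToHom h) j) x = eqToHom h' := by
  subst h
  exact ⟨rfl, rfl⟩

/-- Pseudocones agree if they are isomorphic with identity components. -/
lemma pseudocone_ext (e : ∀ j, leg ρ j ≅ leg σ j)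
    (h : ∀ j (D : C) (x : PCat (fib X j) D), ∃ h : (ev (leg ρ j) D).obj x = (ev (leg σ j) D).obj x,
      comp₂ (e j).hom x = eqToHom h)
    (w : ∀ {j j' : J} (a : j ⟶ j') (D : C) (x : PCat (fib X j) D),
      comp₂ (e j).hom x ≫ (pnat σ a x).hom =
        (pnat ρ a x).hom ≫ comp₂ (e j').hom ((ev (ftr X a) D).obj x)) : ρ = σ := by
  have h₁ : ∀ j, ∃ h : leg ρ j = leg σ j, e j = eqToIso h := fun j => eq_eqToIso_of_comp₂ (e j) (h j)
  obtain ⟨app, nat, _, _, _⟩ := ρ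
  obtain ⟨app', nat', _, _, _⟩ := σ
  obtain rfl : app = app' := funext fun j => (h₁ j.unop).1
  -- Once the legs are identified, the isomorphisms `e` are identities, so `w` equates the structure
  -- cells. The remaining fields are proofs.
  obtain rfl : @nat = @nat' := by
    funext b b' f
    ext1
    refine comp₂_ext fun D x => ?_
    have := w f.unop D x
    rw [(h₁ b'.unop).2, (h₁ b.unop).2] at this
    exact ((Category.comp_id _).symm.trans (this.symm.trans (Category.id_comp _)))
  rfl

end

section

variable [Strict J] {hJ : IsTwoFiltered J} {f g : W ⟶ klim X hJ}

lemma pnat_limCone {j j' : J} {i : (fib X j).idx} {k : (fib X j').idx} {a : j ⟶ j'}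
    {r : (fib X j').at' k ⟶ (fib X j).at' i} (φ : Rep X a i k r) {D : C}
    (s : (fib X j).at' i ⟶ D) :
    (pnat (limCone X hJ) a ⟨i, s⟩).hom = (cmp hJ φ s).hom :=
  (Category.id_comp _).trans (inclIso_eq φ s)

lemma pnat_precomp (f : W ⟶ klim X hJ) {j j' : J} (a : j ⟶ j') {D : C} (x : PCat (fib X j) D) :
    (pnat (((limCone X hJ).precomp W).obj f) a x).hom =
      (ev f D).map (pnat (limCone X hJ) a x).hom := by
  change 𝟙 _ ≫ (𝟙 _ ≫ 𝟙 _) ≫ 𝟙 _ ≫ (ev f D).map (pnat (limCone X hJ) a x).hom ≫ 𝟙 _ = _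
  simp only [Category.id_comp]
  exact Category.comp_id _

variable (μ : ((limCone X hJ).precomp W).obj f ⟶ ((limCone X hJ).precomp W).obj g)

/-- The components of the 2-cell induced by a morphism of pseudocones. -/
noncomputable def liftApp (D : C) (j : J) (x : PCat (fib X j) D) :
    (ev f D).obj ((ev (incl X hJ j) D).obj x) ⟶ (ev g D).obj ((ev (incl X hJ j) D).obj x) :=
  comp₂ (legMap μ j) x

lemma liftApp_naturality (D : C) (j : J) {x y : PCat (fib X j) D} (m : x ⟶ y) :
    (ev f D).map ((ev (incl X hJ j) D).map m) ≫ liftApp μ D j y =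
      liftApp μ D j x ≫ (ev g D).map ((ev (incl X hJ j) D).map m) :=
  comp₂_naturality (legMap μ j) m

lemma liftApp_pnat (D : C) {j j' : J} (a : j ⟶ j') (x : PCat (fib X j) D) :
    liftApp μ D j x ≫ (ev g D).map (pnat (limCone X hJ) a x).hom =
      (ev f D).map (pnat (limCone X hJ) a x).hom ≫ liftApp μ D j' ((ev (ftr X a) D).obj x) := by
  have := legMap_pnat μ a x
  rw [pnat_precomp, pnat_precomp] at this
  exact this

/-- A structure isomorphism of `K_X` is a structure cell of the limit cone followed by the image
under a leg of a morphism. A map of pseudocones is compatible with both. -/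
lemma liftApp_inclUp {j j' : J} {i : (fib X j).idx} {k : (fib X j').idx} {a : j ⟶ j'}
    {r : (fib X j').at' k ⟶ (fib X j).at' i} (φ : Rep X a i k r) {D : C}
    (s : (fib X j).at' i ⟶ D) :
    (ev f D).map (inclUp hJ φ s).hom ≫ liftApp μ D j' ⟨k, r ≫ s⟩ =
      liftApp μ D j ⟨i, s⟩ ≫ (ev g D).map (inclUp hJ φ s).hom := by
  have := liftApp_pnat μ D a ⟨i, s⟩
  rw [pnat_limCone φ] at this
  rw [← cmp_map_rep, Functor.map_comp, Functor.map_comp, Category.assoc, liftApp_naturality]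
  exact (Category.assoc _ _ _).symm.trans ((congrArg (fun m => m ≫ _) this.symm).trans
    (Category.assoc _ _ _))

lemma liftApp_nt (j : J) {D D' : C} (t : D ⟶ D') (x : PCat (fib X j) D) :
    liftApp μ D' j (((fib X j).post t).obj x) ≫ (nt g t ((ev (incl X hJ j) D).obj x)).hom =
      (nt f t ((ev (incl X hJ j) D).obj x)).hom ≫ (W.post t).map (liftApp μ D j x) := by
  have e (f : W ⟶ klim X hJ) : (nt (f ≫ incl X hJ j) t x).hom =
      (nt f t ((ev (incl X hJ j) D).obj x)).hom := by
    refine (nt_comp f (incl X hJ j) t x).trans ?_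
    exact (congrArg (fun m => m ≫ (nt f t ((ev (incl X hJ j) D).obj x)).hom)
      ((ev f D').map_id _)).trans (Category.id_comp _)
  have h := comp₂_nt (legMap μ j) t x
  exact (congrArg (fun m => liftApp μ D' j (((fib X j).post t).obj x) ≫ m) (e g)).symm.trans
    (h.trans (congrArg (fun m => m ≫ (W.post t).map (liftApp μ D j x)) (e f)))

/-- The 2-cell induced by a morphism of pseudocones. -/
noncomputable def lift₂ : f ⟶ g :=
  hom₂Mk (fun D x => liftApp μ D x.idx.j ⟨x.idx.i, x.arr⟩)
    (fun D _ _ m => naturality_of_generators (G := ev f D) (H := ev g D)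
      (fun x => liftApp μ D x.idx.j ⟨x.idx.i, x.arr⟩)
      (fun y _ _ θ => liftApp_naturality μ D y.j 
        (cell (X := (fib X y.j).diagram.toPseudofunctor) y.i θ))
      (fun {y y'} h s => liftApp_inclUp (i := y.i) (k := y'.i) μ h.φ s) m)
    (fun t x => liftApp_nt μ x.idx.j t ⟨x.idx.i, x.arr⟩)

lemma map_lift₂ : ((limCone X hJ).precomp W).map (lift₂ μ) = μ :=
  legMap_ext fun _ => comp₂_ext fun _ _ => rfl

instance : ((limCone X hJ).precomp W).Full := ⟨fun μ => ⟨lift₂ μ, map_lift₂ μ⟩⟩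

/-- An object of the pseudocolimit over `K_X` is `((i, j), s)`, the image of `(i, s)` under the leg
at `j`. The legs therefore see every component of a 2-cell. -/
instance : ((limCone X hJ).precomp W).Faithful := ⟨fun h => comp₂_ext fun _ x =>
  congrArg (fun μ => comp₂ (legMap μ x.idx.j) ⟨x.idx.i, x.arr⟩) h⟩

/-- Full faithfulness lifts the equality of pseudocones to an isomorphism `f ≅ g`. Its components
are those of an identity, so `f = g`. -/
lemma injective_precomp_obj : Function.Injective ((limCone X hJ).precomp W).obj := fun f g h => by
  let e := ((limCone X hJ).precomp W).preimageIso (eqToIso h)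
  have he : ((limCone X hJ).precomp W).map e.hom = eqToHom h :=
    ((limCone X hJ).precomp W).map_preimage _
  refine (eq_eqToIso_of_comp₂ e fun D x => ?_).1
  obtain ⟨h', e'⟩ := comp₂_legMap_eqToHom h (⟨x.idx.i, x.arr⟩ : PCat (fib X x.idx.j) D)
  rw [← he] at e'
  exact ⟨h', e'⟩

end

end Pro
end TwoPro

/-! ### Universality: the 1-cell induced by a pseudocone. -/

namespace TwoPro

open CategoryTheory Bicategory Opposite

lemma Cat.toNatIso_eqToIso_app {A B : Cat.{v, u}} {F G : A ⟶ B} (h : F = G) (x : A) :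
    ∃ h', (Cat.Hom.toNatIso (eqToIso h)).hom.app x = eqToHom h' := by
  subst h
  exact ⟨rfl, rfl⟩

namespace Pro
open scoped Pseudofunctor.StrongTrans
variable {C : Type u} [Bicategory.{v, v} C] [Strict C]

/-- The naturality cells of `lift` are those of the legs of `ρ`. Strict 2-naturality of the legs is
what makes `lift` a 1-cell. -/
lemma nt_eq_eqToHom {X Y : Pro C} (f : X ⟶ Y) {D D' : C} (t : D ⟶ D') (x : PCat Y D) :
    ∃ h, (nt f t x).hom = eqToHom h := by
  obtain ⟨h, e⟩ := Hom.isTwoNatural f t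
  obtain ⟨h', e'⟩ := Cat.toNatIso_eqToIso_app h x
  rw [← e] at e'
  exact ⟨h', e'⟩

variable {J : Type v} [Bicategory.{v, v} J]
variable {X : StrictPseudofunctor Jᵒᵖ (Pro C)} {W : Pro C} (ρ : Pseudocone X.toPseudofunctor W)
  {j j' j'' : J} {i : (fib X j).idx} {k : (fib X j').idx} {l : (fib X j'').idx} {D D' : C}

section

variable {a b : j ⟶ j'} {r q : (fib X j').at' k ⟶ (fib X j).at' i}

/-- The isomorphism assigned by a pseudocone to a 1-cell of `K_X`. -/
def legUp (φ : Rep X a i k r) (s : (fib X j).at' i ⟶ D) :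
    (ev (leg ρ j) D).obj ⟨i, s⟩ ≅ (ev (leg ρ j') D).obj ⟨k, r ≫ s⟩ :=
  pnat ρ a ⟨i, s⟩ ≪≫ (ev (leg ρ j') D).mapIso (rep φ s)

lemma legUp_hom (φ : Rep X a i k r) (s : (fib X j).at' i ⟶ D) :
    (legUp ρ φ s).hom = (pnat ρ a ⟨i, s⟩).hom ≫ (ev (leg ρ j') D).map (rep φ s).hom := rfl

lemma legUp_naturality (φ : Rep X a i k r) {s t : (fib X j).at' i ⟶ D} (θ : s ⟶ t) :
    (ev (leg ρ j) D).map (cell i θ) ≫ (legUp ρ φ t).hom =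
      (legUp ρ φ s).hom ≫ (ev (leg ρ j') D).map (cell k (r ◁ θ)) := by
  rw [legUp_hom, legUp_hom, reassoc_of% @pnat_naturality, Category.assoc, ← Functor.map_comp,
    ← Functor.map_comp, rep_naturality]

lemma legUp_cell {φ : Rep X a i k r} {ψ : Rep X b i k q} {α : a ⟶ b} {θ : r ⟶ q}
    (h : IsCell φ ψ α θ) (s : (fib X j).at' i ⟶ D) :
    (legUp ρ φ s).hom ≫ (ev (leg ρ j') D).map (cell k (θ ▷ s)) = (legUp ρ ψ s).hom := by
  rw [legUp_hom, legUp_hom, Category.assoc, ← Functor.map_comp, ← h.comp₂_rep, Functor.map_comp,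
    reassoc_of% @pnat_comp₂]

lemma legUp_comp {b : j' ⟶ j''} {q : (fib X j'').at' l ⟶ (fib X j').at' k} (φ : Rep X a i k r)
    (ψ : Rep X b k l q) (s : (fib X j).at' i ⟶ D) :
    (legUp ρ (φ.comp ψ) s).hom ≫ (ev (leg ρ j'') D).map (cell l (α_ q r s).hom) =
      (legUp ρ φ s).hom ≫ (legUp ρ ψ (r ≫ s)).hom := by
  have e : (legUp ρ (φ.comp ψ) s).hom = (legUp ρ φ s).hom ≫ (legUp ρ ψ (r ≫ s)).hom ≫
      (ev (leg ρ j'') D).map (cell l (α_ q r s).inv) := by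
    simp only [legUp_hom, Category.assoc, reassoc_of% @pnat_naturality, rep_comp, Functor.map_comp,
      reassoc_of% @pnat_comp]
  rw [e, Category.assoc, Category.assoc, ← Functor.map_comp, cell_comp]
  simp

lemma legUp_id (s : (fib X j).at' i ⟶ D) :
    (legUp ρ (Rep.id i) s).hom ≫ (ev (leg ρ j) D).map (cell i (λ_ s).hom) = 𝟙 _ := by
  have e : cell i (λ_ s).inv ≫ cell i (λ_ s).hom = 𝟙 (⟨i, s⟩ : PCat (fib X j) D) := by
    simp [cell_comp]
  have e' : (rep (Rep.id i) s).hom ≫ cell i (λ_ s).hom =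
      (idIso (trId X.toPseudofunctor j) ⟨i, s⟩).hom := by
    rw [rep_id, Category.assoc, e, Category.comp_id]
  rw [legUp_hom, Category.assoc, ← Functor.map_comp, e', pnat_id]

/-- Over an identity of `J` the structure cell of `ρ` cancels against the unit constraint in
`rep_up`. Thus `lift` restricts on each fibre to the given leg. -/
lemma legUp_up {i' : (fib X j).idx} (u : i ⟶ i') (s : (fib X j).at' i ⟶ D) :
    (legUp ρ (Rep.up u) s).hom = (ev (leg ρ j) D).map (up u s).hom := by
  rw [legUp_hom, rep_up, Functor.map_comp, reassoc_of% @pnat_id]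

lemma legUp_ntMk (φ : Rep X a i k r) (s : (fib X j).at' i ⟶ D) (t : D ⟶ D') :
    (legUp ρ φ (s ≫ t)).hom ≫ (ev (leg ρ j') D').map (cell k (α_ r s t).inv) ≫
      (ntMk (leg ρ j') t k (r ≫ s)).hom =
      (ntMk (leg ρ j) t i s).hom ≫ (W.post t).map (legUp ρ φ s).hom := by
  have e : (pnat ρ a ⟨i, s ≫ t⟩).hom ≫ (ev (leg ρ j') D').map (ntMk (ftr X a) t i s).hom ≫
      (nt (leg ρ j') t ((ev (ftr X a) D).obj ⟨i, s⟩)).hom =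
      (ntMk (leg ρ j) t i s).hom ≫ (W.post t).map (pnat ρ a ⟨i, s⟩).hom := pnat_nt ρ a t ⟨i, s⟩
  have e' : (ev (leg ρ j') D').map (postTo (rep φ s).hom t) ≫ (ntMk (leg ρ j') t k (r ≫ s)).hom =
      (nt (leg ρ j') t _).hom ≫ (W.post t).map ((ev (leg ρ j') D).map (rep φ s).hom) :=
    nt_naturality _ t _
  rw [legUp_hom, legUp_hom, Functor.map_comp, ← reassoc_of% e, ← e', Category.assoc,
    ← Functor.map_comp_assoc, ← Functor.map_comp_assoc, ntMk_rep]

end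

section

variable [Strict J] (hJ : IsTwoFiltered J)

/-- The functor induced by a pseudocone, as a pseudocone in `Cat`. -/
def liftDesc (D : C) :
    ColimDesc (klim X hJ).diagram.toPseudofunctor D (PCat W D) where
  obj (x : K X) s := (ev (leg ρ x.j) D).obj ⟨x.i, s⟩
  map (x : K X) _ _ θ := (ev (leg ρ x.j) D).map
    (cell (X := (fib X x.j).diagram.toPseudofunctor) x.i θ)
  iso {x y : K X} h s := legUp ρ (i := x.i) (k := y.i) h.φ s
  map_id (x : K X) s := (congrArg (fun m => (ev (leg ρ x.j) D).map m)
    (cell_id (X := (fib X x.j).diagram.toPseudofunctor) x.i s)).trans ((ev (leg ρ x.j) D).map_id _)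
  map_comp (x : K X) _ _ _ θ η := (congrArg (fun m => (ev (leg ρ x.j) D).map m)
    (cell_comp (X := (fib X x.j).diagram.toPseudofunctor) x.i θ η)).symm.trans
      ((ev (leg ρ x.j) D).map_comp _ _)
  naturality {x y : K X} h _ _ θ := legUp_naturality ρ (i := x.i) (k := y.i) h.φ θ
  iso_id (x : K X) s := by
    have e : 𝟙 (𝟙 _) ▷ s ≫ (λ_ s).hom = (λ_ s).hom := by simp
    exact (congrArg (fun m => (legUp ρ (Rep.id x.i) s).hom ≫ (ev (leg ρ x.j) D).map
      (cell (X := (fib X x.j).diagram.toPseudofunctor) x.i m)) e).trans (legUp_id ρ s)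
  iso_comp {x y z : K X} h h' s := by
    have e {A B E : C} (p : A ⟶ B) (q : B ⟶ E) (s : E ⟶ D) :
        𝟙 (p ≫ q) ▷ s ≫ (α_ p q s).hom = (α_ p q s).hom := by simp
    exact (congrArg (fun m => (legUp ρ (i := x.i) (k := z.i)
      (Rep.comp (i := x.i) (k := y.i) (l := z.i) h.φ h'.φ) s).hom ≫ (ev (leg ρ z.j) D).map
        (cell (X := (fib X z.j).diagram.toPseudofunctor) z.i m)) (e _ _ s)).trans
          (legUp_comp ρ (i := x.i) (k := y.i) (l := z.i) h.φ h'.φ s)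
  iso_cell {x y : K X} {h h'} η s := legUp_cell ρ (i := x.i) (k := y.i) η.w s

/-- The 1-cell induced by a pseudocone. -/
def lift : W ⟶ klim X hJ :=
  homMk (fun D => (liftDesc ρ hJ D).desc) (fun t x => nt (leg ρ x.idx.j) t ⟨x.idx.i, x.arr⟩)
    (fun {D D'} t {_ _} m => naturality_of_generators
      (G := (klim X hJ).post t ⋙ (liftDesc ρ hJ D').desc)
      (H := (liftDesc ρ hJ D).desc ⋙ W.post t)
      (fun x => (nt (leg ρ x.idx.j) t ⟨x.idx.i, x.arr⟩).hom)
      (fun y _ _ θ => ntMk_naturality (leg ρ y.j) t y.i θ)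
      (fun {y y'} h s => (Category.assoc _ _ _).trans
        (legUp_ntMk ρ (i := y.i) (k := y'.i) h.φ s t)) m)
    (fun σ x => nt_postMap₂ (leg ρ x.idx.j) σ ⟨x.idx.i, x.arr⟩)
    (fun x => nt_id (leg ρ x.idx.j) ⟨x.idx.i, x.arr⟩)
    (fun s t x => nt_post_comp (leg ρ x.idx.j) s t ⟨x.idx.i, x.arr⟩)
    (fun t x => nt_eq_eqToHom (leg ρ x.idx.j) t ⟨x.idx.i, x.arr⟩)

/-- The functors agree definitionally on objects and cells, but on transitions only by `legUp_up`.
The identities put this in the shape of a naturality square, which can be checked on generators. -/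
lemma map_lift_incl {x y : PCat (fib X j) D} (m : x ⟶ y) :
    (ev (lift ρ hJ) D).map ((ev (incl X hJ j) D).map m) ≫ 𝟙 _ =
      𝟙 _ ≫ (ev (leg ρ j) D).map m :=
  naturality_of_generators (G := ev (incl X hJ j) D ⋙ ev (lift ρ hJ) D) (H := ev (leg ρ j) D)
    (fun _ => 𝟙 _) (fun _ _ _ _ => (Category.comp_id _).trans (Category.id_comp _).symm)
    (fun u s => (Category.comp_id _).trans ((legUp_up ρ u s).trans (Category.id_comp _).symm)) m

/-- The legs of the cone induced by `lift`. -/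
noncomputable def legLift (j : J) : leg (((limCone X hJ).precomp W).obj (lift ρ hJ)) j ≅ leg ρ j :=
  hom₂MkIso (fun D x => Iso.refl ((ev (leg ρ j) D).obj x))
    (fun D x y m => map_lift_incl ρ hJ m)
    (fun {D D'} t x => by
      have e : (nt (lift ρ hJ ≫ incl X hJ j) t x).hom = (nt (leg ρ j) t x).hom :=
        (nt_comp (lift ρ hJ) (incl X hJ j) t x).trans
          ((congrArg (fun m => m ≫ (nt (leg ρ j) t x).hom)
            ((ev (lift ρ hJ) D').map_id _)).trans (Category.id_comp _))
      refine (Category.id_comp _).trans (e.symm.trans ?_)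
      exact ((congrArg (fun m => _ ≫ m) ((W.post t).map_id _)).trans (Category.comp_id _)).symm)

/-- The comparison of legs has identity components, so only the structure cells have to be compared.
They agree after composition with the invertible image of `rep φ s`, where both give `legUp`. -/
lemma precomp_lift : ((limCone X hJ).precomp W).obj (lift ρ hJ) = ρ :=
  pseudocone_ext (legLift ρ hJ) (fun _ _ _ => ⟨rfl, rfl⟩) (fun {j j'} a D x => by
    obtain ⟨i, s⟩ := x
    obtain ⟨k, r, ⟨φ⟩⟩ := Rep.exists a i
    refine (Category.id_comp _).trans (Eq.trans ?_ (Category.comp_id _).symm)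
    rw [pnat_precomp, pnat_limCone φ]
    have e₁ := congrArg (fun m => (ev (lift ρ hJ) D).map m) (cmp_map_rep (hJ := hJ) φ s)
    have e₂ := (Category.comp_id _).symm.trans
      ((map_lift_incl ρ hJ (rep φ s).hom).trans (Category.id_comp _))
    -- On the `lift` side, `cmp` followed by `rep` is `inclUp`, which `lift` sends to `legUp` by
    -- construction.
    refine (cancel_mono ((ev (leg ρ j') D).map (rep φ s).hom)).1 ?_
    refine (legUp_hom ρ φ s).symm.trans (Eq.symm ?_)
    refine (congrArg (fun m => (ev (lift ρ hJ) D).map (cmp hJ φ s).hom ≫ m) e₂).symm.trans ?_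
    exact ((ev (lift ρ hJ) D).map_comp _ _).symm.trans e₁)

lemma isPseudolimit_limCone : IsPseudolimit (limCone X hJ) where
  full _ := inferInstance
  faithful _ := inferInstance
  bijective _ := ⟨injective_precomp_obj, fun ρ => ⟨lift ρ hJ, precomp_lift ρ hJ⟩⟩

end

end Pro
end TwoPro

theorem mainTheorem3 {C : Type u} [Bicategory.{v, v} C] [Bicategory.Strict C]
    {J : Type v} [Bicategory.{v, v} J] [Bicategory.Strict J] (hJ : IsTwoFiltered J)
    (X : StrictPseudofunctor Jᵒᵖ (Pro C)) :
    ∃ (hs : IsSmallTwoCategory (Pro.K X)) (hf : IsTwoFiltered (Pro.K X))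
      (π : Pseudocone X.toPseudofunctor (Pro.lim X hs hf)), IsPseudolimit π :=
  ⟨Pro.isSmallTwoCategory_K, Pro.isTwoFiltered_K hJ, Pro.limCone X hJ,
    Pro.isPseudolimit_limCone hJ⟩
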